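/- The tropical product $B\otimes C$ of $B\in\mathbb{R}^{m\times k}$ and $C\in\mathbb{R}^{k\times n}$ has the entries $(B\otimes C)_{ij}=\min_{1\le t\le k}(B_{it}+C_{tj})$, and the factor rank of $A\in\mathbb{R}^{m\times n}$ is the smallest $k$ for which there are real matrices $B\in\mathbb{R}^{m\times k}$, $C\in\mathbb{R}^{k\times n}$ with $B\otimes C=A$. Integer matrices (with $m,n\ge 1$) are given as words over the alphabet consisting of the ten decimal digits, the signs $+$ and $-$, a space and an end-of-line symbol: each entry is written as a sign followed by its decimal digits; entries of a row are separated by spaces, and each row is ended by an end-of-line symbol. For an integer matrix $A$ let $h(A)=|\max_{i,j} A_{ij}|+|\min_{i,j} A_{ij}|$. 1. The problem TMF, "given $A\in\mathbb{Z}^{m\times n}$ and a positive integer $k$ (written in decimal), is the factor rank of $A$ at most $k$?", belongs to the class NP. More precisely, the integer factorizations of $A$ with entries bounded by $h(A)$ serve as certificates. With $r=\min\{k,m,n\}$, the relation "$w$ is the text of a matrix $B\in\mathbb{Z}^{m\times r}$ followed by the text of a matrix $C\in\mathbb{Z}^{r\times n}$ such that $B\otimes C=A$ and $|B_{it}|\le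 h(A)$, $|C_{tj}|\le h(A)$ for all $i,t,j$" between the input $(A,k)$ and the word $w$ is decidable in polynomial time, and $(A,k)$ is a yes-instance if and only if it has such a certificate $w$ of polynomially bounded length. 2. If $A\in\mathbb{Z}^{m\times n}$ has factor rank at most $k$, where $k\ge 1$, then there are $B\in\mathbb{Z}^{m\times k}$ and $C\in\mathbb{Z}^{k\times n}$ with $B\otimes C=A$ and $|B_{it}|\le h(A)$, $|C_{tj}|\le h(A)$ for all $i,t,j$. 3. For every fixed positive integer $k$, the problem $k$-TMF, "given $A\in\mathbb{Z}^{m\times n}$, are there $B\in\mathbb{R}^{m\times k}$ and $C\in\mathbb{R}^{k\times n}$ with $B\otimes C=A$?", belongs to NP. -/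

import Mathlib

/-! ### Tropical matrices and factor rank -/

/-- `B ⊗ C = A` over the tropical semiring (`a ⊕ b = min a b`, `a ⊗ b = a + b`): every entry
`A i j` is the minimum over `t` of the numbers `B i t + C t j`. -/
def IsTropicalProduct {R : Type} [LinearOrder R] [Add R] {m k n : ℕ}
    (B : Matrix (Fin m) (Fin k) R) (C : Matrix (Fin k) (Fin n) R)
    (A : Matrix (Fin m) (Fin n) R) : Prop :=
  ∀ i j, IsLeast (Set.range fun t : Fin k => B i t + C t j) (A i j)

/-- The factor rank of a real matrix `A`: the smallest `k` for which there are real matrices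
`B` (of size `m × k`) and `C` (of size `k × n`) with `B ⊗ C = A`. -/
noncomputable def factorRank {m n : ℕ} (A : Matrix (Fin m) (Fin n) ℝ) : ℕ :=
  sInf {k : ℕ | ∃ (B : Matrix (Fin m) (Fin k) ℝ) (C : Matrix (Fin k) (Fin n) ℝ),
    IsTropicalProduct B C A}

/-- An integer matrix, regarded as a real one. -/
def Matrix.toReal {m n : ℕ} (A : Matrix (Fin m) (Fin n) ℤ) : Matrix (Fin m) (Fin n) ℝ :=
  A.map fun z : ℤ => (z : ℝ)

/-- `B ⊗ C = A` for integer matrices, all entries of `B` and of `C` being at most `|g| + |l|` in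
absolute value, where `g` and `l` are the greatest and the least entry of `A`. -/
def IsBoundedFactorization {m k n : ℕ} (A : Matrix (Fin m) (Fin n) ℤ)
    (B : Matrix (Fin m) (Fin k) ℤ) (C : Matrix (Fin k) (Fin n) ℤ) : Prop :=
  IsTropicalProduct B C A ∧
    ∃ g l : ℤ,
      IsGreatest (Set.range fun p : Fin m × Fin n => A p.1 p.2) g ∧
      IsLeast (Set.range fun p : Fin m × Fin n => A p.1 p.2) l ∧
      (∀ i t, |B i t| ≤ |g| + |l|) ∧ (∀ t j, |C t j| ≤ |g| + |l|)

/-! ### Integer matrices as words in the decimal system -/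

/-- The alphabet: the ten decimal digits, the two signs, a space, and an end-of-line symbol. -/
inductive TextSymbol : Type
  | digit (d : Fin 10)
  | plus
  | minus
  | space
  | newline
  deriving DecidableEq, Fintype

/-- The decimal digits of a natural number, most significant digit first, without leading zeros
(and `0` for the number zero). -/
def natText (a : ℕ) : List TextSymbol :=
  if a = 0 then [TextSymbol.digit 0]
  else ((Nat.digits 10 a).map fun d => TextSymbol.digit (Fin.ofNat 10 d)).reverse

/-- An integer: a sign (`+` for zero) followed by the decimal digits of the absolute value. -/
def intText (z : ℤ) : List TextSymbol :=
  (if z < 0 then TextSymbol.minus else TextSymbol.plus) :: natText z.natAbs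

/-- A row of a matrix: its entries separated by spaces, and an end-of-line symbol. -/
def rowText {n : ℕ} (v : Fin n → ℤ) : List TextSymbol :=
  [TextSymbol.space].intercalate (List.ofFn fun j => intText (v j)) ++ [TextSymbol.newline]

/-- A matrix: its rows, from top to bottom. -/
def matrixText {m n : ℕ} (A : Matrix (Fin m) (Fin n) ℤ) : List TextSymbol :=
  (List.ofFn fun i => rowText (A i)).flatten

/-- The input word of an instance `(A, k)`: a line with the number `k`, then the matrix `A`. -/
def instanceText {m n : ℕ} (A : Matrix (Fin m) (Fin n) ℤ) (k : ℕ) : List TextSymbol :=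
  intText k ++ [TextSymbol.newline] ++ matrixText A

/-! ### The class NP -/

/-- The pair of an input `x` and a certificate `w`, as one word: `x` followed by `w`, the letters
of the two being kept apart. -/
def pairWord {Γ Δ : Type} (xw : List Γ × List Δ) : List (Γ ⊕ Δ) :=
  xw.1.map Sum.inl ++ xw.2.map Sum.inr

/-- A relation between words that a deterministic (multi-stack) Turing machine decides in time
polynomial in the total length of the two words. -/
def PolyTimeDecidableRel {Γ Δ : Type} (R : List Γ → List Δ → Prop) : Prop :=
  ∃ V : List Γ × List Δ → Bool,
    (∀ x w, V (x, w) = true ↔ R x w) ∧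
    Nonempty (Turing.TM2ComputableInPolyTime pairWord Computability.encodeBool V)

/-- `R x w` is a polynomial-time decidable relation `w is a certificate for x`, and the words of
the language `L` are exactly those which have a certificate of polynomially bounded length. -/
def IsCertificateRel {Γ Δ : Type} (L : Language Γ) (R : List Γ → List Δ → Prop) : Prop :=
  PolyTimeDecidableRel R ∧
    ∃ p : Polynomial ℕ, ∀ x, x ∈ L ↔ ∃ w : List Δ, w.length ≤ p.eval x.length ∧ R x w

/-- The class NP of languages: the certificates are words over some finite alphabet `Δ`. -/
def InNP {Γ : Type} (L : Language Γ) : Prop :=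
  ∃ (Δ : Type) (_ : Fintype Δ) (R : List Γ → List Δ → Prop), IsCertificateRel L R

/-! ### The decision problems -/

/-- TMF: given a (nonempty) integer matrix `A` and a positive integer `k`, is the factor rank of
`A` at most `k`? -/
def TMF : Language TextSymbol :=
  {x | ∃ (m n k : ℕ) (A : Matrix (Fin m) (Fin n) ℤ), 0 < m ∧ 0 < n ∧ 0 < k ∧
    x = instanceText A k ∧ factorRank A.toReal ≤ k}

/-- `k`-TMF, for a fixed `k`: given a (nonempty) integer matrix `A` of size `m × n`, are there
real matrices `B` of size `m × k` and `C` of size `k × n` with `B ⊗ C = A`? -/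
def kTMF (k : ℕ) : Language TextSymbol :=
  {x | ∃ (m n : ℕ) (A : Matrix (Fin m) (Fin n) ℤ), 0 < m ∧ 0 < n ∧ x = matrixText A ∧
    ∃ (B : Matrix (Fin m) (Fin k) ℝ) (C : Matrix (Fin k) (Fin n) ℝ),
      IsTropicalProduct B C A.toReal}

/-- The word `w` is a factorization certificate for the instance `x = (A, k)` of TMF, where `A` is
an `m × n` matrix: `w` is the text of an integer `m × r` matrix `B` followed by the text of an
integer `r × n` matrix `C`, where `r = min (k, m, n)`, the entries of `B` and `C` are at most
`|max A| + |min A|` in absolute value, and `B ⊗ C = A`. -/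
def IsFactorizationCertificate (x w : List TextSymbol) : Prop :=
  ∃ (m n k : ℕ) (A : Matrix (Fin m) (Fin n) ℤ)
    (B : Matrix (Fin m) (Fin (min k (min m n))) ℤ) (C : Matrix (Fin (min k (min m n))) (Fin n) ℤ),
    0 < m ∧ 0 < n ∧ 0 < k ∧ x = instanceText A k ∧ w = matrixText B ++ matrixText C ∧
    IsBoundedFactorization A B C

/-! Integrality and bounds. In a real factorization of an integer matrix, round the left factor down
and the right factor up. Where a sum equals the entry of `A`, the two rounding errors cancel;
elsewhere the sum drops by less than one and so cannot fall below the integer entry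
(`IsTropicalProduct.floor_ceil`). Next, shift each column of `B` to have minimum zero, compensating
in the row of `C`, and truncate the large entries. With `g` and `l` the extreme entries of `A`,
minimizing sums involve only left entries in `[0, g - l]` and right entries in `[l, g]`, so
truncation at `g - l` and `g` is harmless (`IsTropicalProduct.exists_bounded`). As the factor rank
never exceeds `min m n`, yes-instances are exactly those with a bounded factorization of inner size
`min k (min m n)`, and its text has length quadratic in that of the instance.

Polynomial-time checking. The verifier is obtained by compilation, in three layers. A `RegProg`
manipulates positions of the word; a register is a pair of stacks holding the word split at its
position, and `code_reachesIn` simulates the program step by step. A `Tm` is a term for a number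
bounded by the word length, with recursion of bounded length, and `Tm.exists_does_compile` gives a
polynomial bound on its running time. Finally `Definable` and `DefinablePred` are the functions and
predicates given by such terms, closed under arithmetic, Boolean operations and quantifiers bounded
by the word length. A relation written as such a formula is therefore decidable in polynomial time
(`DefinablePred.nonempty_computableInPolyTime`).

Long integers. Matrix entries may be exponential in the length of the text, so they never enter a
register. All conditions on a certificate are reduced to signs of sums of three signed entries or
absolute values, and such a sign is read off from the final carry of a digitwise addition
(`nonnegSum_iff`), where the carry stays below a constant. The number `k` enters only through `min k
(min m n)`, so it may be cut off at the text length (`headValue_eq`).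

`isCertifiedWord_iff` identifies the resulting formula with the certificate relation. Fixing `k`
amounts to hardwiring the line with `k` as a prefix of the input (`mem_kTMF_iff`). -/

/-! ### Bounded integer factorizations -/

section Tropical

variable {m n k : ℕ}

/-- Rounding the left factor down and the right factor up keeps an integer product. -/
theorem IsTropicalProduct.floor_ceil {A : Matrix (Fin m) (Fin n) ℤ}
    {B : Matrix (Fin m) (Fin k) ℝ} {C : Matrix (Fin k) (Fin n) ℝ}
    (h : IsTropicalProduct B C A.toReal) :
    IsTropicalProduct (fun i t => ⌊B i t⌋) (fun t j => ⌈C t j⌉) A := by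
  intro i j
  obtain ⟨⟨t, ht⟩, hle⟩ := h i j
  simp only [Matrix.toReal, Matrix.map_apply] at ht hle
  refine ⟨⟨t, ?_⟩, ?_⟩
  -- At a minimizing index, `⌈A - B⌉ = A - ⌊B⌋` since the entry of `A` is an integer: no error
  -- remains.
  · have : C t j = (A i j : ℝ) + -B i t := by linarith
    simp only [this, Int.ceil_intCast_add, Int.ceil_neg]
    ring
  · rintro _ ⟨s, rfl⟩
    have h1 := hle ⟨s, rfl⟩
    simp only at h1
    -- Only the floor loses anything, and it loses less than one; an integer greater than `A i j -
    -- 1` is at least `A i j`.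
    have h2 : (A i j : ℝ) < (⌊B i s⌋ + ⌈C s j⌉ + 1 : ℤ) := by
      push_cast
      linarith [Int.lt_floor_add_one (B i s), Int.le_ceil (C s j)]
    have := Int.cast_lt.1 h2
    show A i j ≤ ⌊B i s⌋ + ⌈C s j⌉
    omega

/-- An integer factorization can be normalized to have small entries. -/
theorem IsTropicalProduct.exists_bounded (hm : 0 < m) (hn : 0 < n)
    {A : Matrix (Fin m) (Fin n) ℤ} {B : Matrix (Fin m) (Fin k) ℤ} {C : Matrix (Fin k) (Fin n) ℤ}
    (h : IsTropicalProduct B C A) :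
    ∃ (B' : Matrix (Fin m) (Fin k) ℤ) (C' : Matrix (Fin k) (Fin n) ℤ),
      IsBoundedFactorization A B' C' := by
  have : Nonempty (Fin m) := ⟨⟨0, hm⟩⟩
  have : Nonempty (Fin n) := ⟨⟨0, hn⟩⟩
  obtain ⟨⟨gi, gj⟩, hg⟩ := Finite.exists_max fun p : Fin m × Fin n => A p.1 p.2
  obtain ⟨⟨li, lj⟩, hl⟩ := Finite.exists_min fun p : Fin m × Fin n => A p.1 p.2
  set g := A gi gj with hgdef
  set l := A li lj with hldef
  replace hg : ∀ i j, A i j ≤ g := fun i j => hg (i, j)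
  replace hl : ∀ i j, l ≤ A i j := fun i j => hl (i, j)
  choose r hr using fun t : Fin k => Finite.exists_min fun i => B i t
  have hlg : l ≤ g := hl _ _
  have hB : ∀ i t, 0 ≤ B i t - B (r t) t := fun i t => by linarith [hr t i]
  have hle : ∀ i t j, A i j ≤ B i t + C t j := fun i t j => (h i j).2 ⟨t, rfl⟩
  -- After the shift, left entries are nonnegative, and right entries are at least `l` because row
  -- `r t` has left entry zero. Hence a minimizing pair has left part at most `g - l` and right part
  -- at most `g`, and is untouched. A sum with a truncated summand is still at least `g`.
  refine ⟨fun i t => min (B i t - B (r t) t) (g - l), fun t j => min (C t j + B (r t) t) g,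
    fun i j => ⟨?_, ?_⟩, g, l, ⟨⟨(gi, gj), rfl⟩, ?_⟩, ⟨⟨(li, lj), rfl⟩, ?_⟩, fun i t => ?_,
    fun t j => ?_⟩
  · obtain ⟨t, ht⟩ := (h i j).1
    refine ⟨t, ?_⟩
    simp only at ht ⊢
    have h1 := hle (r t) t j
    have h2 := hl (r t) j
    have h3 := hg i j
    have h4 := hB i t
    rw [min_eq_left (by linarith), min_eq_left (by linarith)]
    linarith
  · rintro _ ⟨t, rfl⟩
    have h0 := hle i t j
    have h1 := hle (r t) t j
    have h2 := hl (r t) j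
    have h3 := hg i j
    have h4 := hB i t
    simp only
    omega
  · rintro _ ⟨p, rfl⟩
    exact hg _ _
  · rintro _ ⟨p, rfl⟩
    exact hl _ _
  · have h4 := hB i t
    simp only
    rw [abs_of_nonneg (by omega)]
    have := le_abs_self g
    have := neg_abs_le l
    omega
  · have h1 := hle (r t) t j
    have h2 := hl (r t) j
    simp only
    have := le_abs_self g
    have := neg_abs_le l
    have := abs_nonneg g
    have := abs_nonneg l
    rw [abs_le]
    omega

/-! ### Real factorizations and the factor rank. -/

theorem IsTropicalProduct.toReal {A : Matrix (Fin m) (Fin n) ℤ}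
    {B : Matrix (Fin m) (Fin k) ℤ} {C : Matrix (Fin k) (Fin n) ℤ}
    (h : IsTropicalProduct B C A) : IsTropicalProduct B.toReal C.toReal A.toReal := by
  intro i j
  obtain ⟨⟨t, ht⟩, hle⟩ := h i j
  simp only [Matrix.toReal, Matrix.map_apply]
  refine ⟨⟨t, ?_⟩, ?_⟩
  · simp only at ht ⊢
    exact_mod_cast ht
  · rintro _ ⟨s, rfl⟩
    have := hle ⟨s, rfl⟩
    simp only at this ⊢
    exact_mod_cast this

/-- Repeating the last column of the left and the last row of the right factor. -/
theorem IsTropicalProduct.pad {A : Matrix (Fin m) (Fin n) ℝ} {r : ℕ} (hr : 0 < r) (hrk : r ≤ k)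
    {B : Matrix (Fin m) (Fin r) ℝ} {C : Matrix (Fin r) (Fin n) ℝ} (h : IsTropicalProduct B C A) :
    ∃ (B' : Matrix (Fin m) (Fin k) ℝ) (C' : Matrix (Fin k) (Fin n) ℝ),
      IsTropicalProduct B' C' A := by
  let f : Fin k → Fin r := fun t => ⟨min t (r - 1), by omega⟩
  refine ⟨fun i t => B i (f t), fun t j => C (f t) j, fun i j => ⟨?_, ?_⟩⟩
  · obtain ⟨t, ht⟩ := (h i j).1
    have hft : f ⟨t, t.2.trans_le hrk⟩ = t := Fin.ext (by simp [f]; omega)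
    exact ⟨⟨t, t.2.trans_le hrk⟩, by simpa only [hft] using ht⟩
  · rintro _ ⟨t, rfl⟩
    exact (h i j).2 ⟨f t, rfl⟩

theorem exists_abs_le (A : Matrix (Fin m) (Fin n) ℝ) : ∃ S, ∀ i j, |A i j| ≤ S := by
  obtain ⟨S, hS⟩ := (Set.finite_range fun p : Fin m × Fin n => |A p.1 p.2|).bddAbove
  exact ⟨S, fun i j => hS ⟨(i, j), rfl⟩⟩

/-- The left factor is a tropical identity matrix in which `2 * S` replaces infinity: it exceeds
every difference of two entries of `A`. -/
theorem exists_tropicalProduct_rows (A : Matrix (Fin m) (Fin n) ℝ) :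
    ∃ (B : Matrix (Fin m) (Fin m) ℝ) (C : Matrix (Fin m) (Fin n) ℝ), IsTropicalProduct B C A := by
  obtain ⟨S, hS⟩ := exists_abs_le A
  refine ⟨fun i t => if i = t then 0 else 2 * S, A, fun i j => ⟨⟨i, by simp⟩, ?_⟩⟩
  rintro _ ⟨t, rfl⟩
  have h1 := abs_le.1 (hS i j)
  have h2 := abs_le.1 (hS t j)
  simp only
  split_ifs with h
  · simp [h]
  · linarith

theorem exists_tropicalProduct_columns (A : Matrix (Fin m) (Fin n) ℝ) :
    ∃ (B : Matrix (Fin m) (Fin n) ℝ) (C : Matrix (Fin n) (Fin n) ℝ), IsTropicalProduct B C A := by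
  obtain ⟨S, hS⟩ := exists_abs_le A
  refine ⟨A, fun t j => if t = j then 0 else 2 * S, fun i j => ⟨⟨j, by simp⟩, ?_⟩⟩
  rintro _ ⟨t, rfl⟩
  have h1 := abs_le.1 (hS i j)
  have h2 := abs_le.1 (hS i t)
  simp only
  split_ifs with h
  · simp [h]
  · linarith

/-- The infimum is attained, as a factorization of inner size `m` exists. Since `A` has an entry,
which is attained as a minimum, the optimal inner size is positive, and padding raises it to `k`. -/
theorem factorRank_le_iff (hm : 0 < m) (hn : 0 < n) (A : Matrix (Fin m) (Fin n) ℝ) :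
    factorRank A ≤ k ↔ ∃ (B : Matrix (Fin m) (Fin k) ℝ) (C : Matrix (Fin k) (Fin n) ℝ),
      IsTropicalProduct B C A := by
  constructor
  · intro h
    obtain ⟨B, C, hBC⟩ := Nat.sInf_mem (s := {k : ℕ | ∃ (B : Matrix (Fin m) (Fin k) ℝ)
      (C : Matrix (Fin k) (Fin n) ℝ), IsTropicalProduct B C A}) ⟨m, exists_tropicalProduct_rows A⟩
    obtain ⟨⟨t, -⟩, -⟩ := hBC ⟨0, hm⟩ ⟨0, hn⟩
    exact hBC.pad t.pos h
  · exact fun h => Nat.sInf_le h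

theorem factorRank_le_min (A : Matrix (Fin m) (Fin n) ℝ) : factorRank A ≤ min m n :=
  le_min (Nat.sInf_le (exists_tropicalProduct_rows A))
    (Nat.sInf_le (exists_tropicalProduct_columns A))

theorem exists_boundedFactorization_iff (hm : 0 < m) (hn : 0 < n)
    (A : Matrix (Fin m) (Fin n) ℤ) :
    (∃ (B : Matrix (Fin m) (Fin k) ℤ) (C : Matrix (Fin k) (Fin n) ℤ),
      IsBoundedFactorization A B C) ↔ factorRank A.toReal ≤ k := by
  rw [factorRank_le_iff hm hn]
  constructor
  · rintro ⟨B, C, h, -⟩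
    exact ⟨_, _, h.toReal⟩
  · rintro ⟨B, C, h⟩
    exact h.floor_ceil.exists_bounded hm hn

end Tropical

/-! ### Programs with registers that point into the input word -/

/-- Programs on registers which hold positions of a word over `Option G`. -/
inductive RegProg (G : Type) : Type
  | inc (r : ℕ)
  | dec (r : ℕ)
  | seq (p q : RegProg G)
  | ite (r : ℕ) (f : Option G → Bool) (p q : RegProg G)
  | loop (r : ℕ) (p : RegProg G)

namespace RegProg

variable {G : Type}

/-- A strict upper bound on the registers that a program mentions. -/
def bound : RegProg G → ℕ
  | inc r => r + 1
  | dec r => r + 1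
  | seq p q => max p.bound q.bound
  | ite r _ p q => max (r + 1) (max p.bound q.bound)
  | loop r p => max (r + 1) p.bound

/-- `Runs U p v v' t`: on the word `U`, the program `p` takes the register contents `v` to `v'`
in `t` steps. Registers hold numbers up to `U.length`. -/
inductive Runs (U : List (Option G)) : RegProg G → (ℕ → ℕ) → (ℕ → ℕ) → ℕ → Prop
  | inc (r v) : Runs U (inc r) v (Function.update v r (min (v r + 1) U.length)) 1
  | dec (r v) : Runs U (dec r) v (Function.update v r (v r - 1)) 1
  | seq {p q v v' v'' s t} : Runs U p v v' s → Runs U q v' v'' t → Runs U (seq p q) v v'' (s + t)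
  | ite_true {r f p q v v' t} : f (U[v r]?).join = true → Runs U p v v' t →
      Runs U (ite r f p q) v v' (1 + t)
  | ite_false {r f p q v v' t} : f (U[v r]?).join = false → Runs U q v v' t →
      Runs U (ite r f p q) v v' (1 + t)
  | loop_zero {r p v} : v r = 0 → Runs U (loop r p) v v 1
  | loop_succ {r p v v' v'' s t} : v r ≠ 0 → Runs U p v v' s → Runs U (loop r p) v' v'' t →
      Runs U (loop r p) v v'' (1 + s + t)

theorem Runs.le_length {U : List (Option G)} {p : RegProg G} {v v' : ℕ → ℕ} {t : ℕ}
    (h : Runs U p v v' t) (hv : ∀ i, v i ≤ U.length) : ∀ i, v' i ≤ U.length := by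
  induction h with
  | inc r v =>
    intro i
    rcases eq_or_ne i r with rfl | h
    · simp
    · simpa [h] using hv i
  | dec r v =>
    intro i
    rcases eq_or_ne i r with rfl | h
    · simpa using (Nat.sub_le _ _).trans (hv i)
    · simpa [h] using hv i
  | seq _ _ ih1 ih2 => exact ih2 (ih1 hv)
  | ite_true _ _ ih => exact ih hv
  | ite_false _ _ ih => exact ih hv
  | loop_zero _ => exact hv
  | loop_succ _ _ _ ih1 ih2 => exact ih2 (ih1 hv)

/-! ### Realization by stack machines -/

/-- The stacks of the machine: input, output, and two for each register. -/
inductive Stk (R : ℕ) : Type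
  | inp
  | out
  | left (i : Fin (R + 1))
  | right (i : Fin (R + 1))
  deriving DecidableEq, Fintype

/-- The stack alphabets. -/
abbrev Alph (G : Type) (R : ℕ) : Stk R → Type
  | .inp => G
  | .out => Bool
  | .left _ => Option G
  | .right _ => Option G

/-- The statements of the machine. -/
abbrev MStmt (G : Type) (R : ℕ) (Λ : Type) : Type :=
  Turing.TM2.Stmt (Alph G R) Λ (Option (Option G))

/-- The configurations of the machine. -/
abbrev MCfg (G : Type) (R : ℕ) (Λ : Type) : Type :=
  Turing.TM2.Cfg (Alph G R) Λ (Option (Option G))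

/-- The labels of a program. -/
def Lab : RegProg G → Type
  | inc _ => Unit
  | dec _ => Unit
  | seq p q => Lab p ⊕ Lab q
  | ite _ _ p q => Option (Lab p ⊕ Lab q)
  | loop _ p => Option (Lab p)

/-- There are finitely many labels. -/
instance labFintype : (p : RegProg G) → Fintype (Lab p)
  | inc _ => inferInstanceAs (Fintype Unit)
  | dec _ => inferInstanceAs (Fintype Unit)
  | seq p q =>
    haveI := labFintype p
    haveI := labFintype q
    inferInstanceAs (Fintype (Lab p ⊕ Lab q))
  | ite _ _ p q =>
    haveI := labFintype p
    haveI := labFintype q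
    inferInstanceAs (Fintype (Option (Lab p ⊕ Lab q)))
  | loop _ p =>
    haveI := labFintype p
    inferInstanceAs (Fintype (Option (Lab p)))

/-- The label at which a program starts. -/
def entry : (p : RegProg G) → Lab p
  | inc _ => ()
  | dec _ => ()
  | seq p _ => Sum.inl (entry p)
  | ite _ _ _ _ => none
  | loop _ _ => none

/-- The register `r` as an index of stacks. -/
def reg (R r : ℕ) : Fin (R + 1) := Fin.ofNat (R + 1) r

theorem reg_val {R r : ℕ} (hr : r < R + 1) : (reg R r : ℕ) = r := by
  simp [reg, Fin.ofNat, Nat.mod_eq_of_lt hr]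

open Turing.TM2.Stmt in
/-- The machine code of a program. The labels are embedded by `emb`, and the code continues at
`exit` in the end. -/
def code {R : ℕ} {Λ : Type} : (p : RegProg G) → (Lab p → Λ) → Λ → Lab p → MStmt G R Λ
  | inc r, _, exit => fun _ =>
    pop (.right (reg R r)) (fun _ s => s) <|
      branch Option.isSome
        (push (.left (reg R r)) (fun s => s.getD none) <| load (fun _ => none) <|
          goto fun _ => exit)
        (goto fun _ => exit)
  | dec r, _, exit => fun _ =>
    pop (.left (reg R r)) (fun _ s => s) <|
      branch Option.isSome
        (push (.right (reg R r)) (fun s => s.getD none) <| load (fun _ => none) <|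
          goto fun _ => exit)
        (goto fun _ => exit)
  | seq p q, emb, exit => fun l =>
    match l with
    | Sum.inl l => code p (emb ∘ Sum.inl) (emb (Sum.inr (entry q))) l
    | Sum.inr l => code q (emb ∘ Sum.inr) exit l
  | ite r f p q, emb, exit => fun l =>
    match l with
    | none => peek (.right (reg R r)) (fun _ s => s) <|
        branch (fun s => f s.join)
          (load (fun _ => none) <| goto fun _ => emb (some (Sum.inl (entry p))))
          (load (fun _ => none) <| goto fun _ => emb (some (Sum.inr (entry q))))
    | some (Sum.inl l) => code p (emb ∘ some ∘ Sum.inl) exit l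
    | some (Sum.inr l) => code q (emb ∘ some ∘ Sum.inr) exit l
  | loop r p, emb, exit => fun l =>
    match l with
    | none => peek (.left (reg R r)) (fun _ s => s) <|
        branch Option.isSome
          (load (fun _ => none) <| goto fun _ => emb (some (entry p)))
          (goto fun _ => exit)
    | some l => code p (emb ∘ some) (emb none) l

/-- The stacks that represent given register contents. -/
def stkOf {R : ℕ} (U : List (Option G)) (v : ℕ → ℕ) (I : List G) (O : List Bool) :
    (k : Stk R) → List (Alph G R k)
  | .inp => I
  | .out => O
  | .left i => (U.take (v i)).reverse
  | .right i => U.drop (v i)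

/-- Each register owns a copy of the word, split between its two stacks, so an assignment to it
leaves all other stacks alone. -/
theorem stkOf_update {R r : ℕ} (hr : r < R + 1) (U : List (Option G)) (v : ℕ → ℕ) (I : List G)
    (O : List Bool) (x : ℕ) :
    (stkOf U (Function.update v r x) I O : (k : Stk R) → List (Alph G R k)) =
      Function.update (Function.update (stkOf U v I O) (.left (reg R r))
        (U.take x).reverse) (.right (reg R r)) (U.drop x) := by
  have hval : (reg R r : ℕ) = r := reg_val hr
  funext k
  rcases k with _ | _ | i | i
  · simp [stkOf]
  · simp [stkOf]
  · by_cases h : i = reg R r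
    · subst h
      simp [stkOf, hval]
    · have : (i : ℕ) ≠ r := fun h' => h (Fin.ext (h'.trans hval.symm))
      simp [stkOf, h, this]
  · by_cases h : i = reg R r
    · subst h
      simp [stkOf, hval]
    · have : (i : ℕ) ≠ r := fun h' => h (Fin.ext (h'.trans hval.symm))
      simp [stkOf, h, this]

/-- `f` leads from `a` to `b` in exactly `n` steps. -/
def ReachesIn {S : Type} (f : S → Option S) (a b : S) (n : ℕ) : Prop :=
  (flip bind f)^[n] (some a) = some b

theorem ReachesIn.single {S : Type} {f : S → Option S} {a b : S} (h : f a = some b) :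
    ReachesIn f a b 1 := h

theorem ReachesIn.trans {S : Type} {f : S → Option S} {a b c : S} {m n : ℕ}
    (h1 : ReachesIn f a b m) (h2 : ReachesIn f b c n) : ReachesIn f a c (m + n) := by
  unfold ReachesIn at *
  rw [Nat.add_comm, Function.iterate_add_apply, h1, h2]

/-- A machine step executes a statement up to its jump, so program time and machine time agree
exactly. The finite state is back at `none` after each step. The induction varies `exit`, since the
code of a subprogram continues elsewhere than that of the whole. -/
theorem code_reachesIn {R : ℕ} {Λ : Type} {m : Λ → MStmt G R Λ} {U : List (Option G)} {I : List G}
    {O : List Bool} {p : RegProg G} {v v' : ℕ → ℕ} {t : ℕ} (h : Runs U p v v' t)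
    (hv : ∀ i, v i ≤ U.length) (hR : p.bound ≤ R + 1) (emb : Lab p → Λ) (exit : Λ)
    (hm : ∀ l, m (emb l) = code p emb exit l) :
    ReachesIn (Turing.TM2.step m) (⟨some (emb (entry p)), none, stkOf U v I O⟩ : MCfg G R Λ)
      ⟨some exit, none, stkOf U v' I O⟩ t := by
  induction h generalizing exit with
  | inc r v =>
    have hr : r < R + 1 := hR
    have hval : (reg R r : ℕ) = r := reg_val hr
    apply ReachesIn.single
    rw [Turing.TM2.step, hm, stkOf_update hr]
    rcases (hv r).lt_or_eq with h | h
    · rw [min_eq_left (by omega)]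
      have h1 : stkOf U v I O (Stk.right (reg R r)) =
        U[v r] :: U.drop (v r + 1) := by
        simp only [stkOf, hval]
        exact List.drop_eq_getElem_cons h
      have h2 : (U.take (v r + 1)).reverse = U[v r] :: stkOf U v I O (Stk.left (reg R r)) := by
        simp only [stkOf, hval]
        rw [List.take_succ_eq_append_getElem h]
        simp
      rw [h2]
      simp [code, h1]
      rw [Function.update_comm (by simp)]
      simp [List.getElem?_eq_getElem h]
    -- At the right end of the word the pop finds an empty stack and nothing is pushed: this
    -- realizes the saturation of `inc`.
    · rw [min_eq_right (by omega)]
      have h1 : stkOf U v I O (Stk.right (reg R r)) = [] := by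
        simp only [stkOf, hval]
        simp [h]
      have h2 : (U.take U.length).reverse = stkOf U v I O (Stk.left (reg R r)) := by
        simp only [stkOf, hval, h]
      rw [h2]
      simp [code, h1]
  | dec r v =>
    have hr : r < R + 1 := hR
    have hval : (reg R r : ℕ) = r := reg_val hr
    apply ReachesIn.single
    rw [Turing.TM2.step, hm, stkOf_update hr]
    rcases Nat.eq_zero_or_pos (v r) with h | h
    · have h1 : stkOf U v I O (Stk.left (reg R r)) = [] := by
        simp only [stkOf, hval]
        simp [h]
      have h2 : (U.drop (v r - 1)) = stkOf U v I O (Stk.right (reg R r)) := by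
        simp only [stkOf, hval, h]
      rw [h2]
      simp [code, h1, h]
    · obtain ⟨x, hx⟩ : ∃ x, v r = x + 1 := ⟨v r - 1, by omega⟩
      have hxl : x < U.length := by have := hv r; omega
      have h1 : stkOf U v I O (Stk.left (reg R r)) = U[x] :: (U.take x).reverse := by
        simp only [stkOf, hval, hx]
        rw [List.take_succ_eq_append_getElem hxl]
        simp
      have h2 : U.drop x = U[x] :: stkOf U v I O (Stk.right (reg R r)) := by
        simp only [stkOf, hval, hx]
        exact List.drop_eq_getElem_cons hxl
      rw [hx, Nat.add_sub_cancel, h2]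
      simp [code, h1]
  | seq h1 h2 ih1 ih2 =>
    rw [bound, max_le_iff] at hR
    refine (ih1 hv hR.1 (emb ∘ Sum.inl) _ ?_).trans
      (ih2 (h1.le_length hv) hR.2 (emb ∘ Sum.inr) exit ?_)
    · intro l
      exact hm (Sum.inl l)
    · intro l
      exact hm (Sum.inr l)
  | @ite_true r f p q v v' t hf h ih =>
    rw [bound, max_le_iff, max_le_iff] at hR
    have hval : (reg R r : ℕ) = r := reg_val hR.1
    refine (ReachesIn.single ?_).trans (ih hv hR.2.1 (emb ∘ some ∘ Sum.inl) exit ?_)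
    · have h1 : (stkOf U v I O (Stk.right (reg R r))).head? = U[v r]? := by
        simp [stkOf, hval, List.head?_drop]
      rw [Turing.TM2.step, hm]
      simp [code, entry, h1, hf]
      rfl
    · intro l
      exact hm (some (Sum.inl l))
  | @ite_false r f p q v v' t hf h ih =>
    rw [bound, max_le_iff, max_le_iff] at hR
    have hval : (reg R r : ℕ) = r := reg_val hR.1
    refine (ReachesIn.single ?_).trans (ih hv hR.2.2 (emb ∘ some ∘ Sum.inr) exit ?_)
    · have h1 : (stkOf U v I O (Stk.right (reg R r))).head? = U[v r]? := by
        simp [stkOf, hval, List.head?_drop]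
      rw [Turing.TM2.step, hm]
      simp [code, entry, h1, hf]
      rfl
    · intro l
      exact hm (some (Sum.inr l))
  | @loop_zero r p v h =>
    rw [bound, max_le_iff] at hR
    have hval : (reg R r : ℕ) = r := reg_val hR.1
    apply ReachesIn.single
    have h1 : stkOf U v I O (Stk.left (reg R r)) = [] := by
      simp only [stkOf, hval]
      simp [h]
    rw [Turing.TM2.step, hm]
    simp [code, entry, h1]
  | @loop_succ r p v v' v'' s t h h1 h2 ih1 ih2 =>
    have hR' := hR
    rw [bound, max_le_iff] at hR
    have hval : (reg R r : ℕ) = r := reg_val hR.1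
    refine ((ReachesIn.single ?_).trans (ih1 hv hR.2 (emb ∘ some) (emb none) ?_)).trans
      (ih2 (h1.le_length hv) hR' emb exit hm)
    · obtain ⟨x, hx⟩ : ∃ x, v r = x + 1 := ⟨v r - 1, by omega⟩
      have hxl : x < U.length := by have := hv r; omega
      have h1 : stkOf U v I O (Stk.left (reg R r)) = U[x] :: (U.take x).reverse := by
        simp only [stkOf, hval, hx]
        rw [List.take_succ_eq_append_getElem hxl]
        simp
      rw [Turing.TM2.step, hm]
      simp [code, entry, h1]
      rfl
    · intro l
      exact hm (some l)

end RegProg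

namespace RegProg

variable {G : Type}

/-! ### The complete machine -/

/-- The number of blank symbols after the word. -/
def padLength : ℕ := 256

/-- The word with blank symbols appended. -/
def padded (w : List G) : List (Option G) := w.map some ++ List.replicate padLength none

theorem length_padded (w : List G) : (padded w).length = w.length + padLength := by
  simp [padded]

/-- The labels of the complete machine. -/
inductive MLab (p : RegProg G) : Type
  | start
  | read
  | prog (l : Lab p)
  | answer
  | clean

/-- The labels as an iterated sum. -/
def mLabEquiv (p : RegProg G) : MLab p ≃ (Lab p ⊕ Fin 4) where
  toFun
    | .start => Sum.inr 0
    | .read => Sum.inr 1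
    | .prog l => Sum.inl l
    | .answer => Sum.inr 2
    | .clean => Sum.inr 3
  invFun
    | Sum.inl l => .prog l
    | Sum.inr 0 => .start
    | Sum.inr 1 => .read
    | Sum.inr 2 => .answer
    | Sum.inr 3 => .clean
  left_inv l := by cases l <;> rfl
  right_inv l := by
    rcases l with l | l
    · rfl
    · fin_cases l <;> rfl

instance (p : RegProg G) : Fintype (MLab p) := Fintype.ofEquiv _ (mLabEquiv p).symm

/-- Push one symbol to the left stacks of all registers in a list. -/
def pushRegs {R : ℕ} {Λ : Type} (f : Option (Option G) → Option G) (l : List (Fin (R + 1)))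
    (q : MStmt G R Λ) : MStmt G R Λ :=
  l.foldr (fun i q => Turing.TM2.Stmt.push (Stk.left i) f q) q

/-- Push a word to the left stacks of all registers. -/
def pushWord {R : ℕ} {Λ : Type} (w : List (Option G)) (q : MStmt G R Λ) : MStmt G R Λ :=
  w.foldr (fun a q => pushRegs (fun _ => a) (List.finRange (R + 1)) q) q

/-- Pop the two stacks of all registers in a list. -/
def popRegs {R : ℕ} {Λ : Type} (l : List (Fin (R + 1))) (q : MStmt G R Λ) : MStmt G R Λ :=
  l.foldr (fun i q => Turing.TM2.Stmt.pop (Stk.left i) (fun s o => s <|> o)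
    (Turing.TM2.Stmt.pop (Stk.right i) (fun s o => s <|> o) q)) q

theorem stepAux_pushRegs {R : ℕ} {Λ : Type} (f : Option (Option G) → Option G)
    (l : List (Fin (R + 1))) (hl : l.Nodup) (q : MStmt G R Λ) (s : Option (Option G))
    (S : (k : Stk R) → List (Alph G R k)) :
    Turing.TM2.stepAux (pushRegs f l q) s S = Turing.TM2.stepAux q s (fun k => match k with
      | .inp => S .inp
      | .out => S .out
      | .left i => if i ∈ l then f s :: S (.left i) else S (.left i)
      | .right i => S (.right i)) := by
  induction l generalizing S with
  | nil =>
    simp only [pushRegs, List.foldr_nil]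
    congr 1
    funext k
    cases k <;> simp
  | cons i l ih =>
    rw [List.nodup_cons] at hl
    change Turing.TM2.stepAux (pushRegs f l q) s _ = _
    rw [ih hl.2]
    congr 1
    funext k
    rcases k with _ | _ | j | j
    · simp
    · simp
    · rcases eq_or_ne j i with rfl | h
      · simp [hl.1]
      · simp [h]
    · simp

/-- While the input is stored, every register stands at the end of the stored part `Z`; pushing on
all left stacks extends the word and advances all registers at once. -/
theorem stepAux_pushRegs_finRange {R : ℕ} {Λ : Type} (f : Option (Option G) → Option G)
    (q : MStmt G R Λ) (s : Option (Option G)) (Z : List (Option G)) (I : List G) (O : List Bool) :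
    Turing.TM2.stepAux (pushRegs f (List.finRange (R + 1)) q) s
        (stkOf Z (fun _ => Z.length) I O) =
      Turing.TM2.stepAux q s
        (stkOf (Z ++ [f s]) (fun _ => (Z ++ [f s]).length) I O) := by
  rw [stepAux_pushRegs _ _ (List.nodup_finRange _)]
  congr 1
  funext k
  rcases k with _ | _ | i | i
  · rfl
  · rfl
  · simp only [stkOf, List.mem_finRange, if_true, List.take_length, List.reverse_append]
    rfl
  · simp [stkOf]

theorem stepAux_pushWord {R : ℕ} {Λ : Type} (w : List (Option G))
    (q : MStmt G R Λ) (s : Option (Option G)) (Z : List (Option G)) (I : List G) (O : List Bool) :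
    Turing.TM2.stepAux (pushWord w q) s (stkOf Z (fun _ => Z.length) I O) =
      Turing.TM2.stepAux q s (stkOf (Z ++ w) (fun _ => (Z ++ w).length) I O) := by
  induction w generalizing Z with
  | nil => simp [pushWord]
  | cons a w ih =>
    change Turing.TM2.stepAux (pushRegs (fun _ => a) _ (pushWord w q)) s _ = _
    rw [stepAux_pushRegs_finRange, ih]
    simp only [List.append_assoc, List.singleton_append]

/-- The maximal height of a register stack is at most `n`. -/
def HeightLe {R : ℕ} (S : (k : Stk R) → List (Alph G R k)) (n : ℕ) : Prop :=
  ∀ i, (S (.left i)).length ≤ n ∧ (S (.right i)).length ≤ n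

/-- The state keeps the first symbol found by any of the pops, so started at `none` it stays `none`
precisely when all these stacks were empty. This is the test that ends the cleaning. -/
theorem stepAux_popRegs {R : ℕ} {Λ : Type} (l : List (Fin (R + 1))) (hl : l.Nodup)
    (q : MStmt G R Λ) (s : Option (Option G)) (S : (k : Stk R) → List (Alph G R k)) :
    ∃ s' : Option (Option G), (s'.isSome = false ↔ s = none ∧ ∀ i ∈ l, S (.left i) = [] ∧
        S (.right i) = []) ∧
      Turing.TM2.stepAux (popRegs l q) s S = Turing.TM2.stepAux q s' (fun k => match k with
      | .inp => S .inp
      | .out => S .out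
      | .left i => if i ∈ l then (S (.left i)).tail else S (.left i)
      | .right i => if i ∈ l then (S (.right i)).tail else S (.right i)) := by
  induction l generalizing S s with
  | nil =>
    refine ⟨s, by simp, ?_⟩
    simp only [popRegs, List.foldr_nil]
    congr 1
    funext k
    cases k <;> simp
  | cons i l ih =>
    rw [List.nodup_cons] at hl
    obtain ⟨s', hs', h⟩ := ih hl.2 ((s <|> (S (.left i)).head?) <|> (S (.right i)).head?)
      (Function.update (Function.update S (.left i) (S (.left i)).tail) (.right i)
        (S (.right i)).tail)
    refine ⟨s', ?_, ?_⟩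
    · rw [hs']
      have hne : ∀ j ∈ l, j ≠ i := fun j hj h => hl.1 (h ▸ hj)
      have h1 : (∀ j ∈ l, (Function.update (Function.update S (.left i) (S (.left i)).tail)
          (.right i) (S (.right i)).tail) (.left j) = [] ∧
          (Function.update (Function.update S (.left i) (S (.left i)).tail) (.right i)
            (S (.right i)).tail) (.right j) = []) ↔
          ∀ j ∈ l, S (.left j) = [] ∧ S (.right j) = [] := by
        refine forall₂_congr fun j hj => ?_
        simp [hne j hj]
      rw [h1]
      have h2 : ((s <|> (S (.left i)).head?) <|> (S (.right i)).head?) = none ↔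
          s = none ∧ S (.left i) = [] ∧ S (.right i) = [] := by
        cases s <;> cases S (.left i) <;> cases S (.right i) <;> simp
      rw [h2]
      simp only [List.mem_cons, forall_eq_or_imp]
      tauto
    · change Turing.TM2.stepAux (popRegs l q) ((s <|> (S (.left i)).head?) <|> _) _ = _
      rw [Function.update_of_ne (by simp)]
      rw [h]
      congr 1
      funext k
      rcases k with _ | _ | j | j
      · simp
      · simp
      · rcases eq_or_ne j i with rfl | h
        · simp [hl.1]
        · simp [h]
      · rcases eq_or_ne j i with rfl | h
        · simp [hl.1]
        · simp [h]

open Turing.TM2.Stmt in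
/-- The statements of the complete machine: it stores the word `pre`, followed by the input and
blanks, in the stacks of all registers, runs the program, answers whether the register `r` is
nonzero, and empties the stacks. -/
def mainCode {p : RegProg G} {R : ℕ} (pre : List G) (r : ℕ) : MLab p → MStmt G R (MLab p)
  | .start => pushWord (pre.map some) (goto fun _ => .read)
  | .read => pop .inp (fun _ s => s.map some) <|
      branch Option.isSome
        (pushRegs (fun s => s.getD none) (List.finRange (R + 1)) <| load (fun _ => none) <|
          goto fun _ => .read)
        (pushWord (List.replicate padLength none) <| goto fun _ => .prog (entry p))
  | .prog l => code p .prog .answer l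
  | .answer => peek (.left (reg R r)) (fun _ s => s) <| push .out Option.isSome <|
      load (fun _ => none) <| goto fun _ => .clean
  | .clean => popRegs (List.finRange (R + 1)) <|
      branch Option.isSome (load (fun _ => none) <| goto fun _ => .clean) halt

/-- The complete machine. -/
def machine [Fintype G] (p : RegProg G) (pre : List G) (r : ℕ) : Turing.FinTM2 where
  K := Stk (max p.bound (r + 1))
  k₀ := .inp
  k₁ := .out
  Γ := Alph G _
  Λ := MLab p
  main := .start
  σ := Option (Option G)
  initialState := none
  Γk₀Fin := inferInstanceAs (Fintype G)
  m := mainCode pre r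

/-- A halting configuration must have empty register stacks. Every pass shortens all of them at
once, and the additional pass detects that nothing is left. -/
theorem clean_reachesIn {p : RegProg G} {R : ℕ} (pre : List G) (r n : ℕ)
    (S : (k : Stk R) → List (Alph G R k)) (hS : HeightLe S n) : ∃ t ≤ n + 1,
    ReachesIn (Turing.TM2.step (mainCode pre r))
      (⟨some .clean, none, S⟩ : MCfg G R (MLab p))
      ⟨none, none, fun k => match k with
        | .inp => S .inp
        | .out => S .out
        | .left _ => []
        | .right _ => []⟩ t := by
  induction n generalizing S with
  | zero =>
    refine ⟨1, le_rfl, ReachesIn.single ?_⟩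
    obtain ⟨s', hs', h⟩ := stepAux_popRegs (Λ := MLab p) (List.finRange (R + 1))
      (List.nodup_finRange _) (.branch Option.isSome (.load (fun _ => none) <|
        .goto fun _ => .clean) .halt) none S
    have h0 : s'.isSome = false := by
      refine hs'.2 ⟨rfl, fun i _ => ?_⟩
      have := hS i
      simpa using this
    rw [Turing.TM2.step, mainCode, h]
    simp only [Turing.TM2.stepAux, h0, cond_false, Option.some.injEq]
    congr 1
    · simpa using h0
    · funext k
      rcases k with _ | _ | i | i
      · rfl
      · rfl
      · have := (hS i).1
        simp at this
        simp [this]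
      · have := (hS i).2
        simp at this
        simp [this]
  | succ n ih =>
    obtain ⟨s', hs', h⟩ := stepAux_popRegs (Λ := MLab p) (List.finRange (R + 1))
      (List.nodup_finRange _) (.branch Option.isSome (.load (fun _ => none) <|
        .goto fun _ => .clean) .halt) none S
    rcases h0 : s'.isSome with _ | _
    · refine ⟨1, by omega, ReachesIn.single ?_⟩
      rw [Turing.TM2.step, mainCode, h]
      simp only [Turing.TM2.stepAux, h0, cond_false, Option.some.injEq]
      have h1 := (hs'.1 h0).2
      congr 1
      · simpa using h0
      · funext k
        rcases k with _ | _ | i | i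
        · rfl
        · rfl
        · simp [h1]
        · simp [h1]
    · obtain ⟨t, ht, hreach⟩ := ih (fun k => match k with
        | .inp => S .inp
        | .out => S .out
        | .left i => (S (.left i)).tail
        | .right i => (S (.right i)).tail) (fun i => by
          have := hS i
          simp only [List.length_tail]
          omega)
      refine ⟨1 + t, by omega, (ReachesIn.single ?_).trans hreach⟩
      rw [Turing.TM2.step, mainCode, h]
      simp only [Turing.TM2.stepAux, h0, cond_true, Option.some.injEq]
      congr 1
      funext k
      cases k <;> simp

theorem read_reachesIn {p : RegProg G} {R : ℕ} (pre : List G) (r : ℕ) (w : List G)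
    (Z : List (Option G)) :
    ReachesIn (Turing.TM2.step (mainCode pre r))
      (⟨some .read, none, stkOf Z (fun _ => Z.length) w []⟩ : MCfg G R (MLab p))
      ⟨some (.prog (entry p)), none,
        stkOf (Z ++ padded w) (fun _ => (Z ++ padded w).length) [] []⟩ (w.length + 1) := by
  induction w generalizing Z with
  | nil =>
    apply ReachesIn.single
    have h1 : (Function.update (stkOf Z (fun _ => Z.length) [] []) Stk.inp [] :
        (k : Stk R) → List (Alph G R k)) = stkOf Z (fun _ => Z.length) [] [] := by
      funext k
      cases k <;> simp [stkOf]
    have h0 : (stkOf Z (fun _ => Z.length) [] [] : (k : Stk R) → List (Alph G R k)) Stk.inp = [] :=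
      rfl
    simp only [Turing.TM2.step, mainCode, Turing.TM2.stepAux, h0, List.head?_nil, Option.map_none,
      List.tail_nil, h1, Option.isSome_none, cond_false, stepAux_pushWord, padded, List.map_nil,
      List.nil_append]
  | cons a w ih =>
    rw [List.length_cons, Nat.add_comm (w.length + 1)]
    have h2 := ih (Z ++ [some a])
    have h3 : Z ++ [some a] ++ padded w = Z ++ padded (a :: w) := by simp [padded]
    rw [h3] at h2
    refine (ReachesIn.single ?_).trans h2
    have h1 : (Function.update (stkOf Z (fun _ => Z.length) (a :: w) []) Stk.inp w :
        (k : Stk R) → List (Alph G R k)) = stkOf Z (fun _ => Z.length) w [] := by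
      funext k
      cases k <;> simp [stkOf]
    have h0 : (stkOf Z (fun _ => Z.length) (a :: w) [] : (k : Stk R) → List (Alph G R k)) Stk.inp =
      a :: w := rfl
    simp only [Turing.TM2.step, mainCode, Turing.TM2.stepAux, h0, List.head?_cons, Option.map_some,
      List.tail_cons, h1, Option.isSome_some, cond_true, stepAux_pushRegs_finRange,
      Option.getD_some]

/-- Storing the input and cleaning up are each linear in the length of the padded word. The program
starts with every register at the end of the word. -/
theorem machine_reachesIn {p : RegProg G} {R : ℕ} (pre : List G) (r : ℕ) (w : List G)
    (hR : p.bound ≤ R + 1) (hr : r < R + 1) {v : ℕ → ℕ} {t : ℕ}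
    (h : Runs (padded (pre ++ w)) p (fun _ => (padded (pre ++ w)).length) v t) :
    ∃ T ≤ t + 2 * (padded (pre ++ w)).length + 5,
    ReachesIn (Turing.TM2.step (mainCode pre r))
      (⟨some .start, none, stkOf [] (fun _ => 0) w []⟩ : MCfg G R (MLab p))
      ⟨none, none, stkOf [] (fun _ => 0) [] [decide (v r ≠ 0)]⟩ T := by
  set U := padded (pre ++ w) with hU
  have hU' : pre.map some ++ padded w = U := by simp [hU, padded]
  have hlen : U.length = pre.length + w.length + padLength := by
    rw [hU, length_padded, List.length_append]
  have hv : ∀ i, v i ≤ U.length := h.le_length fun _ => le_rfl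
  have hb : (((stkOf U v [] [] : (k : Stk R) → List (Alph G R k)) (.left (reg R r))).head?).isSome =
      decide (v r ≠ 0) := by
    have hval : (reg R r : ℕ) = r := reg_val hr
    have hUpos : 0 < U.length := by
      rw [hlen, padLength]
      omega
    simp only [stkOf, hval]
    rw [List.head?_reverse]
    by_cases h0 : v r = 0
    · simp [h0]
    · have : U.take (v r) ≠ [] := by
        rw [← List.length_pos_iff, List.length_take]
        omega
      rw [List.getLast?_eq_some_getLast this]
      simp [h0]
  obtain ⟨T, hT, hclean⟩ := clean_reachesIn (p := p) pre r U.length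
    (stkOf U v [] [decide (v r ≠ 0)] : (k : Stk R) → List (Alph G R k)) (fun i => by
      simp [stkOf])
  have h1 : ReachesIn (Turing.TM2.step (mainCode pre r))
      (⟨some .start, none, stkOf [] (fun _ => 0) w []⟩ : MCfg G R (MLab p))
      ⟨some .read, none, stkOf (pre.map some) (fun _ => (pre.map some).length) w []⟩ 1 := by
    apply ReachesIn.single
    have := stepAux_pushWord (R := R) (Λ := MLab p) (pre.map some) (.goto fun _ => .read) none [] w []
    rw [Turing.TM2.step, mainCode]
    simpa using this
  have h2 := read_reachesIn (p := p) (R := R) pre r w (pre.map some)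
  rw [hU'] at h2
  have h3 := code_reachesIn (m := mainCode (p := p) (R := R) pre r) (I := []) (O := []) h
    (fun _ => le_rfl) hR .prog .answer (fun l => rfl)
  have h4 : ReachesIn (Turing.TM2.step (mainCode pre r))
      (⟨some .answer, none, stkOf U v [] []⟩ : MCfg G R (MLab p))
      ⟨some .clean, none, stkOf U v [] [decide (v r ≠ 0)]⟩ 1 := by
    apply ReachesIn.single
    rw [Turing.TM2.step, mainCode]
    simp only [Turing.TM2.stepAux, hb, Option.some.injEq]
    congr 1
    funext k
    cases k <;> simp [stkOf]
  refine ⟨1 + (w.length + 1) + t + 1 + T, ?_, ?_⟩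
  · omega
  · have h5 := (((h1.trans h2).trans h3).trans h4).trans hclean
    have h6 : (stkOf [] (fun _ => 0) [] [decide (v r ≠ 0)] : (k : Stk R) → List (Alph G R k)) =
        fun k => match k with
        | .inp => []
        | .out => [decide (v r ≠ 0)]
        | .left _ => []
        | .right _ => [] := by
      funext k
      cases k <;> simp [stkOf]
    rw [h6]
    exact h5

/-- A program of polynomial running time yields a polynomial time machine. -/
theorem nonempty_computableInPolyTime [Fintype G] {α : Type} (ea : α → List G) (V : α → Bool)
    (p : RegProg G) (pre : List G) (r : ℕ) (T : Polynomial ℕ)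
    (h : ∀ a, ∃ v t, Runs (padded (pre ++ ea a)) p (fun _ => (padded (pre ++ ea a)).length) v t ∧
      t ≤ T.eval (padded (pre ++ ea a)).length ∧ decide (v r ≠ 0) = V a) :
    Nonempty (Turing.TM2ComputableInPolyTime ea Computability.encodeBool V) := by
  set P : Polynomial ℕ := Polynomial.X + Polynomial.C (pre.length + padLength) with hP
  have hPe : ∀ a, (padded (pre ++ ea a)).length = P.eval (ea a).length := by
    intro a
    rw [length_padded]
    simp only [hP, List.length_append, Polynomial.eval_add, Polynomial.eval_X, Polynomial.eval_C]
    omega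
  -- The separate variable `l` absorbs the identity map on letters through which the input word is
  -- passed to the machine.
  have key : ∀ a l, l = ea a → Nonempty (Turing.TM2OutputsInTime (machine p pre r) l
      (some [V a]) ((T.comp P + 2 * P + 5).eval (ea a).length)) := by
    rintro a _ rfl
    obtain ⟨v, t, hrun, ht, hV⟩ := h a
    obtain ⟨n, hn, hreach⟩ := machine_reachesIn (R := max p.bound (r + 1)) pre r (ea a) (by omega)
      (by omega) hrun
    refine ⟨⟨⟨n, ?_⟩, ?_⟩⟩
    · have hi : Turing.initList (machine p pre r) (ea a) = (⟨some .start, none,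
          stkOf [] (fun _ => 0) (ea a) []⟩ : MCfg G (max p.bound (r + 1)) (MLab p)) := by
        simp only [Turing.initList, machine]
        congr 1
        funext k
        rcases k with _ | _ | i | i
        · rfl
        all_goals simp [stkOf]
      have ho : Turing.haltList (machine p pre r) [V a] = (⟨none, none,
          stkOf [] (fun _ => 0) [] [V a]⟩ : MCfg G (max p.bound (r + 1)) (MLab p)) := by
        simp only [Turing.haltList, machine]
        congr 1
        funext k
        rcases k with _ | _ | i | i
        · simp [stkOf]
        · rfl
        all_goals simp [stkOf]
      rw [hV] at hreach
      rw [hi]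
      simp only [Option.map_some]
      rw [ho]
      exact hreach
    · refine hn.trans ?_
      rw [hPe] at ht ⊢
      simp only [Polynomial.eval_add, Polynomial.eval_comp, Polynomial.eval_mul]
      have h2 : Polynomial.eval (ea a).length (2 : Polynomial ℕ) = 2 := Polynomial.eval_ofNat 2 _
      have h5 : Polynomial.eval (ea a).length (5 : Polynomial ℕ) = 5 := Polynomial.eval_ofNat 5 _
      rw [h2, h5]
      omega
  refine ⟨{ tm := machine p pre r
            inputAlphabet := Equiv.refl G
            outputAlphabet := Equiv.refl Bool
            time := T.comp P + 2 * P + 5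
            outputsFun := fun a => ?_ }⟩
  exact (key a _ (List.map_id _)).some

end RegProg

/-! ### Terms for numbers bounded by the length of the word -/

namespace RegProg

variable {G : Type}

/-- `p`, started with register contents `v`, stops within `T` steps with contents satisfying
`Q`. -/
def Does (U : List (Option G)) (T : ℕ) (p : RegProg G) (v : ℕ → ℕ) (Q : (ℕ → ℕ) → Prop) : Prop :=
  ∃ v' t, Runs U p v v' t ∧ t ≤ T ∧ Q v'

theorem Does.mono {U : List (Option G)} {T T' : ℕ} {p : RegProg G} {v : ℕ → ℕ}
    {Q Q' : (ℕ → ℕ) → Prop} (h : Does U T p v Q) (hT : T ≤ T') (hQ : ∀ v', Q v' → Q' v') :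
    Does U T' p v Q' := by
  obtain ⟨v', t, h1, h2, h3⟩ := h
  exact ⟨v', t, h1, h2.trans hT, hQ _ h3⟩

theorem Does.seq {U : List (Option G)} {T T' : ℕ} {p q : RegProg G} {v : ℕ → ℕ}
    {Q Q' : (ℕ → ℕ) → Prop} (h : Does U T p v Q) (h' : ∀ v', Q v' → Does U T' q v' Q') :
    Does U (T + T') (seq p q) v Q' := by
  obtain ⟨v', t, h1, h2, h3⟩ := h
  obtain ⟨v'', t', h1', h2', h3'⟩ := h' v' h3
  exact ⟨v'', t + t', .seq h1 h1', by omega, h3'⟩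

/-- The invariant is indexed by the number of passes still to come; each pass costs `T` and one
test, and the last test ends the loop. -/
theorem Does.loop {U : List (Option G)} {T r : ℕ} {p : RegProg G} (I : ℕ → (ℕ → ℕ) → Prop)
    (h0 : ∀ v, I 0 v → v r = 0)
    (hs : ∀ n v, I (n + 1) v → v r ≠ 0 ∧ Does U T p v (I n)) (n : ℕ) (v : ℕ → ℕ) (hI : I n v) :
    Does U (n * (T + 1) + 1) (loop r p) v (I 0) := by
  induction n generalizing v with
  | zero => exact ⟨v, 1, .loop_zero (h0 v hI), by omega, hI⟩
  | succ n ih =>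
    obtain ⟨hr, v', t, h1, h2, h3⟩ := hs n v hI
    obtain ⟨v'', t', h1', h2', h3'⟩ := ih v' h3
    refine ⟨v'', 1 + t + t', .loop_succ hr h1 h1', ?_, h3'⟩
    rw [Nat.succ_mul]
    omega

theorem Does.inc {U : List (Option G)} {r : ℕ} {v : ℕ → ℕ} {Q : (ℕ → ℕ) → Prop}
    (h : Q (Function.update v r (min (v r + 1) U.length))) : Does U 1 (inc r) v Q :=
  ⟨_, 1, .inc r v, le_rfl, h⟩

theorem Does.dec {U : List (Option G)} {r : ℕ} {v : ℕ → ℕ} {Q : (ℕ → ℕ) → Prop}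
    (h : Q (Function.update v r (v r - 1))) : Does U 1 (dec r) v Q :=
  ⟨_, 1, .dec r v, le_rfl, h⟩

/-- Set a register to zero. -/
def clear (d : ℕ) : RegProg G := loop d (dec d)

theorem does_clear {U : List (Option G)} {d : ℕ} {v : ℕ → ℕ} (hv : v d ≤ U.length) :
    Does U (2 * U.length + 1) (clear d) v (fun v' => v' = Function.update v d 0) := by
  refine (Does.loop (fun n v' => v' = Function.update v d n) ?_ ?_ (v d) v (by simp)).mono
    (T := v d * (1 + 1) + 1) (by omega) fun v' h => h
  · rintro _ rfl
    simp
  · rintro n _ rfl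
    refine ⟨by simp, .dec ?_⟩
    simp

/-- Move the contents of the register `s` to the register `d`. -/
def move (s d : ℕ) : RegProg G := seq (clear d) (loop s (seq (dec s) (inc d)))

theorem does_move {U : List (Option G)} {s d : ℕ} (hsd : s ≠ d) {v : ℕ → ℕ}
    (hv : ∀ i, v i ≤ U.length) :
    Does U (5 * U.length + 2) (move s d) v
      (fun v' => v' d = v s ∧ ∀ i, i ≠ s → i ≠ d → v' i = v i) := by
  refine ((does_clear (hv d)).seq (T' := v s * (2 + 1) + 1)
    (Q' := fun v' => v' d = v s ∧ ∀ i, i ≠ s → i ≠ d → v' i = v i) ?_).mono ?_ fun _ h => h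
  · rintro _ rfl
    refine (Does.loop (T := 2) (fun n v' => n ≤ v s ∧ v' s = n ∧ v' d = v s - n ∧
      ∀ i, i ≠ s → i ≠ d → v' i = v i) (fun v' h => h.2.1) ?_ (v s) _ ?_).mono le_rfl ?_
    · rintro n v' ⟨h0, h1, h2, h3⟩
      refine ⟨by omega, (Does.dec (Q := fun v'' => v'' = Function.update v' s n) ?_).seq
        (T' := 1) ?_⟩
      · simp [h1]
      · rintro _ rfl
        apply Does.inc
        have := hv s
        refine ⟨by omega, ?_, ?_, ?_⟩
        · simp [hsd]
        · simp [hsd.symm, h2]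
          omega
        · intro i hi hi'
          simp [hi, hi', h3]
    · refine ⟨le_rfl, by simp [hsd], by simp, fun i hi hi' => by simp [hi']⟩
    · rintro v' ⟨-, -, h2, h3⟩
      exact ⟨h2, h3⟩
  · have := hv s
    omega

/-- Copy the contents of the register `s` to the register `d`, with the help of `e`. -/
def copy (s d e : ℕ) : RegProg G :=
  seq (clear d) (seq (clear e) (seq (loop s (seq (dec s) (seq (inc d) (inc e))))
    (loop e (seq (dec e) (inc s)))))

theorem does_copy {U : List (Option G)} {s d e : ℕ} (hsd : s ≠ d) (hse : s ≠ e) (hde : d ≠ e)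
    {v : ℕ → ℕ} (hv : ∀ i, v i ≤ U.length) :
    Does U (11 * U.length + 4) (copy s d e) v
      (fun v' => v' d = v s ∧ ∀ i, i ≠ d → i ≠ e → v' i = v i) := by
  have hs := hv s
  refine ((does_clear (hv d)).seq (T' := (2 * U.length + 1) +
    ((v s * (3 + 1) + 1) + (v s * (2 + 1) + 1)))
    (Q' := fun v' => v' d = v s ∧ ∀ i, i ≠ d → i ≠ e → v' i = v i) ?_).mono ?_ fun _ h => h
  · rintro _ rfl
    refine (does_clear (by simpa [hde.symm] using hv e)).seq ?_
    rintro _ rfl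
    -- The first loop empties `s` into both `d` and `e`; the second one restores `s` from `e`.
    refine (Does.loop (T := 3) (fun n v' => n ≤ v s ∧ v' s = n ∧ v' d = v s - n ∧ v' e = v s - n ∧
      ∀ i, i ≠ s → i ≠ d → i ≠ e → v' i = v i) (fun v' h => h.2.1) ?_ (v s) _ ?_).seq ?_
    · rintro n v' ⟨h0, h1, h2, h3, h4⟩
      refine ⟨by omega, (Does.dec (Q := fun v'' => v'' = Function.update v' s n) ?_).seq
        (T' := 2) ?_⟩
      · simp [h1]
      · rintro _ rfl
        refine (Does.inc (Q := fun v'' => v'' = Function.update (Function.update v' s n) d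
          (v s - n)) ?_).seq (T' := 1) ?_
        · congr 1
          simp [hsd.symm, h2]
          omega
        · rintro _ rfl
          apply Does.inc
          refine ⟨by omega, ?_, ?_, ?_, ?_⟩
          · simp [hsd, hse]
          · simp [hde]
          · simp [hde.symm, hse.symm, h3]
            omega
          · intro i hi hi' hi''
            simp [hi, hi', hi'', h4]
    · refine ⟨le_rfl, by simp [hsd, hse], by simp [hde], by simp,
        fun i hi hi' hi'' => by simp [hi', hi'']⟩
    · rintro w ⟨-, h1, h2, h3, h4⟩
      refine (Does.loop (T := 2) (fun n v' => n ≤ v s ∧ v' e = n ∧ v' s = v s - n ∧ v' d = v s ∧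
        ∀ i, i ≠ s → i ≠ d → i ≠ e → v' i = v i) (fun v' h => h.2.1) ?_ (v s) _ ?_).mono le_rfl ?_
      · rintro n v' ⟨h0, h1, h2, h3, h4⟩
        refine ⟨by omega, (Does.dec (Q := fun v'' => v'' = Function.update v' e n) ?_).seq
          (T' := 1) ?_⟩
        · simp [h1]
        · rintro _ rfl
          apply Does.inc
          refine ⟨by omega, ?_, ?_, ?_, ?_⟩
          · simp [hse.symm]
          · simp [hse, h2]
            omega
          · simp [hsd.symm, hde, h3]
          · intro i hi hi' hi''
            simp [hi, hi'', h4 i hi hi' hi'']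
      · exact ⟨le_rfl, by omega, by omega, by omega, h4⟩
      · rintro v' ⟨-, h1, h2, h3, h4⟩
        refine ⟨h3, fun i hi hi' => ?_⟩
        rcases eq_or_ne i s with rfl | h
        · simpa using h2
        · exact h4 i h hi hi'
  · omega

end RegProg

/-- Prepend a value to an environment. -/
def envCons (x : ℕ) (v : ℕ → ℕ) : ℕ → ℕ
  | 0 => x
  | i + 1 => v i

/-- Terms for numbers which are at most the length of a given word over `Option G`. Variables are
de Bruijn indices. -/
inductive Tm (G : Type) : Type
  | var (i : ℕ)
  | zero
  | succ (t : Tm G)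
  | pred (t : Tm G)
  | test (f : Option G → Bool) (t : Tm G)
  | letIn (t s : Tm G)
  | iter (n init step : Tm G)

namespace Tm

variable {G : Type}

/-- The value of a term. -/
def eval (U : List (Option G)) : Tm G → (ℕ → ℕ) → ℕ
  | var i, v => v i
  | zero, _ => 0
  | succ t, v => min (t.eval U v + 1) U.length
  | pred t, v => t.eval U v - 1
  | test f t, v => if f (U[t.eval U v]?).join then min 1 U.length else 0
  | letIn t s, v => s.eval U (envCons (t.eval U v) v)
  | iter n init step, v =>
    Nat.rec (init.eval U v) (fun i x => step.eval U (envCons x (envCons i v))) (n.eval U v)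

/-- The clamping of `succ` and `test` keeps all values representable in a register, and bounds the
length of every iteration by that of the word. -/
theorem eval_le {U : List (Option G)} (t : Tm G) {v : ℕ → ℕ} (hv : ∀ i, v i ≤ U.length) :
    t.eval U v ≤ U.length := by
  induction t generalizing v with
  | var i => exact hv i
  | zero => exact Nat.zero_le _
  | succ t _ => exact min_le_right _ _
  | pred t ih => exact (Nat.sub_le _ _).trans (ih hv)
  | test f t _ =>
    rw [eval]
    split_ifs
    · exact min_le_right _ _
    · exact Nat.zero_le _
  | letIn t s iht ihs =>
    refine ihs fun i => ?_
    cases i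
    · exact iht hv
    · exact hv _
  | iter n init step ihn ihi ihs =>
    rw [eval]
    have hn := ihn hv
    generalize n.eval U v = k at hn
    induction k with
    | zero => exact ihi hv
    | succ k ih =>
      refine ihs fun i => ?_
      rcases i with _ | _ | i
      · exact ih (by omega)
      · exact Nat.le_of_succ_le hn
      · exact hv _

open RegProg in
/-- Compute the value of a term in the register `d`; the variables are found in the registers
given by `ρ`, and the registers after `d` are free for use. -/
def compile : Tm G → (ℕ → ℕ) → ℕ → RegProg G
  | var i, ρ, d => copy (ρ i) d (d + 1)
  | zero, _, d => clear d
  | succ t, ρ, d => .seq (t.compile ρ d) (.inc d)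
  | pred t, ρ, d => .seq (t.compile ρ d) (.dec d)
  | test f t, ρ, d => .seq (t.compile ρ d) (.ite d f (.seq (clear d) (.inc d)) (clear d))
  | letIn t s, ρ, d => .seq (t.compile ρ d) (.seq (s.compile (envCons d ρ) (d + 1)) (move (d + 1) d))
  | iter n init step, ρ, d =>
    .seq (init.compile ρ d) (.seq (n.compile ρ (d + 1)) (.seq (clear (d + 2))
      (.loop (d + 1) (.seq (.dec (d + 1))
        (.seq (step.compile (envCons d (envCons (d + 2) ρ)) (d + 3))
          (.seq (move (d + 3) d) (.inc (d + 2))))))))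

open RegProg in
/-- The compiled program computes the value of the term in polynomial time. -/
theorem exists_does_compile (t : Tm G) : ∃ P : Polynomial ℕ, ∀ (U : List (Option G)) (ρ : ℕ → ℕ)
    (d : ℕ) (v : ℕ → ℕ), (∀ i, ρ i < d) → (∀ i, v i ≤ U.length) →
    Does U (P.eval U.length) (t.compile ρ d) v (fun v' => v' d = t.eval U (fun i => v (ρ i)) ∧
      (∀ i < d, v' i = v i) ∧ ∀ i, v' i ≤ U.length) := by
  have strengthen : ∀ {U : List (Option G)} {T : ℕ} {p : RegProg G} {v : ℕ → ℕ}
      {Q : (ℕ → ℕ) → Prop}, (∀ i, v i ≤ U.length) → Does U T p v Q →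
      Does U T p v (fun v' => Q v' ∧ ∀ i, v' i ≤ U.length) := by
    rintro U T p v Q hv ⟨v', t, h1, h2, h3⟩
    exact ⟨v', t, h1, h2, h3, h1.le_length hv⟩
  induction t with
  | var i =>
    refine ⟨11 * Polynomial.X + 4, fun U ρ d v hρ hv => ?_⟩
    have := hρ i
    refine (strengthen hv (does_copy (s := ρ i) (d := d) (e := d + 1) (by omega) (by omega)
      (by omega) hv)).mono (by simp) ?_
    rintro v' ⟨⟨h1, h2⟩, h3⟩
    exact ⟨h1, fun i hi => h2 i (by omega) (by omega), h3⟩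
  | zero =>
    refine ⟨2 * Polynomial.X + 1, fun U ρ d v hρ hv => ?_⟩
    refine (strengthen hv (does_clear (hv d))).mono (by simp) ?_
    rintro v' ⟨rfl, h3⟩
    exact ⟨by simp [eval], fun i hi => by simp [hi.ne], h3⟩
  | succ t ih =>
    obtain ⟨P, hP⟩ := ih
    refine ⟨P + 1, fun U ρ d v hρ hv => ?_⟩
    rw [Polynomial.eval_add, Polynomial.eval_one]
    refine (hP U ρ d v hρ hv).seq ?_
    rintro v' ⟨h1, h2, h3⟩
    refine (strengthen h3 (Does.inc (Q := fun v'' => v'' = _) rfl)).mono le_rfl ?_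
    rintro _ ⟨rfl, h4⟩
    exact ⟨by simp [eval, h1], fun i hi => by simp [hi.ne, h2 i hi], h4⟩
  | pred t ih =>
    obtain ⟨P, hP⟩ := ih
    refine ⟨P + 1, fun U ρ d v hρ hv => ?_⟩
    rw [Polynomial.eval_add, Polynomial.eval_one]
    refine (hP U ρ d v hρ hv).seq ?_
    rintro v' ⟨h1, h2, h3⟩
    refine (strengthen h3 (Does.dec (Q := fun v'' => v'' = _) rfl)).mono le_rfl ?_
    rintro _ ⟨rfl, h4⟩
    exact ⟨by simp [eval, h1], fun i hi => by simp [hi.ne, h2 i hi], h4⟩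
  | test f t ih =>
    obtain ⟨P, hP⟩ := ih
    refine ⟨P + (1 + ((2 * Polynomial.X + 1) + 1)), fun U ρ d v hρ hv => ?_⟩
    rw [Polynomial.eval_add]
    refine (hP U ρ d v hρ hv).seq ?_
    rintro v' ⟨h1, h2, h3⟩
    rcases hf : f (U[v' d]?).join with _ | _
    · obtain ⟨w, t, h4, h5, rfl, h6⟩ := strengthen h3 (does_clear (h3 d))
      refine ⟨_, _, .ite_false hf h4, by simp; omega, ?_, ?_, h6⟩
      · rw [h1] at hf
        simp [eval, hf]
      · exact fun i hi => by simp [hi.ne, h2 i hi]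
    · obtain ⟨w, t, h4, h5, rfl, h6⟩ := strengthen h3 (does_clear (h3 d))
      refine ⟨_, _, .ite_true hf (.seq h4 (.inc _ _)), by simp; omega, ?_, ?_,
        (Runs.inc d _).le_length h6⟩
      · rw [h1] at hf
        simp [eval, hf]
      · exact fun i hi => by simp [hi.ne, h2 i hi]
  | letIn t s iht ihs =>
    obtain ⟨P, hP⟩ := iht
    obtain ⟨P', hP'⟩ := ihs
    refine ⟨P + (P' + (5 * Polynomial.X + 2)), fun U ρ d v hρ hv => ?_⟩
    rw [Polynomial.eval_add, Polynomial.eval_add]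
    refine (hP U ρ d v hρ hv).seq ?_
    rintro v' ⟨h1, h2, h3⟩
    refine (hP' U (envCons d ρ) (d + 1) v' ?_ h3).seq ?_
    · rintro (_ | i)
      · exact Nat.lt_succ_self d
      · exact (hρ i).trans (Nat.lt_succ_self d)
    · rintro w ⟨h4, h5, h6⟩
      refine (strengthen h6 (does_move (s := d + 1) (d := d) (by omega) h6)).mono (by simp) ?_
      rintro w' ⟨⟨h7, h8⟩, h9⟩
      refine ⟨?_, fun i hi => ?_, h9⟩
      · rw [h7, h4, eval]
        congr 1
        funext i
        rcases i with _ | i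
        · exact h1
        · exact h2 _ (hρ i)
      · rw [h8 i (by omega) (by omega), h5 i (by omega), h2 i hi]
  | iter n init step ihn ihi ihs =>
    obtain ⟨Pn, hPn⟩ := ihn
    obtain ⟨Pi, hPi⟩ := ihi
    obtain ⟨Ps, hPs⟩ := ihs
    -- At most `U.length` passes are made, each of time polynomial in `U.length`. The depth of
    -- nesting is fixed by the term, so the bound remains a polynomial independent of the word.
    refine ⟨Pi + (Pn + ((2 * Polynomial.X + 1) +
      (Polynomial.X * ((1 + (Ps + ((5 * Polynomial.X + 2) + 1))) + 1) + 1))),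
      fun U ρ d v hρ hv => ?_⟩
    rw [Polynomial.eval_add, Polynomial.eval_add, Polynomial.eval_add]
    refine (hPi U ρ d v hρ hv).seq ?_
    rintro v1 ⟨h11, h12, h13⟩
    refine (hPn U ρ (d + 1) v1 (fun i => (hρ i).trans (Nat.lt_succ_self d)) h13).seq ?_
    rintro v2 ⟨h21, h22, h23⟩
    refine ((strengthen h23 (does_clear (h23 (d + 2)))).mono (by simp) fun _ h => h).seq ?_
    rintro v3 ⟨rfl, h33⟩
    have hρ1 : (fun i => v1 (ρ i)) = fun i => v (ρ i) := funext fun i => h12 _ (hρ i)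
    set N := n.eval U (fun i => v (ρ i)) with hN
    have hNle : N ≤ U.length := eval_le _ fun i => hv _
    let F : ℕ → ℕ := fun k => Nat.rec (init.eval U fun i => v (ρ i))
      (fun i x => step.eval U (envCons x (envCons i fun i => v (ρ i)))) k
    have hF : ∀ k, F (k + 1) = step.eval U (envCons (F k) (envCons k fun i => v (ρ i))) :=
      fun k => rfl
    -- With `k` passes left, register `d + 1` counts them down, `d + 2` counts the completed passes
    -- and serves as the recursion variable, and `d` holds the current value.
    refine (Does.loop (T := 1 + (Ps.eval U.length + ((5 * U.length + 2) + 1)))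
      (fun k w => k ≤ N ∧ w (d + 1) = k ∧ w (d + 2) = N - k ∧ w d = F (N - k) ∧
        (∀ i < d, w i = v i) ∧ ∀ i, w i ≤ U.length) (fun w h => h.2.1) ?_ N _ ?_).mono ?_ ?_
    · rintro k w ⟨h1, h2, h3, h4, h5, h6⟩
      refine ⟨by omega, ?_⟩
      refine (strengthen h6 (Does.dec (Q := fun v'' => v'' = Function.update w (d + 1) k)
        (by simp [h2]))).seq ?_
      rintro w1 ⟨rfl, h7⟩
      refine (hPs U (envCons d (envCons (d + 2) ρ)) (d + 3) _ ?_ h7).seq ?_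
      · rintro (_ | _ | i)
        · show d < d + 3
          omega
        · show d + 2 < d + 3
          omega
        · exact (hρ i).trans (by omega)
      · rintro w2 ⟨h8, h9, h10⟩
        refine (strengthen h10 (does_move (s := d + 3) (d := d) (by omega) h10)).seq ?_
        rintro w3 ⟨⟨h14, h15⟩, h16⟩
        have e1 : w3 (d + 1) = k := by
          rw [h15 _ (by omega) (by omega), h9 _ (by omega)]
          simp
        have e2 : w3 (d + 2) = N - (k + 1) := by
          rw [h15 _ (by omega) (by omega), h9 _ (by omega)]
          simp [h3]
        have e3 : w3 d = F (N - (k + 1) + 1) := by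
          rw [h14, h8, hF]
          congr 1
          funext i
          rcases i with _ | _ | i
          · simp [envCons, h4]
          · simp [envCons, h3]
          · have := hρ i
            simp only [envCons]
            rw [Function.update_of_ne (by omega), h5 _ this]
        refine (strengthen h16 (Does.inc (Q := fun v'' => v'' = _) rfl)).mono le_rfl ?_
        rintro w4 ⟨rfl, h17⟩
        refine ⟨by omega, by simp [e1], ?_, ?_, fun i hi => ?_, h17⟩
        · rw [Function.update_self, e2]
          omega
        · rw [Function.update_of_ne (by omega), e3, show N - k = N - (k + 1) + 1 by omega]
        · rw [Function.update_of_ne (by omega), h15 _ (by omega) (by omega), h9 _ (by omega),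
            Function.update_of_ne (by omega), h5 i hi]
    · refine ⟨le_rfl, ?_, by simp, ?_, fun i hi => ?_, h33⟩
      · rw [Function.update_of_ne (by omega), h21, hρ1]
      · rw [Function.update_of_ne (by omega), h22 _ (by omega), h11, Nat.sub_self]
        rfl
      · rw [Function.update_of_ne (by omega), h22 _ (by omega), h12 _ hi]
    · simp only [Polynomial.eval_add, Polynomial.eval_mul, Polynomial.eval_one, Polynomial.eval_X,
        Polynomial.eval_ofNat]
      gcongr
    · rintro w ⟨-, -, -, h4, h5, h6⟩
      exact ⟨h4, h5, h6⟩

/-- Renaming of variables. -/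
def rename : Tm G → (ℕ → ℕ) → Tm G
  | var i, ρ => var (ρ i)
  | zero, _ => zero
  | succ t, ρ => succ (t.rename ρ)
  | pred t, ρ => pred (t.rename ρ)
  | test f t, ρ => test f (t.rename ρ)
  | letIn t s, ρ => letIn (t.rename ρ) (s.rename (envCons 0 fun i => ρ i + 1))
  | iter n init step, ρ => iter (n.rename ρ) (init.rename ρ)
      (step.rename (envCons 0 (envCons 1 fun i => ρ i + 2)))

/-- This carries a term over to a context with one more number. -/
theorem eval_rename (U : List (Option G)) (t : Tm G) (ρ v : ℕ → ℕ) :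
    (t.rename ρ).eval U v = t.eval U fun i => v (ρ i) := by
  induction t generalizing ρ v with
  | var i => rfl
  | zero => rfl
  | succ t ih => simp only [rename, eval, ih]
  | pred t ih => simp only [rename, eval, ih]
  | test f t ih => simp only [rename, eval, ih]
  | letIn t s iht ihs =>
    simp only [rename, eval, iht, ihs]
    congr 1
    funext i
    cases i <;> rfl
  | iter n init step ihn ihi ihs =>
    simp only [rename, eval, ihn, ihi, ihs]
    congr 1
    funext i x
    congr 1
    funext j
    rcases j with _ | _ | j <;> rfl

end Tm

/-! ### Definable functions -/

open RegProg (padded padLength)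

/-- Types whose elements consist of a word and finitely many numbers. -/
class NumCtx (G : outParam Type) (α : Type) where
  /-- the word -/
  word : α → List G
  /-- the numbers, indexed from the most recent one -/
  env : α → ℕ → ℕ
  /-- the index of the number that is the bound on all numbers -/
  top : ℕ
  env_top (a : α) : env a top = (padded (word a)).length

namespace NumCtx

variable {G : Type}

instance : NumCtx G (List G) where
  word := id
  env u _ := (padded u).length
  top := 0
  env_top _ := rfl

instance {α : Type} [NumCtx G α] : NumCtx G (α × ℕ) where
  word a := word a.1
  env a := envCons a.2 (env a.1)
  top := top (α := α) + 1
  env_top a := env_top a.1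

/-- The bound on the numbers. -/
def cap {α : Type} [NumCtx G α] (a : α) : ℕ := (padded (word a)).length

/-- All numbers are within the bound. -/
def Valid {α : Type} [NumCtx G α] (a : α) : Prop := ∀ i, env a i ≤ cap a

theorem valid_list (u : List G) : Valid u := fun _ => le_rfl

theorem Valid.fst {α : Type} [NumCtx G α] {a : α × ℕ} (h : Valid a) : Valid a.1 :=
  fun i => h (i + 1)

theorem Valid.snd_le {α : Type} [NumCtx G α] {a : α × ℕ} (h : Valid a) : a.2 ≤ cap a.1 := h 0

theorem Valid.mk {α : Type} [NumCtx G α] {a : α} (h : Valid a) {x : ℕ} (hx : x ≤ cap a) :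
    Valid (a, x) := by
  rintro (_ | i)
  · exact hx
  · exact h i

theorem cap_eq {α : Type} [NumCtx G α] (a : α) : cap a = (word a).length + padLength :=
  RegProg.length_padded _

theorem padLength_le_cap {α : Type} [NumCtx G α] (a : α) : padLength ≤ cap a := by
  rw [cap_eq]
  omega

theorem one_le_cap {α : Type} [NumCtx G α] (a : α) : 1 ≤ cap a :=
  le_trans (by simp [padLength]) (padLength_le_cap a)

end NumCtx

open NumCtx

/-- `f` is computed, up to the bound on the numbers, by a term. -/
def Definable {G α : Type} [NumCtx G α] (f : α → ℕ) : Prop :=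
  ∃ t : Tm G, ∀ a, Valid a → t.eval (padded (word a)) (env a) = min (f a) (cap a)

open Classical in
/-- The indicator function of a predicate is definable. -/
def DefinablePred {G α : Type} [NumCtx G α] (P : α → Prop) : Prop :=
  Definable fun a => if P a then 1 else 0

/-! ### Closure properties of definable functions. -/

namespace Definable

variable {G α : Type} [NumCtx G α] {f g : α → ℕ}

theorem congr (hf : Definable f) (h : ∀ a, Valid a → f a = g a) : Definable g := by
  obtain ⟨t, ht⟩ := hf
  exact ⟨t, fun a ha => by rw [ht a ha, h a ha]⟩

theorem min_cap (hf : Definable f) : Definable fun a => min (f a) (cap a) := by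
  obtain ⟨t, ht⟩ := hf
  exact ⟨t, fun a ha => by rw [ht a ha, min_assoc, min_self]⟩

/-- Definability sees only the truncation at the cap. So functions may grow beyond the cap as long
as the operations applied to them respect saturation. -/
theorem of_min_cap (hf : Definable g) (h : ∀ a, Valid a → min (g a) (cap a) = min (f a) (cap a)) :
    Definable f := by
  obtain ⟨t, ht⟩ := hf
  exact ⟨t, fun a ha => by rw [ht a ha, h a ha]⟩

theorem cap : Definable fun a : α => cap a :=
  ⟨.var (top (α := α)), fun a _ => by rw [min_self]; exact env_top a⟩

theorem var : Definable fun a : α × ℕ => a.2 :=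
  ⟨.var 0, fun _ ha => (min_eq_left ha.snd_le).symm⟩

theorem lift (hf : Definable f) : Definable fun a : α × ℕ => f a.1 := by
  obtain ⟨t, ht⟩ := hf
  refine ⟨t.rename (· + 1), fun a ha => ?_⟩
  rw [Tm.eval_rename]
  exact ht a.1 ha.fst

theorem succ (hf : Definable f) : Definable fun a => f a + 1 := by
  obtain ⟨t, ht⟩ := hf
  refine ⟨.succ t, fun a ha => ?_⟩
  rw [Tm.eval, ht a ha]
  change min (min (f a) (NumCtx.cap a) + 1) (NumCtx.cap a) = min (f a + 1) (NumCtx.cap a)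
  omega

theorem const (c : ℕ) : Definable fun _ : α => c := by
  induction c with
  | zero => exact ⟨.zero, fun a _ => by simp [Tm.eval]⟩
  | succ c ih => exact ih.succ

/-- Decrementing does not respect saturation: a value above the cap would come out as the cap minus
one. Hence the bound on `f`. -/
theorem pred (hf : Definable f) (h : ∀ a, Valid a → f a ≤ NumCtx.cap a) :
    Definable fun a => f a - 1 := by
  obtain ⟨t, ht⟩ := hf
  refine ⟨.pred t, fun a ha => ?_⟩
  have := h a ha
  rw [Tm.eval, ht a ha]
  simp only
  omega

/-- Primitive recursion, where the recursion step is compatible with the bound on the numbers. -/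
theorem iter {n : α → ℕ} {F : (α × ℕ) × ℕ → ℕ} (hn : Definable n) (hf : Definable f)
    (hF : Definable F) (h1 : ∀ a, Valid a → n a ≤ NumCtx.cap a)
    (h2 : ∀ a, Valid a → ∀ i < n a, ∀ x,
      min (F ((a, i), min x (NumCtx.cap a))) (NumCtx.cap a) = min (F ((a, i), x)) (NumCtx.cap a)) :
    Definable fun a => Nat.rec (f a) (fun i x => F ((a, i), x)) (n a) := by
  obtain ⟨tn, htn⟩ := hn
  obtain ⟨tf, htf⟩ := hf
  obtain ⟨tF, htF⟩ := hF
  refine ⟨.iter tn tf tF, fun a ha => ?_⟩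
  rw [Tm.eval, htn a ha, min_eq_left (h1 a ha)]
  suffices h : ∀ k ≤ n a, (Nat.rec (tf.eval (padded (word a)) (env a))
      (fun i x => tF.eval (padded (word a)) (envCons x (envCons i (env a)))) k : ℕ) =
      min (Nat.rec (f a) (fun i x => F ((a, i), x)) k) (NumCtx.cap a) from h _ le_rfl
  intro k hk
  induction k with
  | zero => exact htf a ha
  | succ k ih =>
    simp only
    rw [ih (by omega), ← h2 a ha k hk]
    exact htF ((a, k), _) ((ha.mk (by have := h1 a ha; omega)).mk (min_le_right _ _))

/-- Primitive recursion with bounded values. -/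
theorem iter_of_le {n : α → ℕ} {F : (α × ℕ) × ℕ → ℕ} (hn : Definable n) (hf : Definable f)
    (hF : Definable F) (h1 : ∀ a, Valid a → n a ≤ NumCtx.cap a)
    (h2 : ∀ a, Valid a → ∀ k ≤ n a,
      (Nat.rec (f a) (fun i x => F ((a, i), x)) k : ℕ) ≤ NumCtx.cap a) :
    Definable fun a => Nat.rec (f a) (fun i x => F ((a, i), x)) (n a) := by
  obtain ⟨tn, htn⟩ := hn
  obtain ⟨tf, htf⟩ := hf
  obtain ⟨tF, htF⟩ := hF
  refine ⟨.iter tn tf tF, fun a ha => ?_⟩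
  rw [Tm.eval, htn a ha, min_eq_left (h1 a ha)]
  suffices h : ∀ k ≤ n a, (Nat.rec (tf.eval (padded (word a)) (env a))
      (fun i x => tF.eval (padded (word a)) (envCons x (envCons i (env a)))) k : ℕ) =
      min (Nat.rec (f a) (fun i x => F ((a, i), x)) k) (NumCtx.cap a) from h _ le_rfl
  intro k hk
  induction k with
  | zero => exact htf a ha
  | succ k ih =>
    have h3 := h2 a ha k (by omega)
    simp only
    rw [ih (by omega), min_eq_left h3]
    exact htF ((a, k), _) ((ha.mk (by have := h1 a ha; omega)).mk h3)

/-- Addition is an iterated successor. Truncating the number of iterations is harmless, since that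
many successors already reach the cap. -/
theorem add (hf : Definable f) (hg : Definable g) : Definable fun a => f a + g a := by
  have h := iter (F := fun a => a.2 + 1) hg.min_cap hf var.succ (fun a _ => min_le_right _ _)
    (fun a _ i _ x => by simp only; omega)
  refine h.of_min_cap fun a _ => ?_
  have : ∀ k, (Nat.rec (f a) (fun _ x => x + 1) k : ℕ) = f a + k := fun k => by
    induction k with
    | zero => rfl
    | succ k ih => simp only [ih]; rfl
  simp only
  rw [this]
  omega

theorem mul (hf : Definable f) (hg : Definable g) : Definable fun a => f a * g a := by
  have h := iter (F := fun a => a.2 + g a.1.1) hf.min_cap (const 0) (var.add hg.lift.lift)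
    (fun a _ => min_le_right _ _) (fun a _ i _ x => by simp only; omega)
  refine h.of_min_cap fun a _ => ?_
  have : ∀ k, (Nat.rec 0 (fun _ x => x + g a) k : ℕ) = k * g a := fun k => by
    induction k with
    | zero => simp
    | succ k ih => simp only [ih, Nat.succ_mul]
  simp only
  rw [this]
  -- The number of additions was truncated. If this changed it, the product is zero or has reached
  -- the cap in either case.
  rcases le_total (f a) (NumCtx.cap a) with h1 | h1
  · rw [min_eq_left h1]
  · rw [min_eq_right h1]
    rcases Nat.eq_zero_or_pos (g a) with h2 | h2
    · simp [h2]
    · rw [min_eq_right (Nat.le_mul_of_pos_right _ h2),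
        min_eq_right (h1.trans (Nat.le_mul_of_pos_right _ h2))]

/-- Only the minuend needs a bound: a subtrahend beyond the cap gives zero, with or without
truncation. -/
theorem sub (hf : Definable f) (hg : Definable g) (h : ∀ a, Valid a → f a ≤ NumCtx.cap a) :
    Definable fun a => f a - g a := by
  have key : ∀ a k, (Nat.rec (f a) (fun _ x => x - 1) k : ℕ) = f a - k := fun a k => by
    induction k with
    | zero => rfl
    | succ k ih =>
      simp only [ih]
      omega
  have hp : Definable fun a : (α × ℕ) × ℕ => a.2 - 1 := var.pred fun a ha => ha.snd_le
  have h1 := iter_of_le (F := fun a => a.2 - 1) hg.min_cap hf hp (fun a _ => min_le_right _ _)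
    (fun a ha k _ => by
      simp only
      rw [key]
      exact (Nat.sub_le _ _).trans (h a ha))
  refine h1.congr fun a ha => ?_
  simp only
  rw [key]
  have := h a ha
  omega

end Definable

/-! ### Closure properties of definable predicates. -/

namespace DefinablePred

open Definable

variable {G α : Type} [NumCtx G α] {f g : α → ℕ} {P Q : α → Prop}

theorem congr (hP : DefinablePred P) (h : ∀ a, Valid a → (P a ↔ Q a)) : DefinablePred Q := by
  classical
  exact Definable.congr hP fun a ha => by simp only [h a ha]

theorem indicator (hP : DefinablePred P) [DecidablePred P] :
    Definable fun a => if P a then 1 else 0 :=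
  Definable.congr hP fun a _ => by split_ifs <;> rfl

theorem not (hP : DefinablePred P) : DefinablePred fun a => ¬P a := by
  refine Definable.congr ((const 1).sub hP fun a _ => one_le_cap a) fun a _ => ?_
  by_cases h : P a <;> simp [h]

theorem and (hP : DefinablePred P) (hQ : DefinablePred Q) : DefinablePred fun a => P a ∧ Q a := by
  refine Definable.congr (Definable.mul hP hQ) fun a _ => ?_
  by_cases h : P a <;> by_cases h' : Q a <;> simp [h, h']

theorem imp (hP : DefinablePred P) (hQ : DefinablePred Q) : DefinablePred fun a => P a → Q a :=
  (hP.and hQ.not).not.congr fun a _ => by tauto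

theorem iff (hP : DefinablePred P) (hQ : DefinablePred Q) : DefinablePred fun a => P a ↔ Q a :=
  ((hP.imp hQ).and (hQ.imp hP)).congr fun a _ => by tauto

/-- The indicator is `1 - (f - g)` in truncated subtraction, so the bound is needed on the left side
only. -/
theorem le (hf : Definable f) (hg : Definable g) (h : ∀ a, Valid a → f a ≤ NumCtx.cap a) :
    DefinablePred fun a => f a ≤ g a := by
  refine Definable.congr ((const 1).sub (hf.sub hg h) fun a _ => one_le_cap a) fun a _ => ?_
  split_ifs with h <;> omega

/-- Equality, where one side may exceed the bound. -/
theorem eq (hf : Definable f) (hg : Definable g) (h : ∀ a, Valid a → g a < NumCtx.cap a) :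
    DefinablePred fun a => f a = g a :=
  ((le hg hf fun a ha => (h a ha).le).and (le hg.succ hf h).not).congr fun a _ => by omega

/-- Blanks and positions past the end both read as `none`, so a position truncated at the cap gives
the same symbol. -/
theorem read (p : Option G → Prop) (hf : Definable f) : DefinablePred fun a => p (word a)[f a]? := by
  classical
  obtain ⟨t, ht⟩ := hf
  refine ⟨.test (fun o => decide (p o)) t, fun a ha => ?_⟩
  have h1 : ((padded (word a))[min (f a) (cap a)]?).join = (word a)[f a]? := by
    have hc := cap_eq a
    have hp : 0 < padLength := by simp [padLength]
    rcases lt_or_ge (f a) (word a).length with h | h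
    · rw [min_eq_left (by omega), padded, List.getElem?_append_left (by simpa using h)]
      simp [h]
    · rw [padded, List.getElem?_append_right (by simp; omega), List.getElem?_replicate,
        List.getElem?_eq_none h]
      split_ifs <;> rfl
  rw [Tm.eval, ht a ha, h1]
  change (if _ then min 1 (cap a) else 0) = _
  by_cases h : p (word a)[f a]? <;> simp [h]

end DefinablePred

namespace Definable

variable {G α : Type} [NumCtx G α] {f g : α → ℕ} {P : α → Prop}

theorem ite [DecidablePred P] (hP : DefinablePred P) (hf : Definable f) (hg : Definable g) :
    Definable fun a => if P a then f a else g a :=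
  ((hP.indicator.mul hf).add (hP.not.indicator.mul hg)).congr fun a _ => by
    by_cases h : P a <;> simp [h]

theorem min (hf : Definable f) (hg : Definable g) (h : ∀ a, Valid a → f a ≤ NumCtx.cap a) :
    Definable fun a => min (f a) (g a) :=
  (ite (DefinablePred.le hf hg h) hf hg).congr fun a _ => by simp only [min_def]

theorem count {P : α × ℕ → Prop} (hP : DefinablePred P) (hf : Definable f)
    (h : ∀ a, Valid a → f a ≤ NumCtx.cap a) [∀ a, DecidablePred fun x => P (a, x)] :
    Definable fun a => Nat.count (fun x => P (a, x)) (f a) := by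
  classical
  have key : ∀ a k, (Nat.rec 0 (fun i x => x + if P (a, i) then 1 else 0) k : ℕ) =
      Nat.count (fun x => P (a, x)) k := fun a k => by
    induction k with
    | zero => simp
    | succ k ih => simp only [ih, Nat.count_succ]
  refine (iter_of_le (F := fun a => a.2 + if P a.1 then 1 else 0) hf (const 0)
    (var.add (lift hP.indicator)) h fun a ha k hk => ?_).congr fun a _ => key a _
  simp only
  rw [key]
  exact (Nat.count_le _).trans (hk.trans (h a ha))

theorem finset_sum {ι : Type} (s : Finset ι) {F : ι → α → ℕ} (h : ∀ i, Definable (F i)) :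
    Definable fun a => ∑ i ∈ s, F i a := by
  classical
  induction s using Finset.induction_on with
  | empty => exact (const 0).congr fun a _ => by simp
  | insert i s hi ih => exact ((h i).add ih).congr fun a _ => by rw [Finset.sum_insert hi]

/-- A function of the symbol at a definable position. -/
theorem read [Fintype G] (F : Option G → ℕ) (hf : Definable f) :
    Definable fun a => F (word a)[f a]? := by
  classical
  refine (finset_sum Finset.univ fun o : Option G =>
    (DefinablePred.read (fun o' => o' = o) hf).indicator.mul (const (F o))).congr fun a _ => ?_
  simp

/-- An arbitrary function of small numbers. -/
theorem table (F : ℕ → ℕ) (hf : Definable f) (c : ℕ) (hc : c < padLength)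
    (h : ∀ a, Valid a → f a ≤ c) : Definable fun a => F (f a) := by
  classical
  refine (finset_sum (Finset.range (c + 1)) fun i : ℕ =>
    (DefinablePred.eq (const i) hf fun a ha => ((h a ha).trans_lt hc).trans_le
      (padLength_le_cap a)).indicator.mul (const (F i))).congr fun a ha => ?_
  have := h a ha
  simp
  omega

theorem length_word : Definable fun a : α => (word a).length :=
  (cap.sub (const padLength) fun _ _ => le_rfl).congr fun a _ => by rw [cap_eq]; omega

end Definable

/-! ### Bounded quantifiers, and the passage to machines. -/

namespace DefinablePred

open Definable

variable {G α : Type} [NumCtx G α] {f g : α → ℕ}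

theorem exists_lt {P : α × ℕ → Prop} (hP : DefinablePred P) (hf : Definable f)
    (h : ∀ a, Valid a → f a ≤ NumCtx.cap a) : DefinablePred fun a => ∃ x < f a, P (a, x) := by
  classical
  refine (le (const 1) (count hP hf h) fun a _ => one_le_cap a).congr fun a _ => ?_
  rw [Nat.one_le_iff_ne_zero, Nat.count_ne_iff_exists]

theorem forall_lt {P : α × ℕ → Prop} (hP : DefinablePred P) (hf : Definable f)
    (h : ∀ a, Valid a → f a ≤ NumCtx.cap a) : DefinablePred fun a => ∀ x < f a, P (a, x) :=
  (hP.not.exists_lt hf h).not.congr fun a _ => by push Not; rfl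

/-- A definable predicate of words is decidable in polynomial time. -/
theorem nonempty_computableInPolyTime [Fintype G] {P : List G → Prop} (hP : DefinablePred P)
    {β : Type} (ea : β → List G) (pre : List G) (V : β → Bool)
    (hV : ∀ b, V b = true ↔ P (pre ++ ea b)) :
    Nonempty (Turing.TM2ComputableInPolyTime ea Computability.encodeBool V) := by
  classical
  obtain ⟨t, ht⟩ := hP
  obtain ⟨T, hT⟩ := t.exists_does_compile
  -- For a bare word, every variable denotes the length of the padded word, which is the initial
  -- content of register `0`. The result appears in register `1`.
  refine RegProg.nonempty_computableInPolyTime ea V (t.compile (fun _ => 0) 1) pre 1 T fun b => ?_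
  obtain ⟨v, k, h1, h2, h3, -⟩ := hT (padded (pre ++ ea b)) (fun _ => 0) 1
    (fun _ => (padded (pre ++ ea b)).length) (fun _ => Nat.zero_lt_one) fun _ => le_rfl
  refine ⟨v, k, h1, h2, ?_⟩
  have h4 := ht (pre ++ ea b) (valid_list _)
  have h5 : v 1 = _ := h3.trans h4
  rw [h5, Bool.eq_iff_iff, hV, decide_eq_true_eq]
  have := one_le_cap (pre ++ ea b)
  simp only
  split_ifs with h
  · simp [h]
    omega
  · simp [h]

end DefinablePred

/-! ### Words as sequences of integers with separators -/

/-- The end-of-line symbol or a space. -/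
def sepSymbol (b : Bool) : TextSymbol := if b then .newline else .space

/-- An integer, followed by an end-of-line symbol or a space. -/
def tokenText (a : ℤ × Bool) : List TextSymbol := intText a.1 ++ [sepSymbol a.2]

/-- A sequence of integers with separators. -/
def tokensText (E : List (ℤ × Bool)) : List TextSymbol := E.flatMap tokenText

@[simp] theorem tokensText_nil : tokensText [] = [] := rfl

@[simp] theorem tokensText_cons (a : ℤ × Bool) (E : List (ℤ × Bool)) :
    tokensText (a :: E) = tokenText a ++ tokensText E := rfl

@[simp] theorem tokensText_append (E F : List (ℤ × Bool)) :
    tokensText (E ++ F) = tokensText E ++ tokensText F := List.flatMap_append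

theorem natText_zero : natText 0 = [.digit 0] := rfl

theorem exists_natText_eq_cons {a : ℕ} (ha : a ≠ 0) :
    ∃ (d : Fin 10) (ds : List (Fin 10)), d ≠ 0 ∧ natText a = .digit d :: ds.map .digit := by
  have hne : Nat.digits 10 a ≠ [] := Nat.digits_ne_nil_iff_ne_zero.2 ha
  refine ⟨Fin.ofNat 10 ((Nat.digits 10 a).getLast hne),
    ((Nat.digits 10 a).dropLast.map (Fin.ofNat 10)).reverse, ?_, ?_⟩
  · have h1 := Nat.getLast_digit_ne_zero 10 ha
    have h2 := Nat.digits_lt_base (b := 10) (by norm_num) (List.getLast_mem hne)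
    intro h
    have := congrArg Fin.val h
    simp only [Fin.ofNat, Fin.val_zero] at this
    omega
  · rw [natText, if_neg ha]
    conv_lhs => rw [← List.dropLast_append_getLast hne]
    simp [List.map_reverse]
    rfl

/-- Needed to recover an integer from the digits that the automaton has accepted. -/
theorem exists_natText_eq (d : Fin 10) (hd : d ≠ 0) (ds : List (Fin 10)) :
    ∃ a ≠ 0, natText a = .digit d :: ds.map .digit := by
  set L : List ℕ := ((d :: ds).reverse).map Fin.val with hL
  have hdig : Nat.digits 10 (Nat.ofDigits 10 L) = L := by
    refine Nat.digits_ofDigits 10 (by norm_num) L (fun l hl => ?_) fun h => ?_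
    · obtain ⟨c, -, rfl⟩ := List.mem_map.1 hl
      exact c.2
    · simp only [hL, List.getLast_map, List.getLast_reverse, List.head_cons]
      exact fun h => hd (Fin.ext h)
  have hne : Nat.ofDigits 10 L ≠ 0 := by
    intro h
    rw [h] at hdig
    simp [hL] at hdig
  refine ⟨Nat.ofDigits 10 L, hne, ?_⟩
  rw [natText, if_neg hne, hdig, hL, List.map_map, List.map_reverse, List.reverse_reverse,
    List.map_cons]
  congr 1
  · simp
  · refine List.map_congr_left fun c _ => ?_
    simp

theorem mem_natText {a : ℕ} {c : TextSymbol} (hc : c ∈ natText a) : ∃ d, c = .digit d := by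
  rcases eq_or_ne a 0 with rfl | h
  · exact ⟨0, by simpa [natText_zero] using hc⟩
  · obtain ⟨d, ds, -, h'⟩ := exists_natText_eq_cons h
    rw [h', List.mem_cons, List.mem_map] at hc
    rcases hc with rfl | ⟨e, -, rfl⟩
    · exact ⟨_, rfl⟩
    · exact ⟨_, rfl⟩

theorem lt_pow_length_natText (a : ℕ) : a < 10 ^ (natText a).length := by
  rcases eq_or_ne a 0 with rfl | h
  · simp
  · rw [natText, if_neg h, List.length_reverse, List.length_map]
    exact Nat.lt_base_pow_length_digits (by norm_num)

theorem natText_getElem? {a l : ℕ} (hl : l < (natText a).length) :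
    (natText a)[(natText a).length - 1 - l]? = some (.digit (Fin.ofNat 10 (a / 10 ^ l % 10))) := by
  rcases eq_or_ne a 0 with rfl | h
  · rw [natText_zero]
    simp
  · have h1 : (natText a).length = (Nat.digits 10 a).length := by
      rw [natText, if_neg h, List.length_reverse, List.length_map]
    rw [h1] at hl ⊢
    rw [natText, if_neg h, List.getElem?_reverse (by simp; omega)]
    simp only [List.length_map, List.getElem?_map]
    rw [show (Nat.digits 10 a).length - 1 - ((Nat.digits 10 a).length - 1 - l) = l by omega,
      ← Nat.getD_digits a l (by norm_num : 2 ≤ 10), List.getD_eq_getElem?_getD,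
      List.getElem?_eq_getElem hl]
    simp

theorem length_natText_le {a b : ℕ} (h : a < 10 ^ b) (hb : 0 < b) : (natText a).length ≤ b := by
  rcases eq_or_ne a 0 with rfl | h0
  · rw [natText_zero]
    exact hb
  · rw [natText, if_neg h0, List.length_reverse, List.length_map]
    exact (Nat.digits_length_le_iff (by norm_num) a).2 h

/-! ### Recognition by a finite automaton -/

/-- The transitions of an automaton that recognizes sequences of integers with separators. -/
def scanStep : ℕ → TextSymbol → ℕ
  -- State `0` expects a sign, `1` and `2` follow a plus and a minus, `3` follows the lone digit
  -- zero, `4` lies inside a numeral with nonzero leading digit, and `5` is dead. Negative zero and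
  -- leading zeros are rejected.
  | 0, .plus => 1
  | 0, .minus => 2
  | 1, .digit d => if d = 0 then 3 else 4
  | 2, .digit d => if d = 0 then 5 else 4
  | 3, .space => 0
  | 3, .newline => 0
  | 4, .digit _ => 4
  | 4, .space => 0
  | 4, .newline => 0
  | _, _ => 5

theorem scanStep_le (s : ℕ) (c : TextSymbol) : scanStep s c ≤ 5 := by
  rcases s with _ | _ | _ | _ | _ | s <;> cases c <;> simp [scanStep] <;> split_ifs <;> simp

theorem foldl_scanStep_digits (ds : List (Fin 10)) :
    (ds.map TextSymbol.digit).foldl scanStep 4 = 4 := by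
  induction ds with
  | nil => rfl
  | cons d ds ih => simpa [scanStep] using ih

theorem foldl_scanStep_tokenText (a : ℤ × Bool) : (tokenText a).foldl scanStep 0 = 0 := by
  obtain ⟨x, b⟩ := a
  have hb : scanStep 3 (sepSymbol b) = 0 ∧ scanStep 4 (sepSymbol b) = 0 := by
    cases b <;> simp [sepSymbol, scanStep]
  rcases eq_or_ne x 0 with rfl | h
  · simp only [tokenText, intText, natText_zero, lt_irrefl, if_false, Int.natAbs_zero,
      List.foldl_append, List.foldl_cons, List.foldl_nil]
    exact hb.1
  · obtain ⟨d, ds, hd, h'⟩ := exists_natText_eq_cons (Int.natAbs_ne_zero.2 h)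
    simp only [tokenText, intText, h', List.foldl_append, List.foldl_cons, List.foldl_nil]
    have : scanStep (scanStep 0 (if x < 0 then TextSymbol.minus else TextSymbol.plus))
        (TextSymbol.digit d) = 4 := by
      split_ifs <;> simp [scanStep, hd]
    rw [this, foldl_scanStep_digits, hb.2]

theorem scanStep_dead (z : List TextSymbol) : z.foldl scanStep 5 = 5 := by
  induction z with
  | nil => rfl
  | cons c z ih => simpa [scanStep] using ih

/-- What the automaton accepts from each of its states. -/
theorem scan_states (z : List TextSymbol) :
    (z.foldl scanStep 0 = 0 → ∃ E, z = tokensText E) ∧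
    (z.foldl scanStep 1 = 0 → ∃ a b E, z = natText a ++ sepSymbol b :: tokensText E) ∧
    (z.foldl scanStep 2 = 0 → ∃ a b E, a ≠ 0 ∧ z = natText a ++ sepSymbol b :: tokensText E) ∧
    (z.foldl scanStep 3 = 0 → ∃ b E, z = sepSymbol b :: tokensText E) ∧
    (z.foldl scanStep 4 = 0 → ∃ (ds : List (Fin 10)) (b : Bool) (E : List (ℤ × Bool)),
      z = ds.map .digit ++ sepSymbol b :: tokensText E) := by
  induction z with
  | nil => exact ⟨fun _ => ⟨[], rfl⟩, by simp, by simp, by simp, by simp⟩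
  | cons c z ih =>
    obtain ⟨h0, h1, h2, h3, h4⟩ := ih
    refine ⟨fun h => ?_, fun h => ?_, fun h => ?_, fun h => ?_, fun h => ?_⟩ <;>
      rw [List.foldl_cons] at h
    · cases c with
      | plus =>
        obtain ⟨a, b, E, rfl⟩ := h1 h
        exact ⟨((a : ℤ), b) :: E, by simp [tokenText, intText]⟩
      | minus =>
        obtain ⟨a, b, E, ha, rfl⟩ := h2 h
        refine ⟨(-(a : ℤ), b) :: E, ?_⟩
        have : 0 < a := Nat.pos_of_ne_zero ha
        simp [tokenText, intText, this]
      | _ => simp [scanStep, scanStep_dead] at h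
    · cases c with
      | digit d =>
        by_cases hd : d = 0
        · simp only [scanStep, hd, if_true] at h
          obtain ⟨b, E, rfl⟩ := h3 h
          exact ⟨0, b, E, by simp [natText_zero, hd]⟩
        · simp only [scanStep, hd, if_false] at h
          obtain ⟨ds, b, E, rfl⟩ := h4 h
          obtain ⟨a, -, ha⟩ := exists_natText_eq d hd ds
          exact ⟨a, b, E, by simp [ha]⟩
      | _ => simp [scanStep, scanStep_dead] at h
    · cases c with
      | digit d =>
        by_cases hd : d = 0
        · simp [scanStep, hd, scanStep_dead] at h
        · simp only [scanStep, hd, if_false] at h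
          obtain ⟨ds, b, E, rfl⟩ := h4 h
          obtain ⟨a, ha0, ha⟩ := exists_natText_eq d hd ds
          exact ⟨a, b, E, ha0, by simp [ha]⟩
      | _ => simp [scanStep, scanStep_dead] at h
    · cases c with
      | space =>
        obtain ⟨E, rfl⟩ := h0 h
        exact ⟨false, E, rfl⟩
      | newline =>
        obtain ⟨E, rfl⟩ := h0 h
        exact ⟨true, E, rfl⟩
      | _ => simp [scanStep, scanStep_dead] at h
    · cases c with
      | space =>
        obtain ⟨E, rfl⟩ := h0 h
        exact ⟨[], false, E, rfl⟩
      | newline =>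
        obtain ⟨E, rfl⟩ := h0 h
        exact ⟨[], true, E, rfl⟩
      | digit d =>
        obtain ⟨ds, b, E, rfl⟩ := h4 h
        exact ⟨d :: ds, b, E, rfl⟩
      | _ => simp [scanStep, scanStep_dead] at h

theorem scan_eq_zero_iff (z : List TextSymbol) :
    z.foldl scanStep 0 = 0 ↔ ∃ E, z = tokensText E := by
  refine ⟨(scan_states z).1, ?_⟩
  rintro ⟨E, rfl⟩
  induction E with
  | nil => rfl
  | cons a E ih => rw [tokensText_cons, List.foldl_append, foldl_scanStep_tokenText, ih]

/-! ### Positions of the integers -/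

/-- The separators. -/
def isSep : TextSymbol → Bool
  | .space => true
  | .newline => true
  | _ => false

/-- The number of separators before a position. -/
def sepCount (z : List TextSymbol) (p : ℕ) : ℕ := (z.take p).countP isSep

/-- The position where the integer with a given index starts. -/
def tokenStart (z : List TextSymbol) (q : ℕ) : ℕ :=
  Nat.count (fun p => sepCount z p + 1 ≤ q) z.length

theorem sepCount_le (z : List TextSymbol) (p : ℕ) : sepCount z p ≤ z.length :=
  (List.countP_le_length).trans (by simp)

theorem sepCount_mono (z : List TextSymbol) : Monotone (sepCount z) := fun _ _ h =>
  (List.take_sublist_take_left h).countP_le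

theorem countP_isSep_intText (x : ℤ) : (intText x).countP isSep = 0 := by
  rw [List.countP_eq_zero]
  intro c hc
  rw [intText, List.mem_cons] at hc
  rcases hc with rfl | hc
  · split_ifs <;> simp [isSep]
  · obtain ⟨d, rfl⟩ := mem_natText hc
    simp [isSep]

theorem isSep_sepSymbol (b : Bool) : isSep (sepSymbol b) = true := by
  cases b <;> rfl

theorem countP_isSep_tokensText (E : List (ℤ × Bool)) :
    (tokensText E).countP isSep = E.length := by
  induction E with
  | nil => rfl
  | cons a E ih =>
    rw [tokensText_cons, List.countP_append, ih, tokenText, List.countP_append,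
      countP_isSep_intText]
    simp [isSep_sepSymbol]
    omega

theorem sepCount_length (E : List (ℤ × Bool)) :
    sepCount (tokensText E) (tokensText E).length = E.length := by
  rw [sepCount, List.take_length, countP_isSep_tokensText]

theorem tokensText_eq {E : List (ℤ × Bool)} {q : ℕ} {a : ℤ × Bool} (h : E[q]? = some a) :
    tokensText E = tokensText (E.take q) ++ (intText a.1 ++
      (sepSymbol a.2 :: tokensText (E.drop (q + 1)))) := by
  obtain ⟨hq, rfl⟩ := List.getElem?_eq_some_iff.1 h
  conv_lhs => rw [← List.take_append_drop q E, List.drop_eq_getElem_cons hq]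
  rw [tokensText_append, tokensText_cons, tokenText, List.append_assoc, List.singleton_append]

theorem count_lt_eq {n T : ℕ} (h : T ≤ n) (P : ℕ → Prop) [DecidablePred P]
    (hP : ∀ p, P p ↔ p < T) : Nat.count P n = T := by
  obtain ⟨k, rfl⟩ := Nat.exists_eq_add_of_le h
  rw [Nat.count_add, Nat.count_of_forall fun p hp => (hP p).2 hp, Nat.count_of_forall_not]
  · rfl
  · intro p _
    rw [hP]
    omega

/-- The positions preceded by fewer than `q` separators form an initial segment, as `sepCount` is
monotone. It ends right after the separator numbered `q`, so its size is the required position; for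
`q = E.length` this is the end of the text. -/
theorem tokenStart_tokensText {E : List (ℤ × Bool)} {q : ℕ} (hq : q ≤ E.length) :
    tokenStart (tokensText E) q = (tokensText (E.take q)).length := by
  have hE : tokensText E = tokensText (E.take q) ++ tokensText (E.drop q) := by
    rw [← tokensText_append, List.take_append_drop]
  apply count_lt_eq
  · conv_rhs => rw [hE, List.length_append]
    omega
  · intro p
    rcases lt_or_ge p (tokensText (E.take q)).length with h | h
    · simp only [h, iff_true]
      obtain _ | q := q
      · simp at h
      · have h1 := tokensText_eq (List.getElem?_eq_getElem (Nat.lt_of_succ_le hq))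
        have h2 : tokensText (E.take (q + 1)) =
            tokensText (E.take q) ++ (intText E[q].1 ++ [sepSymbol E[q].2]) := by
          rw [List.take_succ_eq_append_getElem (Nat.lt_of_succ_le hq), tokensText_append]
          simp [tokenText]
        rw [h2] at h
        simp only [List.length_append, List.length_cons, List.length_nil] at h
        refine Nat.succ_le_succ ((sepCount_mono _ (b := (tokensText (E.take q)).length +
          (intText E[q].1).length) (by omega)).trans ?_)
        rw [sepCount, h1, ← List.append_assoc, List.take_append_of_le_length (by simp),
          List.take_of_length_le (by simp), List.countP_append, countP_isSep_intText,
          countP_isSep_tokensText]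
        simp
    · simp only [h.not_gt, iff_false, not_le]
      refine Nat.lt_succ_of_le (le_trans ?_ (sepCount_mono _ h))
      rw [sepCount, hE, List.take_append_of_le_length le_rfl, List.take_length,
        countP_isSep_tokensText, List.length_take, min_eq_left hq]

/-- The integer with index `q` is negative. -/
def IsNegToken (z : List TextSymbol) (q : ℕ) : Prop := z[tokenStart z q]? = some .minus

/-- The integer with index `q` is the last one in its line. -/
def IsLastToken (z : List TextSymbol) (q : ℕ) : Prop :=
  z[tokenStart z (q + 1) - 1]? = some .newline

/-- The value of a digit. -/
def digitVal : Option TextSymbol → ℕ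
  | some (.digit d) => d
  | _ => 0

theorem digitVal_le (o : Option TextSymbol) : digitVal o ≤ 9 := by
  rcases o with _ | (d | _ | _ | _ | _) <;> simp [digitVal]
  omega

/-- The coefficient of `10 ^ l` in the decimal expansion of the integer with index `q`. -/
def tokenDigit (z : List TextSymbol) (q l : ℕ) : ℕ :=
  -- The integer occupies a sign, its digits and a separator. Hence the units digit lies two places
  -- before the next start, and the digit for `10 ^ l` exists when `l + 3` places are available.
  if tokenStart z q + (l + 3) ≤ tokenStart z (q + 1) then
    digitVal z[tokenStart z (q + 1) - (l + 2)]? else 0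

section Token

variable {E : List (ℤ × Bool)} {q : ℕ} {a : ℤ × Bool}

theorem tokenStart_of_getElem? (h : E[q]? = some a) :
    tokenStart (tokensText E) q = (tokensText (E.take q)).length := by
  obtain ⟨hq, -⟩ := List.getElem?_eq_some_iff.1 h
  exact tokenStart_tokensText hq.le

theorem tokenStart_succ_of_getElem? (h : E[q]? = some a) :
    tokenStart (tokensText E) (q + 1) =
      (tokensText (E.take q)).length + ((natText a.1.natAbs).length + 2) := by
  obtain ⟨hq, rfl⟩ := List.getElem?_eq_some_iff.1 h
  rw [tokenStart_tokensText hq, List.take_succ_eq_append_getElem hq, tokensText_append]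
  simp [tokenText, intText]

theorem isNegToken_iff (h : E[q]? = some a) : IsNegToken (tokensText E) q ↔ a.1 < 0 := by
  rw [IsNegToken, tokenStart_of_getElem? h]
  conv_lhs => rw [tokensText_eq h]
  rw [List.getElem?_append_right le_rfl, Nat.sub_self]
  simp [intText]

theorem isLastToken_iff (h : E[q]? = some a) : IsLastToken (tokensText E) q ↔ a.2 = true := by
  rw [IsLastToken, tokenStart_succ_of_getElem? h]
  conv_lhs => rw [tokensText_eq h]
  rw [List.getElem?_append_right (by omega), List.getElem?_append_right (by simp [intText])]
  rw [intText, List.length_cons, show (tokensText (List.take q E)).length +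
    ((natText a.1.natAbs).length + 2) - 1 - (tokensText (List.take q E)).length -
    ((natText a.1.natAbs).length + 1) = 0 by omega]
  obtain ⟨x, b⟩ := a
  cases b <;> simp [sepSymbol]

theorem tokenDigit_eq (h : E[q]? = some a) (l : ℕ) :
    tokenDigit (tokensText E) q l = a.1.natAbs / 10 ^ l % 10 := by
  rw [tokenDigit, tokenStart_of_getElem? h, tokenStart_succ_of_getElem? h]
  rcases lt_or_ge l (natText a.1.natAbs).length with hl | hl
  · rw [if_pos (by omega)]
    conv_lhs => rw [tokensText_eq h]
    rw [List.getElem?_append_right (by omega), List.getElem?_append_left (by simp [intText]; omega),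
      intText, show (tokensText (List.take q E)).length + ((natText a.1.natAbs).length + 2) -
      (l + 2) - (tokensText (List.take q E)).length = ((natText a.1.natAbs).length - 1 - l) + 1 by
      omega, List.getElem?_cons_succ, natText_getElem? hl]
    simp [digitVal]
  · rw [if_neg (by omega), Nat.div_eq_of_lt]
    exact (lt_pow_length_natText _).trans_le (Nat.pow_le_pow_right (by norm_num) hl)

/-- One common number of digits, the length of the whole text, suffices for all integers in it. -/
theorem natAbs_lt_pow_length (h : E[q]? = some a) : a.1.natAbs < 10 ^ (tokensText E).length := by
  refine (lt_pow_length_natText _).trans_le (Nat.pow_le_pow_right (by norm_num) ?_)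
  rw [tokensText_eq h]
  simp [intText]
  omega

end Token

/-! ### Signs of sums -/

/-- The ways in which an integer can enter a sum. -/
inductive SummandKind : Type
  | pos
  | neg
  | abs
  | negAbs
  | zero

/-- The summand given by an integer. -/
def SummandKind.value : SummandKind → ℤ → ℤ
  | pos, x => x
  | neg, x => -x
  | abs, x => |x|
  | negAbs, x => -|x|
  | zero, _ => 0

open Classical in
/-- The digits of a summand, with their signs, enlarged by `9`. -/
noncomputable def SummandKind.digit (z : List TextSymbol) (q l : ℕ) : SummandKind → ℕ
  | pos => if IsNegToken z q then 9 - tokenDigit z q l else 9 + tokenDigit z q l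
  | neg => if IsNegToken z q then 9 + tokenDigit z q l else 9 - tokenDigit z q l
  | abs => 9 + tokenDigit z q l
  | negAbs => 9 - tokenDigit z q l
  | zero => 9

/-- The carry in the addition of three numbers. -/
def carry (f : ℕ → ℕ) (L : ℕ) : ℕ := Nat.rec 3 (fun l c => (c + f l) / 10) L

/-- Successive division by ten with remainders dropped is a single division by `10 ^ L`. The `f l`
may exceed nine, so they are digits only in a generalized sense. -/
theorem carry_eq (f : ℕ → ℕ) (L : ℕ) :
    carry f L = (3 + ∑ l ∈ Finset.range L, f l * 10 ^ l) / 10 ^ L := by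
  induction L with
  | zero => simp [carry]
  | succ L ih =>
    have h1 : carry f (L + 1) = (carry f L + f L) / 10 := rfl
    rw [h1, ih, Finset.sum_range_succ, ← add_assoc, pow_succ, ← Nat.div_div_eq_div_mul,
      Nat.add_mul_div_right _ _ (by positivity)]

theorem sum_digits (x L : ℕ) : ∑ l ∈ Finset.range L, x / 10 ^ l % 10 * 10 ^ l = x % 10 ^ L := by
  induction L with
  | zero => simp [Nat.mod_one]
  | succ L ih => rw [Finset.sum_range_succ, ih, Nat.mod_pow_succ, mul_comm (10 ^ L)]

theorem sum_nines (L : ℕ) : ∑ l ∈ Finset.range L, (9 : ℤ) * 10 ^ l = 10 ^ L - 1 := by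
  induction L with
  | zero => simp
  | succ L ih =>
    rw [Finset.sum_range_succ, ih, pow_succ]
    ring

/-- Adding nine makes every signed digit a natural number; the total effect is to add the number
written with nines only, that is `10 ^ L - 1` for a text of length `L`. -/
theorem SummandKind.sum_digit {E : List (ℤ × Bool)} {q : ℕ} {a : ℤ × Bool} (h : E[q]? = some a)
    (s : SummandKind) : ∑ l ∈ Finset.range (tokensText E).length,
      (s.digit (tokensText E) q l : ℤ) * 10 ^ l =
        s.value a.1 + (10 ^ (tokensText E).length - 1) := by
  have h0 : ∑ l ∈ Finset.range (tokensText E).length,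
      (tokenDigit (tokensText E) q l : ℤ) * 10 ^ l = |a.1| := by
    have h1 := sum_digits a.1.natAbs (tokensText E).length
    rw [Nat.mod_eq_of_lt (natAbs_lt_pow_length h)] at h1
    rw [Int.abs_eq_natAbs, ← h1]
    push_cast
    refine Finset.sum_congr rfl fun l _ => ?_
    rw [tokenDigit_eq h]
    push_cast
    rfl
  have hd : ∀ l, tokenDigit (tokensText E) q l ≤ 9 := fun l => by
    rw [tokenDigit]
    split_ifs
    · exact digitVal_le _
    · omega
  have hp : ∑ l ∈ Finset.range (tokensText E).length,
      ((9 + tokenDigit (tokensText E) q l : ℕ) : ℤ) * 10 ^ l =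
        |a.1| + (10 ^ (tokensText E).length - 1) := by
    rw [← h0, ← sum_nines, ← Finset.sum_add_distrib]
    refine Finset.sum_congr rfl fun l _ => ?_
    push_cast
    ring
  have hm : ∑ l ∈ Finset.range (tokensText E).length,
      ((9 - tokenDigit (tokensText E) q l : ℕ) : ℤ) * 10 ^ l =
        -|a.1| + (10 ^ (tokensText E).length - 1) := by
    rw [← h0, ← sum_nines, ← Finset.sum_neg_distrib, ← Finset.sum_add_distrib]
    refine Finset.sum_congr rfl fun l _ => ?_
    rw [Nat.cast_sub (hd l)]
    push_cast
    ring
  cases s with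
  | pos =>
    simp only [digit, value, isNegToken_iff h]
    split_ifs with hneg
    · rw [hm, abs_of_neg hneg, neg_neg]
    · rw [hp, abs_of_nonneg (not_lt.1 hneg)]
  | neg =>
    simp only [digit, value, isNegToken_iff h]
    split_ifs with hneg
    · rw [hp, abs_of_neg hneg]
    · rw [hm, abs_of_nonneg (not_lt.1 hneg)]
  | abs => exact hp
  | negAbs => exact hm
  | zero =>
    simp only [digit, value, zero_add, ← sum_nines]
    rfl

/-- The sum of three summands is nonnegative. -/
def NonnegSum (s₁ s₂ s₃ : SummandKind) (z : List TextSymbol) (q₁ q₂ q₃ : ℕ) : Prop :=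
  3 ≤ carry (fun l => s₁.digit z q₁ l + s₂.digit z q₂ l + s₃.digit z q₃ l) z.length

/-- If `S` is the sum and `L` the length, the digit sums represent `S + 3 * (10 ^ L - 1)`. The
initial carry `3` turns this into `S + 3 * 10 ^ L`, whose quotient by `10 ^ L` is at least `3`
exactly when `S ≥ 0`. -/
theorem nonnegSum_iff {E : List (ℤ × Bool)} {q₁ q₂ q₃ : ℕ} {a₁ a₂ a₃ : ℤ × Bool}
    (h₁ : E[q₁]? = some a₁) (h₂ : E[q₂]? = some a₂) (h₃ : E[q₃]? = some a₃)
    (s₁ s₂ s₃ : SummandKind) : NonnegSum s₁ s₂ s₃ (tokensText E) q₁ q₂ q₃ ↔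
      0 ≤ s₁.value a₁.1 + s₂.value a₂.1 + s₃.value a₃.1 := by
  rw [NonnegSum, carry_eq, Nat.le_div_iff_mul_le (by positivity), ← Nat.cast_le (α := ℤ)]
  push_cast
  simp only [add_mul, Finset.sum_add_distrib, SummandKind.sum_digit h₁, SummandKind.sum_digit h₂,
    SummandKind.sum_digit h₃]
  constructor <;> intro h <;> linarith

/-! ### Definability of the certificate relation -/

open NumCtx RegProg

/-- The text of a word over two copies of the alphabet. -/
def mergedText (u : List (TextSymbol ⊕ TextSymbol)) : List TextSymbol := u.map (Sum.elim id id)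

section Definability

variable {α : Type} [NumCtx (TextSymbol ⊕ TextSymbol) α] {f g h : α → ℕ}

/-- The text of the word of `a`. -/
def ctxText (a : α) : List TextSymbol := mergedText (word a)

theorem length_ctxText (a : α) : (ctxText a).length = (word a).length := List.length_map _

/-- The padding leaves room above the text length for all the small constants, so side conditions
about the cap hold even for the empty word. -/
theorem length_ctxText_lt (a : α) : (ctxText a).length + 200 < cap a := by
  rw [length_ctxText, cap_eq, padLength]
  omega

theorem ctxText_getElem? (a : α) (p : ℕ) :
    (ctxText a)[p]? = (word a)[p]?.map (Sum.elim id id) := List.getElem?_map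

theorem definable_length : Definable fun a : α => (ctxText a).length :=
  Definable.length_word.congr fun a _ => (length_ctxText a).symm

theorem definablePred_read (p : Option TextSymbol → Prop) (hf : Definable f) :
    DefinablePred fun a => p (ctxText a)[f a]? :=
  (DefinablePred.read (fun o => p (o.map (Sum.elim id id))) hf).congr fun a _ => by
    rw [ctxText_getElem?]

theorem definable_read (F : Option TextSymbol → ℕ) (hf : Definable f) :
    Definable fun a => F (ctxText a)[f a]? :=
  (Definable.read (fun o => F (o.map (Sum.elim id id))) hf).congr fun a _ => by
    rw [ctxText_getElem?]

open Classical in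
theorem sepCount_eq_count (z : List TextSymbol) (p : ℕ) :
    sepCount z p = Nat.count (fun i => ∃ c, z[i]? = some c ∧ isSep c = true) p := by
  induction p with
  | zero => simp [sepCount]
  | succ p ih =>
    rw [Nat.count_succ, ← ih, sepCount, sepCount, List.take_add_one, List.countP_append]
    congr 1
    rcases z[p]? with _ | c
    · simp
    · simp [List.countP_cons]

theorem definable_sepCount (hf : Definable f) : Definable fun a => sepCount (ctxText a) (f a) := by
  classical
  have h1 : DefinablePred fun b : α × ℕ => ∃ c, (ctxText b.1)[b.2]? = some c ∧ isSep c = true :=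
    definablePred_read (α := α × ℕ) (fun o => ∃ c, o = some c ∧ isSep c = true) Definable.var
  refine (Definable.count h1 hf.min_cap fun a _ => min_le_right _ _).congr fun a _ => ?_
  change Nat.count (fun i => ∃ c, (ctxText a)[i]? = some c ∧ isSep c = true) _ = _
  rw [← sepCount_eq_count]
  rcases le_total (f a) (cap a) with h2 | h2
  · rw [min_eq_left h2]
  · have := length_ctxText_lt a
    rw [min_eq_right h2, sepCount, sepCount, List.take_of_length_le (by omega),
      List.take_of_length_le (by omega)]

theorem sepCount_lt_cap (a : α) (p : ℕ) : sepCount (ctxText a) p + 200 < cap a := by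
  have := length_ctxText_lt a
  have := sepCount_le (ctxText a) p
  omega

theorem definable_tokenStart (hf : Definable f) :
    Definable fun a => tokenStart (ctxText a) (f a) := by
  have h1 : DefinablePred fun b : α × ℕ => sepCount (ctxText b.1) b.2 + 1 ≤ f b.1 :=
    DefinablePred.le (definable_sepCount (α := α × ℕ) Definable.var).succ hf.lift fun b _ => by
      have := sepCount_lt_cap b.1 b.2
      change _ ≤ cap b.1
      omega
  exact Definable.count h1 definable_length fun a _ => by
    have := length_ctxText_lt a
    omega

theorem tokenStart_lt_cap (a : α) (q : ℕ) : tokenStart (ctxText a) q + 200 < cap a := by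
  have := length_ctxText_lt a
  have : tokenStart (ctxText a) q ≤ (ctxText a).length := Nat.count_le _
  omega

theorem definablePred_isNegToken (hf : Definable f) :
    DefinablePred fun a => IsNegToken (ctxText a) (f a) :=
  definablePred_read (fun o => o = some .minus) (definable_tokenStart hf)

theorem definablePred_isLastToken (hf : Definable f) :
    DefinablePred fun a => IsLastToken (ctxText a) (f a) :=
  definablePred_read (fun o => o = some .newline)
    ((definable_tokenStart hf.succ).pred fun a _ => by
      have := tokenStart_lt_cap a (f a + 1)
      omega)

theorem definable_tokenDigit (hf : Definable f) (hg : Definable g) :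
    Definable fun a => tokenDigit (ctxText a) (f a) (g a) := by
  -- The comparison is negated so that its left side is bounded; `g a` may be arbitrarily large.
  have h1 : DefinablePred fun a =>
      ¬ tokenStart (ctxText a) (f a + 1) + 1 ≤ tokenStart (ctxText a) (f a) + (g a + 3) :=
    (DefinablePred.le (definable_tokenStart hf.succ).succ
      ((definable_tokenStart hf).add (hg.add (Definable.const 3))) fun a _ => by
        have := tokenStart_lt_cap a (f a + 1)
        omega).not
  have h2 := definable_read digitVal (((definable_tokenStart hf.succ)).sub
    (hg.add (Definable.const 2)) fun a _ => by
      have := tokenStart_lt_cap a (f a + 1)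
      omega)
  have h3 := Definable.ite (h1.congr (Q := fun a => tokenStart (ctxText a) (f a) + (g a + 3) ≤
    tokenStart (ctxText a) (f a + 1)) fun a _ => by omega) h2 (Definable.const 0)
  exact h3

theorem tokenDigit_le (z : List TextSymbol) (q l : ℕ) : tokenDigit z q l ≤ 9 := by
  rw [tokenDigit]
  split_ifs
  · exact digitVal_le _
  · omega

theorem SummandKind.digit_le (s : SummandKind) (z : List TextSymbol) (q l : ℕ) :
    s.digit z q l ≤ 18 := by
  have := tokenDigit_le z q l
  cases s <;> simp only [SummandKind.digit] <;> (try split_ifs) <;> omega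

theorem SummandKind.definable_digit (s : SummandKind) (hf : Definable f) (hg : Definable g) :
    Definable fun a => s.digit (ctxText a) (f a) (g a) := by
  classical
  have hd := definable_tokenDigit hf hg
  have hp : Definable fun a => 9 + tokenDigit (ctxText a) (f a) (g a) := (Definable.const 9).add hd
  have hm : Definable fun a => 9 - tokenDigit (ctxText a) (f a) (g a) :=
    (Definable.const 9).sub hd fun a _ => by
      have := length_ctxText_lt a
      omega
  cases s with
  | pos => exact Definable.ite (definablePred_isNegToken hf) hm hp
  | neg => exact Definable.ite (definablePred_isNegToken hf) hp hm
  | abs => exact hp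
  | negAbs => exact hm
  | zero => exact Definable.const 9

/-- Three enlarged digits add up to at most `3 * 18 = 54`, and `(5 + 54) / 10 = 5`. The addition
thus needs only a finite table. -/
theorem carry_le {f : ℕ → ℕ} (hf : ∀ l, f l ≤ 54) (L : ℕ) : carry f L ≤ 5 := by
  induction L with
  | zero => simp [carry]
  | succ L ih =>
    have h1 : carry f (L + 1) = (carry f L + f L) / 10 := rfl
    have := hf L
    omega

theorem definable_carry {F : α × ℕ → ℕ} (hF : Definable F) (h : ∀ b, F b ≤ 54) :
    Definable fun a => carry (fun l => F (a, l)) (ctxText a).length := by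
  -- The minimum with `5` bounds the table argument by `59` for every possible value; on actual
  -- carries it has no effect.
  have hs : Definable fun b : (α × ℕ) × ℕ => (min 5 b.2 + F b.1) / 10 :=
    Definable.table (· / 10) ((Definable.min (Definable.const 5) Definable.var fun b _ =>
      le_trans (by simp [padLength]) (padLength_le_cap b)).add hF.lift) 59 (by simp [padLength])
      fun b _ => by
        have := h b.1
        omega
  have key : ∀ a k, (Nat.rec 3 (fun i x => (min 5 x + F (a, i)) / 10) k : ℕ) =
      carry (fun l => F (a, l)) k := fun a k => by
    induction k with
    | zero => rfl
    | succ k ih =>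
      have h1 : carry (fun l => F (a, l)) (k + 1) = (carry (fun l => F (a, l)) k + F (a, k)) / 10 :=
        rfl
      simp only [ih]
      rw [h1, min_eq_right (carry_le (fun l => h _) _)]
  refine (Definable.iter_of_le (F := fun b => (min 5 b.2 + F b.1) / 10) definable_length
    (Definable.const 3) hs (fun a _ => ?_) fun a _ k _ => ?_).congr fun a _ => key a _
  · have := length_ctxText_lt a
    omega
  · simp only
    rw [key]
    have := carry_le (f := fun l => F (a, l)) (fun l => h _) k
    have := length_ctxText_lt a
    omega

theorem definablePred_nonnegSum (s₁ s₂ s₃ : SummandKind) (hf : Definable f) (hg : Definable g)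
    (hh : Definable h) : DefinablePred fun a => NonnegSum s₁ s₂ s₃ (ctxText a) (f a) (g a) (h a) := by
  have h1 : Definable fun b : α × ℕ => s₁.digit (ctxText b.1) (f b.1) b.2 +
      s₂.digit (ctxText b.1) (g b.1) b.2 + s₃.digit (ctxText b.1) (h b.1) b.2 :=
    ((s₁.definable_digit (α := α × ℕ) hf.lift Definable.var).add
      (s₂.definable_digit (α := α × ℕ) hg.lift Definable.var)).add
      (s₃.definable_digit (α := α × ℕ) hh.lift Definable.var)
  exact DefinablePred.le (Definable.const 3) (definable_carry h1 fun b => by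
    have := s₁.digit_le (ctxText b.1) (f b.1) b.2
    have := s₂.digit_le (ctxText b.1) (g b.1) b.2
    have := s₃.digit_le (ctxText b.1) (h b.1) b.2
    omega) fun a _ => by
      have := length_ctxText_lt a
      omega

theorem foldl_eq_rec {β γ : Type} (F : β → γ → β) (s : β) (l : List γ) :
    l.foldl F s = Nat.rec s (fun i x => (l[i]?).elim x (F x)) l.length := by
  suffices h : ∀ k ≤ l.length, (Nat.rec s (fun i x => (l[i]?).elim x (F x)) k : β) =
      (l.take k).foldl F s by
    rw [h _ le_rfl, List.take_length]
  intro k hk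
  induction k with
  | zero => rfl
  | succ k ih =>
    simp only
    rw [ih (by omega), List.take_succ_eq_append_getElem hk, List.foldl_append,
      List.getElem?_eq_getElem hk]
    rfl

/-- States are at most `5` and the alphabet is finite, so a transition is a finite sum of tables,
and the run is a recursion with bounded values. -/
theorem definable_scan : Definable fun a : α => (ctxText a).foldl scanStep 0 := by
  classical
  let H : Option TextSymbol → ℕ → ℕ := fun o x => o.elim x (scanStep x)
  have hH : ∀ o x, x ≤ 5 → H o x ≤ 5 := fun o x hx => by
    rcases o with _ | c
    · exact hx
    · exact scanStep_le _ _
  have hs : Definable fun b : (α × ℕ) × ℕ => H (ctxText b.1.1)[b.1.2]? (min 5 b.2) := by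
    refine (Definable.finset_sum Finset.univ fun o : Option TextSymbol =>
      (definablePred_read (α := (α × ℕ) × ℕ) (fun o' => o' = o)
        (Definable.var.lift (f := fun b : α × ℕ => b.2))).indicator.mul
      (Definable.table (H o) (Definable.min (Definable.const 5) Definable.var fun b _ =>
        le_trans (by simp [padLength]) (padLength_le_cap b)) 5 (by simp [padLength])
        fun b _ => min_le_left _ _)).congr fun b _ => ?_
    simp
    rfl
  have key : ∀ (a : α) k, (Nat.rec 0 (fun i x => H (ctxText a)[i]? (min 5 x)) k : ℕ) =
      Nat.rec 0 (fun i x => H (ctxText a)[i]? x) k ∧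
      (Nat.rec 0 (fun i x => H (ctxText a)[i]? x) k : ℕ) ≤ 5 := fun a k => by
    induction k with
    | zero => exact ⟨rfl, Nat.zero_le _⟩
    | succ k ih =>
      simp only
      rw [ih.1, min_eq_right ih.2]
      exact ⟨rfl, hH _ _ ih.2⟩
  refine (Definable.iter_of_le (F := fun b => H (ctxText b.1.1)[b.1.2]? (min 5 b.2))
    definable_length (Definable.const 0) hs (fun a _ => ?_) fun a _ k _ => ?_).congr fun a _ => ?_
  · have := length_ctxText_lt a
    omega
  · simp only
    rw [(key a k).1]
    have := (key a k).2
    have := length_ctxText_lt a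
    omega
  · simp only
    rw [(key a _).1, foldl_eq_rec]

/-- The first integer of a text, cut off at the length of the text. -/
def headValue (z : List TextSymbol) : ℕ :=
  Nat.rec 0 (fun p x => min z.length (10 * x + tokenDigit z 0 (z.length - (p + 1)))) z.length

/-- Horner's scheme from the highest possible digit: after `k` steps the value is the quotient by
`10 ^ (L - k)`, truncated at `L`. Truncation commutes with a step, since a prefix that has reached
`L` stays at least `L`. -/
theorem headValue_eq {E : List (ℤ × Bool)} {a : ℤ × Bool} (h : E[0]? = some a) :
    headValue (tokensText E) = min (tokensText E).length a.1.natAbs := by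
  set L := (tokensText E).length with hL
  suffices h' : ∀ k ≤ L, (Nat.rec 0 (fun p x => min L (10 * x +
      tokenDigit (tokensText E) 0 (L - (p + 1)))) k : ℕ) =
      min L (a.1.natAbs / 10 ^ (L - k)) by
    rw [headValue, ← hL, h' L le_rfl]
    simp
  intro k hk
  induction k with
  | zero => simp [Nat.div_eq_of_lt (natAbs_lt_pow_length h), hL]
  | succ k ih =>
    simp only
    rw [ih (by omega), tokenDigit_eq h, show L - k = L - (k + 1) + 1 by omega, pow_succ,
      ← Nat.div_div_eq_div_mul]
    omega

theorem headValue_le (z : List TextSymbol) : headValue z ≤ z.length := by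
  rw [headValue]
  rcases z.length with _ | n
  · exact le_rfl
  · exact min_le_left _ _

theorem definable_headValue : Definable fun a : α => headValue (ctxText a) := by
  have hs : Definable fun b : (α × ℕ) × ℕ => min (ctxText b.1.1).length
      (10 * b.2 + tokenDigit (ctxText b.1.1) 0 ((ctxText b.1.1).length - (b.1.2 + 1))) := by
    have hl : Definable fun b : (α × ℕ) × ℕ => (ctxText b.1.1).length :=
      definable_length.lift.lift
    have hle : ∀ b : (α × ℕ) × ℕ, Valid b → (ctxText b.1.1).length ≤ cap b := fun b _ => by
      have := length_ctxText_lt b.1.1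
      change _ ≤ cap b.1.1
      omega
    exact Definable.min hl (((Definable.const 10).mul Definable.var).add
      (definable_tokenDigit (α := (α × ℕ) × ℕ) (Definable.const 0)
        (hl.sub (Definable.var.lift (f := fun b : α × ℕ => b.2)).succ hle))) hle
  refine Definable.iter_of_le (F := fun b : (α × ℕ) × ℕ => min (ctxText b.1.1).length
      (10 * b.2 + tokenDigit (ctxText b.1.1) 0 ((ctxText b.1.1).length - (b.1.2 + 1))))
      definable_length (Definable.const 0) hs (fun a _ => ?_) fun a _ k _ => ?_
  · have := length_ctxText_lt a
    omega
  · have h1 := length_ctxText_lt a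
    rcases k with _ | k
    · exact Nat.zero_le _
    · exact (min_le_left _ _).trans (show (ctxText a).length ≤ cap a by omega)

end Definability

/-! ### The certificate relation in terms of positions -/

/-- The integers from index `o` on form a matrix with `m` rows and `n` columns. -/
def IsBlock (z : List TextSymbol) (o m n : ℕ) : Prop :=
  ∀ i < m, ∀ j < n, (IsLastToken z (o + (i * n + j)) ↔ n ≤ j + 1)

/-- The absolute values in a matrix are at most the sum of the absolute values of two integers. -/
def IsBoundedBlock (z : List TextSymbol) (g l o m n : ℕ) : Prop :=
  ∀ i < m, ∀ j < n, NonnegSum .abs .abs .negAbs z g l (o + (i * n + j))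

/-- The integers with the indices `g` and `l` are upper and lower bounds of a matrix. -/
def AreBounds (z : List TextSymbol) (g l o m n : ℕ) : Prop :=
  ∀ i < m, ∀ j < n, NonnegSum .pos .neg .zero z g (o + (i * n + j)) 0 ∧
    NonnegSum .pos .neg .zero z (o + (i * n + j)) l 0

/-- The matrices which start at the indices `b` and `c` have the tropical product which starts
at the index `o`. -/
def IsProductBlock (z : List TextSymbol) (o b c m n r : ℕ) : Prop :=
  ∀ i < m, ∀ j < n,
    (∀ t < r, NonnegSum .pos .pos .neg z (b + (i * r + t)) (c + (t * n + j)) (o + (i * n + j))) ∧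
    ∃ t < r, NonnegSum .pos .neg .neg z (o + (i * n + j)) (b + (i * r + t)) (c + (t * n + j))

/-- A text consists of a positive number, a matrix, and a bounded factorization of it. -/
def IsFactorizationText (z : List TextSymbol) (s m n r : ℕ) : Prop :=
  (1 ≤ m ∧ 1 ≤ n ∧ 1 ≤ r ∧ ¬IsNegToken z 0 ∧ IsLastToken z 0 ∧ 1 + m * n = s ∧
    1 + m * n + m * r + r * n = sepCount z z.length) ∧
  (IsBlock z 1 m n ∧ IsBlock z (1 + m * n) m r ∧ IsBlock z (1 + m * n + m * r) r n) ∧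
  (∃ i < m, ∃ j < n, ∃ i' < m, ∃ j' < n,
    AreBounds z (1 + (i * n + j)) (1 + (i' * n + j')) 1 m n ∧
    IsBoundedBlock z (1 + (i * n + j)) (1 + (i' * n + j')) (1 + m * n) m r ∧
    IsBoundedBlock z (1 + (i * n + j)) (1 + (i' * n + j')) (1 + m * n + m * r) r n) ∧
  IsProductBlock z 1 (1 + m * n) (1 + m * n + m * r) m n r

section Definability

variable {α : Type} [NumCtx (TextSymbol ⊕ TextSymbol) α] {f g h o m n r b c l s : α → ℕ}

/-- Each bounded quantifier adds a coordinate to the context. Only the quantifier ranges need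
bounds; the index expressions are sums and products, which may saturate. -/
theorem definablePred_isBlock (ho : Definable o) (hm : Definable m) (hn : Definable n)
    (hm' : ∀ a, Valid a → m a ≤ cap a) (hn' : ∀ a, Valid a → n a ≤ cap a) :
    DefinablePred fun a => IsBlock (ctxText a) (o a) (m a) (n a) := by
  have hi : Definable fun b : (α × ℕ) × ℕ => b.1.2 := Definable.var.lift (f := fun b : α × ℕ => b.2)
  have hj : Definable fun b : (α × ℕ) × ℕ => b.2 := Definable.var
  refine DefinablePred.forall_lt (P := fun b : α × ℕ => ∀ j < n b.1,
    (IsLastToken (ctxText b.1) (o b.1 + (b.2 * n b.1 + j)) ↔ n b.1 ≤ j + 1)) ?_ hm hm'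
  refine DefinablePred.forall_lt (P := fun b : (α × ℕ) × ℕ =>
    (IsLastToken (ctxText b.1.1) (o b.1.1 + (b.1.2 * n b.1.1 + b.2)) ↔ n b.1.1 ≤ b.2 + 1))
    ?_ hn.lift fun b hb => hn' _ hb.fst
  exact (definablePred_isLastToken (α := (α × ℕ) × ℕ)
    (ho.lift.lift.add ((hi.mul hn.lift.lift).add hj))).iff
    (DefinablePred.le hn.lift.lift hj.succ fun b hb => hn' _ hb.fst.fst)

theorem definablePred_isBoundedBlock (hg : Definable g) (hl : Definable l) (ho : Definable o)
    (hm : Definable m) (hn : Definable n)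
    (hm' : ∀ a, Valid a → m a ≤ cap a) (hn' : ∀ a, Valid a → n a ≤ cap a) :
    DefinablePred fun a => IsBoundedBlock (ctxText a) (g a) (l a) (o a) (m a) (n a) := by
  have hi : Definable fun b : (α × ℕ) × ℕ => b.1.2 := Definable.var.lift (f := fun b : α × ℕ => b.2)
  have hj : Definable fun b : (α × ℕ) × ℕ => b.2 := Definable.var
  refine DefinablePred.forall_lt (P := fun b : α × ℕ => ∀ j < n b.1, NonnegSum .abs .abs .negAbs
    (ctxText b.1) (g b.1) (l b.1) (o b.1 + (b.2 * n b.1 + j))) ?_ hm hm'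
  refine DefinablePred.forall_lt (P := fun b : (α × ℕ) × ℕ => NonnegSum .abs .abs .negAbs
    (ctxText b.1.1) (g b.1.1) (l b.1.1) (o b.1.1 + (b.1.2 * n b.1.1 + b.2)))
    ?_ hn.lift fun b hb => hn' _ hb.fst
  exact definablePred_nonnegSum (α := (α × ℕ) × ℕ) _ _ _ hg.lift.lift hl.lift.lift
    (ho.lift.lift.add ((hi.mul hn.lift.lift).add hj))

theorem definablePred_areBounds (hg : Definable g) (hl : Definable l) (ho : Definable o)
    (hm : Definable m) (hn : Definable n)
    (hm' : ∀ a, Valid a → m a ≤ cap a) (hn' : ∀ a, Valid a → n a ≤ cap a) :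
    DefinablePred fun a => AreBounds (ctxText a) (g a) (l a) (o a) (m a) (n a) := by
  have hi : Definable fun b : (α × ℕ) × ℕ => b.1.2 := Definable.var.lift (f := fun b : α × ℕ => b.2)
  have hj : Definable fun b : (α × ℕ) × ℕ => b.2 := Definable.var
  refine DefinablePred.forall_lt (P := fun b : α × ℕ => ∀ j < n b.1,
    NonnegSum .pos .neg .zero (ctxText b.1) (g b.1) (o b.1 + (b.2 * n b.1 + j)) 0 ∧
    NonnegSum .pos .neg .zero (ctxText b.1) (o b.1 + (b.2 * n b.1 + j)) (l b.1) 0) ?_ hm hm'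
  refine DefinablePred.forall_lt (P := fun b : (α × ℕ) × ℕ =>
    NonnegSum .pos .neg .zero (ctxText b.1.1) (g b.1.1) (o b.1.1 + (b.1.2 * n b.1.1 + b.2)) 0 ∧
    NonnegSum .pos .neg .zero (ctxText b.1.1) (o b.1.1 + (b.1.2 * n b.1.1 + b.2)) (l b.1.1) 0)
    ?_ hn.lift fun b hb => hn' _ hb.fst
  exact (definablePred_nonnegSum (α := (α × ℕ) × ℕ) _ _ _ hg.lift.lift
      (ho.lift.lift.add ((hi.mul hn.lift.lift).add hj)) (Definable.const 0)).and
    (definablePred_nonnegSum (α := (α × ℕ) × ℕ) _ _ _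
      (ho.lift.lift.add ((hi.mul hn.lift.lift).add hj)) hl.lift.lift (Definable.const 0))

theorem definablePred_isProductBlock (ho : Definable o) (hb : Definable b) (hc : Definable c)
    (hm : Definable m) (hn : Definable n) (hr : Definable r) (hm' : ∀ a, Valid a → m a ≤ cap a)
    (hn' : ∀ a, Valid a → n a ≤ cap a) (hr' : ∀ a, Valid a → r a ≤ cap a) :
    DefinablePred fun a => IsProductBlock (ctxText a) (o a) (b a) (c a) (m a) (n a) (r a) := by
  have hi : Definable fun d : ((α × ℕ) × ℕ) × ℕ => d.1.1.2 :=
    (Definable.var.lift (f := fun b : α × ℕ => b.2)).lift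
  have hj : Definable fun d : ((α × ℕ) × ℕ) × ℕ => d.1.2 :=
    Definable.var.lift (f := fun b : (α × ℕ) × ℕ => b.2)
  have ht : Definable fun d : ((α × ℕ) × ℕ) × ℕ => d.2 := Definable.var
  have hA := ho.lift.lift.lift.add ((hi.mul hn.lift.lift.lift).add hj)
  have hB := hb.lift.lift.lift.add ((hi.mul hr.lift.lift.lift).add ht)
  have hC := hc.lift.lift.lift.add ((ht.mul hn.lift.lift.lift).add hj)
  refine DefinablePred.forall_lt (P := fun d : α × ℕ => ∀ j < n d.1,
    (∀ t < r d.1, NonnegSum .pos .pos .neg (ctxText d.1) (b d.1 + (d.2 * r d.1 + t))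
      (c d.1 + (t * n d.1 + j)) (o d.1 + (d.2 * n d.1 + j))) ∧
    ∃ t < r d.1, NonnegSum .pos .neg .neg (ctxText d.1) (o d.1 + (d.2 * n d.1 + j))
      (b d.1 + (d.2 * r d.1 + t)) (c d.1 + (t * n d.1 + j))) ?_ hm hm'
  refine DefinablePred.forall_lt (P := fun d : (α × ℕ) × ℕ =>
    (∀ t < r d.1.1, NonnegSum .pos .pos .neg (ctxText d.1.1) (b d.1.1 + (d.1.2 * r d.1.1 + t))
      (c d.1.1 + (t * n d.1.1 + d.2)) (o d.1.1 + (d.1.2 * n d.1.1 + d.2))) ∧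
    ∃ t < r d.1.1, NonnegSum .pos .neg .neg (ctxText d.1.1) (o d.1.1 + (d.1.2 * n d.1.1 + d.2))
      (b d.1.1 + (d.1.2 * r d.1.1 + t)) (c d.1.1 + (t * n d.1.1 + d.2))) ?_ hn.lift
      fun d hd => hn' _ hd.fst
  refine DefinablePred.and ?_ ?_
  · refine DefinablePred.forall_lt (P := fun d : ((α × ℕ) × ℕ) × ℕ => NonnegSum .pos .pos .neg
      (ctxText d.1.1.1) (b d.1.1.1 + (d.1.1.2 * r d.1.1.1 + d.2))
      (c d.1.1.1 + (d.2 * n d.1.1.1 + d.1.2)) (o d.1.1.1 + (d.1.1.2 * n d.1.1.1 + d.1.2)))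
      ?_ hr.lift.lift fun d hd => hr' _ hd.fst.fst
    exact definablePred_nonnegSum (α := ((α × ℕ) × ℕ) × ℕ) _ _ _ hB hC hA
  · refine DefinablePred.exists_lt (P := fun d : ((α × ℕ) × ℕ) × ℕ => NonnegSum .pos .neg .neg
      (ctxText d.1.1.1) (o d.1.1.1 + (d.1.1.2 * n d.1.1.1 + d.1.2))
      (b d.1.1.1 + (d.1.1.2 * r d.1.1.1 + d.2)) (c d.1.1.1 + (d.2 * n d.1.1.1 + d.1.2)))
      ?_ hr.lift.lift fun d hd => hr' _ hd.fst.fst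
    exact definablePred_nonnegSum (α := ((α × ℕ) × ℕ) × ℕ) _ _ _ hA hB hC

theorem definablePred_isFactorizationText (hs : Definable s) (hm : Definable m) (hn : Definable n)
    (hr : Definable r) (hs' : ∀ a, Valid a → s a < cap a) (hm' : ∀ a, Valid a → m a ≤ cap a)
    (hn' : ∀ a, Valid a → n a ≤ cap a) (hr' : ∀ a, Valid a → r a ≤ cap a) :
    DefinablePred fun a => IsFactorizationText (ctxText a) (s a) (m a) (n a) (r a) := by
  have hone : ∀ a : α, 1 ≤ cap a := one_le_cap
  have hb : Definable fun a => 1 + m a * n a := (Definable.const 1).add (hm.mul hn)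
  have hc : Definable fun a => 1 + m a * n a + m a * r a := hb.add (hm.mul hr)
  have h1 : DefinablePred fun a => 1 ≤ m a := .le (.const 1) hm fun a _ => hone a
  have h2 : DefinablePred fun a => 1 ≤ n a := .le (.const 1) hn fun a _ => hone a
  have h3 : DefinablePred fun a => 1 ≤ r a := .le (.const 1) hr fun a _ => hone a
  have h4 := (definablePred_isNegToken (α := α) (Definable.const 0)).not
  have h5 := definablePred_isLastToken (α := α) (Definable.const 0)
  -- The product may exceed the cap; equality is still decided correctly because the other side is
  -- strictly below it.
  have h6 : DefinablePred fun a => 1 + m a * n a = s a := .eq hb hs hs'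
  have h7 : DefinablePred fun a => 1 + m a * n a + m a * r a + r a * n a =
      sepCount (ctxText a) (ctxText a).length :=
    .eq (hc.add (hr.mul hn)) (definable_sepCount definable_length) fun a _ => by
      have := sepCount_lt_cap a (ctxText a).length
      omega
  refine (h1.and (h2.and (h3.and (h4.and (h5.and (h6.and h7)))))).and
    (((definablePred_isBlock (.const 1) hm hn hm' hn').and
      ((definablePred_isBlock hb hm hr hm' hr').and (definablePred_isBlock hc hr hn hr' hn'))).and
      (DefinablePred.and ?_
        (definablePred_isProductBlock (.const 1) hb hc hm hn hr hm' hn' hr')))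
  refine DefinablePred.exists_lt (P := fun d : α × ℕ => ∃ j < n d.1, ∃ i' < m d.1, ∃ j' < n d.1,
    AreBounds (ctxText d.1) (1 + (d.2 * n d.1 + j)) (1 + (i' * n d.1 + j')) 1 (m d.1) (n d.1) ∧
    IsBoundedBlock (ctxText d.1) (1 + (d.2 * n d.1 + j)) (1 + (i' * n d.1 + j'))
      (1 + m d.1 * n d.1) (m d.1) (r d.1) ∧
    IsBoundedBlock (ctxText d.1) (1 + (d.2 * n d.1 + j)) (1 + (i' * n d.1 + j'))
      (1 + m d.1 * n d.1 + m d.1 * r d.1) (r d.1) (n d.1)) ?_ hm hm'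
  refine DefinablePred.exists_lt (P := fun d : (α × ℕ) × ℕ => ∃ i' < m d.1.1, ∃ j' < n d.1.1,
    AreBounds (ctxText d.1.1) (1 + (d.1.2 * n d.1.1 + d.2)) (1 + (i' * n d.1.1 + j')) 1 (m d.1.1)
      (n d.1.1) ∧
    IsBoundedBlock (ctxText d.1.1) (1 + (d.1.2 * n d.1.1 + d.2)) (1 + (i' * n d.1.1 + j'))
      (1 + m d.1.1 * n d.1.1) (m d.1.1) (r d.1.1) ∧
    IsBoundedBlock (ctxText d.1.1) (1 + (d.1.2 * n d.1.1 + d.2)) (1 + (i' * n d.1.1 + j'))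
      (1 + m d.1.1 * n d.1.1 + m d.1.1 * r d.1.1) (r d.1.1) (n d.1.1)) ?_ hn.lift
      fun d hd => hn' _ hd.fst
  refine DefinablePred.exists_lt (P := fun d : ((α × ℕ) × ℕ) × ℕ => ∃ j' < n d.1.1.1,
    AreBounds (ctxText d.1.1.1) (1 + (d.1.1.2 * n d.1.1.1 + d.1.2)) (1 + (d.2 * n d.1.1.1 + j')) 1
      (m d.1.1.1) (n d.1.1.1) ∧
    IsBoundedBlock (ctxText d.1.1.1) (1 + (d.1.1.2 * n d.1.1.1 + d.1.2))
      (1 + (d.2 * n d.1.1.1 + j')) (1 + m d.1.1.1 * n d.1.1.1) (m d.1.1.1) (r d.1.1.1) ∧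
    IsBoundedBlock (ctxText d.1.1.1) (1 + (d.1.1.2 * n d.1.1.1 + d.1.2))
      (1 + (d.2 * n d.1.1.1 + j')) (1 + m d.1.1.1 * n d.1.1.1 + m d.1.1.1 * r d.1.1.1)
      (r d.1.1.1) (n d.1.1.1)) ?_ hm.lift.lift fun d hd => hm' _ hd.fst.fst
  refine DefinablePred.exists_lt (P := fun d : (((α × ℕ) × ℕ) × ℕ) × ℕ =>
    AreBounds (ctxText d.1.1.1.1) (1 + (d.1.1.1.2 * n d.1.1.1.1 + d.1.1.2))
      (1 + (d.1.2 * n d.1.1.1.1 + d.2)) 1 (m d.1.1.1.1) (n d.1.1.1.1) ∧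
    IsBoundedBlock (ctxText d.1.1.1.1) (1 + (d.1.1.1.2 * n d.1.1.1.1 + d.1.1.2))
      (1 + (d.1.2 * n d.1.1.1.1 + d.2)) (1 + m d.1.1.1.1 * n d.1.1.1.1) (m d.1.1.1.1)
      (r d.1.1.1.1) ∧
    IsBoundedBlock (ctxText d.1.1.1.1) (1 + (d.1.1.1.2 * n d.1.1.1.1 + d.1.1.2))
      (1 + (d.1.2 * n d.1.1.1.1 + d.2)) (1 + m d.1.1.1.1 * n d.1.1.1.1 + m d.1.1.1.1 * r d.1.1.1.1)
      (r d.1.1.1.1) (n d.1.1.1.1)) ?_ hn.lift.lift.lift fun d hd => hn' _ hd.fst.fst.fst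
  have hi : Definable fun d : (((α × ℕ) × ℕ) × ℕ) × ℕ => d.1.1.1.2 :=
    ((Definable.var.lift (f := fun b : α × ℕ => b.2)).lift).lift
  have hj : Definable fun d : (((α × ℕ) × ℕ) × ℕ) × ℕ => d.1.1.2 :=
    (Definable.var.lift (f := fun b : (α × ℕ) × ℕ => b.2)).lift
  have hi' : Definable fun d : (((α × ℕ) × ℕ) × ℕ) × ℕ => d.1.2 :=
    Definable.var.lift (f := fun b : ((α × ℕ) × ℕ) × ℕ => b.2)
  have hj' : Definable fun d : (((α × ℕ) × ℕ) × ℕ) × ℕ => d.2 := Definable.var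
  have hn4 := hn.lift.lift.lift.lift
  have hg := (Definable.const 1).add ((hi.mul hn4).add hj)
  have hl := (Definable.const 1).add ((hi'.mul hn4).add hj')
  have hm4' : ∀ d : (((α × ℕ) × ℕ) × ℕ) × ℕ, Valid d → m d.1.1.1.1 ≤ cap d :=
    fun d hd => hm' _ hd.fst.fst.fst.fst
  have hn4' : ∀ d : (((α × ℕ) × ℕ) × ℕ) × ℕ, Valid d → n d.1.1.1.1 ≤ cap d :=
    fun d hd => hn' _ hd.fst.fst.fst.fst
  have hr4' : ∀ d : (((α × ℕ) × ℕ) × ℕ) × ℕ, Valid d → r d.1.1.1.1 ≤ cap d :=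
    fun d hd => hr' _ hd.fst.fst.fst.fst
  exact (definablePred_areBounds (α := (((α × ℕ) × ℕ) × ℕ) × ℕ) hg hl (.const 1)
      hm.lift.lift.lift.lift hn4 hm4' hn4').and
    ((definablePred_isBoundedBlock (α := (((α × ℕ) × ℕ) × ℕ) × ℕ) hg hl hb.lift.lift.lift.lift
      hm.lift.lift.lift.lift hr.lift.lift.lift.lift hm4' hr4').and
    (definablePred_isBoundedBlock (α := (((α × ℕ) × ℕ) × ℕ) × ℕ) hg hl hc.lift.lift.lift.lift
      hr.lift.lift.lift.lift hn4 hr4' hn4'))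

end Definability

/-- The number of letters from the first copy of the alphabet. -/
def inlCount (u : List (TextSymbol ⊕ TextSymbol)) : ℕ := u.countP Sum.isLeft

/-- A word is an input followed by a factorization certificate. -/
def IsCertifiedWord (u : List (TextSymbol ⊕ TextSymbol)) : Prop :=
  (mergedText u).foldl scanStep 0 = 0 ∧
  tokenStart (mergedText u) (sepCount (mergedText u) (inlCount u)) = inlCount u ∧
  ∃ m < (mergedText u).length, ∃ n < (mergedText u).length,
    IsFactorizationText (mergedText u) (sepCount (mergedText u) (inlCount u)) m n
      (min (headValue (mergedText u)) (min m n))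

theorem definable_inlCount : Definable inlCount := by
  classical
  have h1 : DefinablePred fun b : List (TextSymbol ⊕ TextSymbol) × ℕ =>
      ∃ c, b.1[b.2]? = some (Sum.inl c) :=
    DefinablePred.read (α := List (TextSymbol ⊕ TextSymbol) × ℕ)
      (fun o => ∃ c, o = some (Sum.inl c)) Definable.var
  refine (Definable.count h1 Definable.length_word fun a _ => ?_).congr fun a _ => ?_
  · rw [cap_eq]
    omega
  · suffices h : ∀ k, Nat.count (fun x => ∃ c, a[x]? = some (Sum.inl c)) k =
        (a.take k).countP Sum.isLeft by
      refine (h _).trans ?_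
      change (a.take a.length).countP _ = _
      rw [List.take_length, inlCount]
    intro k
    induction k with
    | zero => simp
    | succ k ih =>
      rw [Nat.count_succ, ih, List.take_add_one, List.countP_append]
      congr 1
      rcases a[k]? with _ | (c | c)
      · simp
      · simp
      · simp

theorem definablePred_isCertifiedWord : DefinablePred IsCertifiedWord := by
  have hX : Definable fun u : List (TextSymbol ⊕ TextSymbol) =>
      sepCount (ctxText u) (inlCount u) := definable_sepCount definable_inlCount
  have hlen : ∀ u : List (TextSymbol ⊕ TextSymbol), (ctxText u).length ≤ cap u := fun u => by
    have := length_ctxText_lt u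
    omega
  refine DefinablePred.and (P := fun u : List (TextSymbol ⊕ TextSymbol) =>
    (ctxText u).foldl scanStep 0 = 0) ?_ (DefinablePred.and
    (P := fun u : List (TextSymbol ⊕ TextSymbol) =>
    tokenStart (ctxText u) (sepCount (ctxText u) (inlCount u)) = inlCount u) ?_ ?_)
  · exact DefinablePred.eq definable_scan (Definable.const 0) fun u _ => one_le_cap u
  · refine DefinablePred.eq (definable_tokenStart hX) definable_inlCount fun u _ => ?_
    have h1 := length_ctxText_lt u
    rw [length_ctxText] at h1
    have h2 : inlCount u ≤ u.length := List.countP_le_length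
    change _ + 200 < _ at h1
    have h3 : (word u).length = u.length := rfl
    omega
  · refine DefinablePred.exists_lt (P := fun b : List (TextSymbol ⊕ TextSymbol) × ℕ =>
      ∃ n < (ctxText b.1).length, IsFactorizationText (ctxText b.1)
        (sepCount (ctxText b.1) (inlCount b.1)) b.2 n (min (headValue (ctxText b.1)) (min b.2 n)))
      ?_ definable_length fun u _ => hlen u
    refine DefinablePred.exists_lt (P := fun b : (List (TextSymbol ⊕ TextSymbol) × ℕ) × ℕ =>
      IsFactorizationText (ctxText b.1.1) (sepCount (ctxText b.1.1) (inlCount b.1.1)) b.1.2 b.2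
        (min (headValue (ctxText b.1.1)) (min b.1.2 b.2)))
      ?_ definable_length.lift fun b _ => hlen b.1
    have hm : Definable fun b : (List (TextSymbol ⊕ TextSymbol) × ℕ) × ℕ => b.1.2 :=
      Definable.var.lift (f := fun b : List (TextSymbol ⊕ TextSymbol) × ℕ => b.2)
    have hn : Definable fun b : (List (TextSymbol ⊕ TextSymbol) × ℕ) × ℕ => b.2 := Definable.var
    have hm' : ∀ b : (List (TextSymbol ⊕ TextSymbol) × ℕ) × ℕ, Valid b → b.1.2 ≤ cap b :=
      fun b hb => hb.fst.snd_le
    have hK : ∀ b : (List (TextSymbol ⊕ TextSymbol) × ℕ) × ℕ, Valid b →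
        headValue (ctxText b.1.1) ≤ cap b := fun b _ => (headValue_le _).trans (hlen b.1.1)
    exact definablePred_isFactorizationText (α := (List (TextSymbol ⊕ TextSymbol) × ℕ) × ℕ)
      hX.lift.lift hm hn
      (Definable.min definable_headValue.lift.lift (Definable.min hm hn hm') hK)
      (fun b _ => by
        have := sepCount_lt_cap b.1.1 (inlCount b.1.1)
        change _ < cap b.1.1
        omega) hm' (fun b hb => hb.snd_le) (fun b hb => (min_le_left _ _).trans (hK b hb))

/-! ### Matrices as sequences of integers -/

section Block

/-- The entries of a matrix, with an end-of-line mark at the last entry of each row. -/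
def matrixTokens {m n : ℕ} (A : Matrix (Fin m) (Fin n) ℤ) : List (ℤ × Bool) :=
  List.ofFn fun q : Fin (m * n) => (A q.divNat q.modNat, decide (n ≤ (q.modNat : ℕ) + 1))

theorem length_matrixTokens {m n : ℕ} (A : Matrix (Fin m) (Fin n) ℤ) :
    (matrixTokens A).length = m * n := List.length_ofFn

theorem index_lt {m n i j : ℕ} (hi : i < m) (hj : j < n) : i * n + j < m * n :=
  calc i * n + j < (i + 1) * n := by rw [Nat.succ_mul]; omega
    _ ≤ m * n := Nat.mul_le_mul_right _ hi

theorem divNat_mk {m n : ℕ} (i : Fin m) (j : Fin n) (h : (i : ℕ) * n + j < m * n) :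
    (⟨i * n + j, h⟩ : Fin (m * n)).divNat = i := by
  apply Fin.ext
  simp only [Fin.coe_divNat]
  rw [Nat.add_comm, Nat.add_mul_div_right _ _ j.pos, Nat.div_eq_of_lt j.2, Nat.zero_add]

theorem modNat_mk {m n : ℕ} (i : Fin m) (j : Fin n) (h : (i : ℕ) * n + j < m * n) :
    (⟨i * n + j, h⟩ : Fin (m * n)).modNat = j := by
  apply Fin.ext
  simp only [Fin.coe_modNat]
  rw [Nat.add_comm, Nat.add_mul_mod_self_right, Nat.mod_eq_of_lt j.2]

theorem intercalate_intText (l : List ℤ) (x : ℤ) :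
    [TextSymbol.space].intercalate ((l ++ [x]).map intText) =
      tokensText (l.map fun y => (y, false)) ++ intText x := by
  induction l with
  | nil => simp [List.intercalate]
  | cons y l ih =>
    have h : ∃ b s, (l ++ [x]).map intText = b :: s := by
      cases l <;> simp
    obtain ⟨b, s, h⟩ := h
    rw [List.cons_append, List.map_cons, h, List.intercalate_cons_cons, ← h, ih]
    simp [tokenText, sepSymbol]

theorem rowText_eq {n : ℕ} (hn : 0 < n) (v : Fin n → ℤ) :
    rowText v = tokensText (List.ofFn fun j : Fin n => (v j, decide (n ≤ (j : ℕ) + 1))) := by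
  obtain ⟨n, rfl⟩ := Nat.exists_eq_succ_of_ne_zero hn.ne'
  have h1 : (List.ofFn fun j => intText (v j)) =
      ((List.ofFn fun j : Fin n => v j.castSucc) ++ [v (Fin.last n)]).map intText := by
    rw [← List.ofFn_succ_last, List.map_ofFn]
    rfl
  have h2 : (List.ofFn fun j : Fin n => (v j.castSucc, decide (n + 1 ≤ (j : ℕ) + 1))) =
      (List.ofFn fun j : Fin n => v j.castSucc).map fun y => (y, false) := by
    rw [List.map_ofFn]
    congr 1
    funext j
    have := j.2
    simp
  rw [rowText, h1, intercalate_intText, List.ofFn_succ_last]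
  simp only [Fin.val_castSucc, Fin.val_last]
  rw [h2, tokensText_append]
  simp [tokenText, sepSymbol]

theorem tokensText_flatten (l : List (List (ℤ × Bool))) :
    tokensText l.flatten = (l.map tokensText).flatten := by
  induction l with
  | nil => rfl
  | cons a l ih => simp [ih]

theorem matrixText_eq {m n : ℕ} (hn : 0 < n) (A : Matrix (Fin m) (Fin n) ℤ) :
    matrixText A = tokensText (matrixTokens A) := by
  rw [matrixTokens, List.ofFn_mul, tokensText_flatten, List.map_ofFn, matrixText]
  congr 2
  funext i
  simp only [Function.comp, divNat_mk, modNat_mk]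
  exact rowText_eq hn _

/-- From the index `o` on, the entries of a matrix appear in a sequence of integers. -/
def HasBlock {m n : ℕ} (E : List (ℤ × Bool)) (o : ℕ) (A : Matrix (Fin m) (Fin n) ℤ) : Prop :=
  ∀ (i : Fin m) (j : Fin n), E[o + ((i : ℕ) * n + j)]? = some (A i j, decide (n ≤ (j : ℕ) + 1))

variable {m n k : ℕ}

theorem hasBlock_append (E F : List (ℤ × Bool)) (A : Matrix (Fin m) (Fin n) ℤ) :
    HasBlock (E ++ (matrixTokens A ++ F)) E.length A := by
  intro i j
  have h := index_lt i.2 j.2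
  rw [List.getElem?_append_right (by omega), Nat.add_sub_cancel_left,
    List.getElem?_append_left (by rwa [length_matrixTokens]), matrixTokens, List.getElem?_ofFn,
    dif_pos h, divNat_mk, modNat_mk]

theorem HasBlock.getElem?_eq {E F : List (ℤ × Bool)} {o q : ℕ} {A : Matrix (Fin m) (Fin n) ℤ}
    (hE : HasBlock E o A) (hF : HasBlock F o A) (h1 : o ≤ q) (h2 : q < o + m * n) :
    E[q]? = F[q]? := by
  have hn : 0 < n := Nat.pos_of_ne_zero fun h => by simp [h] at h2; omega
  have hi : (q - o) / n < m := Nat.div_lt_of_lt_mul (by rw [Nat.mul_comm]; omega)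
  have h3 := hE ⟨_, hi⟩ ⟨_, Nat.mod_lt (q - o) hn⟩
  have h4 := hF ⟨_, hi⟩ ⟨_, Nat.mod_lt (q - o) hn⟩
  simp only [Nat.div_add_mod', Nat.add_sub_cancel' h1] at h3 h4
  rw [h3, h4]

theorem hasBlock_of_isBlock {E : List (ℤ × Bool)} {o : ℕ} (hE : o + m * n ≤ E.length)
    (h : IsBlock (tokensText E) o m n) :
    ∃ A : Matrix (Fin m) (Fin n) ℤ, HasBlock E o A := by
  -- The default is never used, as all these indices lie within `E`. The separators are forced by
  -- `IsBlock`.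
  refine ⟨fun i j => (E[o + ((i : ℕ) * n + j)]?.getD (0, false)).1, fun i j => ?_⟩
  have hlt := index_lt i.2 j.2
  obtain ⟨a, ha⟩ : ∃ a, E[o + ((i : ℕ) * n + j)]? = some a :=
    ⟨_, List.getElem?_eq_getElem (by omega)⟩
  have h1 := (isLastToken_iff ha).symm.trans (h i i.2 j j.2)
  simp only [ha, Option.getD_some, Option.some.injEq]
  refine Prod.ext rfl ?_
  rw [Bool.eq_iff_iff, h1, decide_eq_true_eq]

theorem HasBlock.isBlock {E : List (ℤ × Bool)} {o : ℕ} {A : Matrix (Fin m) (Fin n) ℤ}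
    (h : HasBlock E o A) : IsBlock (tokensText E) o m n := by
  intro i hi j hj
  rw [isLastToken_iff (h ⟨i, hi⟩ ⟨j, hj⟩), decide_eq_true_eq]

theorem isBoundedBlock_iff {E : List (ℤ × Bool)} {o g l : ℕ} {a b : ℤ × Bool}
    {A : Matrix (Fin m) (Fin n) ℤ} (h : HasBlock E o A) (hg : E[g]? = some a)
    (hl : E[l]? = some b) :
    IsBoundedBlock (tokensText E) g l o m n ↔ ∀ i j, |A i j| ≤ |a.1| + |b.1| := by
  constructor
  · intro h1 i j
    have h2 := (nonnegSum_iff hg hl (h i j) _ _ _).1 (h1 i i.2 j j.2)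
    simp only [SummandKind.value] at h2
    linarith
  · intro h1 i hi j hj
    refine (nonnegSum_iff hg hl (h ⟨i, hi⟩ ⟨j, hj⟩) _ _ _).2 ?_
    have h2 := h1 ⟨i, hi⟩ ⟨j, hj⟩
    simp only [SummandKind.value]
    linarith

/-- A comparison of two integers is a sum of three with a dummy zero summand at index `0`; `h0`
merely says that this index exists. -/
theorem areBounds_iff {E : List (ℤ × Bool)} {o g l : ℕ} {a b c : ℤ × Bool}
    {A : Matrix (Fin m) (Fin n) ℤ} (h : HasBlock E o A) (h0 : E[0]? = some c) (hg : E[g]? = some a)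
    (hl : E[l]? = some b) :
    AreBounds (tokensText E) g l o m n ↔ ∀ i j, A i j ≤ a.1 ∧ b.1 ≤ A i j := by
  constructor
  · intro h1 i j
    have h2 := (nonnegSum_iff hg (h i j) h0 _ _ _).1 (h1 i i.2 j j.2).1
    have h3 := (nonnegSum_iff (h i j) hl h0 _ _ _).1 (h1 i i.2 j j.2).2
    simp only [SummandKind.value] at h2 h3
    constructor <;> linarith
  · intro h1 i hi j hj
    have h2 := h1 ⟨i, hi⟩ ⟨j, hj⟩
    refine ⟨(nonnegSum_iff hg (h ⟨i, hi⟩ ⟨j, hj⟩) h0 _ _ _).2 ?_,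
      (nonnegSum_iff (h ⟨i, hi⟩ ⟨j, hj⟩) hl h0 _ _ _).2 ?_⟩ <;>
      simp only [SummandKind.value] <;> linarith

theorem isProductBlock_iff {E : List (ℤ × Bool)} {o b c : ℕ} {A : Matrix (Fin m) (Fin n) ℤ}
    {B : Matrix (Fin m) (Fin k) ℤ} {C : Matrix (Fin k) (Fin n) ℤ} (hA : HasBlock E o A)
    (hB : HasBlock E b B) (hC : HasBlock E c C) :
    IsProductBlock (tokensText E) o b c m n k ↔ IsTropicalProduct B C A := by
  constructor
  · intro h i j
    obtain ⟨h1, t, ht, h2⟩ := h i i.2 j j.2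
    have hle : ∀ t, A i j ≤ B i t + C t j := fun t => by
      have h3 := (nonnegSum_iff (hB i t) (hC t j) (hA i j) _ _ _).1 (h1 t t.2)
      simp only [SummandKind.value] at h3
      linarith
    refine ⟨⟨⟨t, ht⟩, ?_⟩, ?_⟩
    · have h3 := (nonnegSum_iff (hA i j) (hB i ⟨t, ht⟩) (hC ⟨t, ht⟩ j) _ _ _).1 h2
      simp only [SummandKind.value] at h3
      have := hle ⟨t, ht⟩
      simp only
      linarith
    · rintro _ ⟨t, rfl⟩
      exact hle t
  · intro h i hi j hj
    obtain ⟨⟨t, ht⟩, h1⟩ := h ⟨i, hi⟩ ⟨j, hj⟩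
    refine ⟨fun s hs => ?_, t, t.2, ?_⟩
    · refine (nonnegSum_iff (hB ⟨i, hi⟩ ⟨s, hs⟩) (hC ⟨s, hs⟩ ⟨j, hj⟩) (hA ⟨i, hi⟩ ⟨j, hj⟩)
        _ _ _).2 ?_
      have := h1 ⟨⟨s, hs⟩, rfl⟩
      simp only [SummandKind.value] at this ⊢
      linarith
    · refine (nonnegSum_iff (hA ⟨i, hi⟩ ⟨j, hj⟩) (hB ⟨i, hi⟩ t) (hC t ⟨j, hj⟩) _ _ _).2 ?_
      simp only [SummandKind.value] at ht ⊢
      linarith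

/-- The text of a number, a matrix and two factors is a factorization text if and only if the
factorization is bounded. -/
theorem isBoundedFactorization_iff {E : List (ℤ × Bool)} {o b c : ℕ} {x : ℤ × Bool}
    {A : Matrix (Fin m) (Fin n) ℤ} {B : Matrix (Fin m) (Fin k) ℤ} {C : Matrix (Fin k) (Fin n) ℤ}
    (h0 : E[0]? = some x) (hA : HasBlock E o A) (hB : HasBlock E b B) (hC : HasBlock E c C) :
    IsBoundedFactorization A B C ↔
      (∃ i < m, ∃ j < n, ∃ i' < m, ∃ j' < n,
        AreBounds (tokensText E) (o + (i * n + j)) (o + (i' * n + j')) o m n ∧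
        IsBoundedBlock (tokensText E) (o + (i * n + j)) (o + (i' * n + j')) b m k ∧
        IsBoundedBlock (tokensText E) (o + (i * n + j)) (o + (i' * n + j')) c k n) ∧
      IsProductBlock (tokensText E) o b c m n k := by
  rw [IsBoundedFactorization, isProductBlock_iff hA hB hC, and_comm]
  refine and_congr_left fun _ => ?_
  constructor
  · rintro ⟨_, _, ⟨⟨⟨i, j⟩, rfl⟩, hg⟩, ⟨⟨⟨i', j'⟩, rfl⟩, hl⟩, h1, h2⟩
    refine ⟨i, i.2, j, j.2, i', i'.2, j', j'.2, (areBounds_iff hA h0 (hA i j) (hA i' j')).2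
      fun s t => ⟨hg ⟨(s, t), rfl⟩, hl ⟨(s, t), rfl⟩⟩,
      (isBoundedBlock_iff hB (hA i j) (hA i' j')).2 h1,
      (isBoundedBlock_iff hC (hA i j) (hA i' j')).2 h2⟩
  · rintro ⟨i, hi, j, hj, i', hi', j', hj', h1, h2, h3⟩
    have hg := hA ⟨i, hi⟩ ⟨j, hj⟩
    have hl := hA ⟨i', hi'⟩ ⟨j', hj'⟩
    have h4 := (areBounds_iff hA h0 hg hl).1 h1
    refine ⟨A ⟨i, hi⟩ ⟨j, hj⟩, A ⟨i', hi'⟩ ⟨j', hj'⟩, ⟨⟨(⟨i, hi⟩, ⟨j, hj⟩), rfl⟩, ?_⟩,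
      ⟨⟨(⟨i', hi'⟩, ⟨j', hj'⟩), rfl⟩, ?_⟩, (isBoundedBlock_iff hB hg hl).1 h2,
      (isBoundedBlock_iff hC hg hl).1 h3⟩
    · rintro _ ⟨⟨s, t⟩, rfl⟩
      exact (h4 s t).1
    · rintro _ ⟨⟨s, t⟩, rfl⟩
      exact (h4 s t).2

end Block

theorem mergedText_pairWord (x w : List TextSymbol) : mergedText (pairWord (x, w)) = x ++ w := by
  simp [mergedText, pairWord, Function.comp_def]

theorem inlCount_pairWord (x w : List TextSymbol) : inlCount (pairWord (x, w)) = x.length := by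
  simp [inlCount, pairWord, List.countP_map, Function.comp_def]

/-- The integers in an instance, a matrix `B` and a matrix `C`. -/
def certificateTokens {m n r : ℕ} (k : ℕ) (A : Matrix (Fin m) (Fin n) ℤ)
    (B : Matrix (Fin m) (Fin r) ℤ) (C : Matrix (Fin r) (Fin n) ℤ) : List (ℤ × Bool) :=
  ((k : ℤ), true) :: (matrixTokens A ++ (matrixTokens B ++ matrixTokens C))

section Certificate

variable {m n r k : ℕ} {A : Matrix (Fin m) (Fin n) ℤ} {B : Matrix (Fin m) (Fin r) ℤ}
  {C : Matrix (Fin r) (Fin n) ℤ}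

theorem instanceText_eq (hn : 0 < n) (k : ℕ) (A : Matrix (Fin m) (Fin n) ℤ) :
    instanceText A k = tokensText (((k : ℤ), true) :: matrixTokens A) := by
  rw [instanceText, matrixText_eq hn, tokensText_cons]
  rfl

theorem length_certificateTokens :
    (certificateTokens k A B C).length = 1 + m * n + m * r + r * n := by
  simp only [certificateTokens, List.length_cons, List.length_append, length_matrixTokens]
  omega

theorem hasBlock_left : HasBlock (certificateTokens k A B C) 1 A :=
  hasBlock_append [((k : ℤ), true)] _ A

theorem hasBlock_middle : HasBlock (certificateTokens k A B C) (1 + m * n) B := by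
  have h := hasBlock_append (((k : ℤ), true) :: matrixTokens A) (matrixTokens C) B
  rw [List.length_cons, length_matrixTokens, Nat.add_comm] at h
  exact h

theorem hasBlock_right : HasBlock (certificateTokens k A B C) (1 + m * n + m * r) C := by
  have h := hasBlock_append (((k : ℤ), true) :: (matrixTokens A ++ matrixTokens B)) [] C
  rw [List.length_cons, List.length_append, length_matrixTokens, length_matrixTokens,
    Nat.add_comm, ← Nat.add_assoc] at h
  simpa [certificateTokens] using h

/-- The leading number and the three blocks exhaust the indices below the length. -/
theorem eq_certificateTokens {E : List (ℤ × Bool)} (hE : E.length = 1 + m * n + m * r + r * n)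
    (h0 : E[0]? = some ((k : ℤ), true)) (hA : HasBlock E 1 A) (hB : HasBlock E (1 + m * n) B)
    (hC : HasBlock E (1 + m * n + m * r) C) : E = certificateTokens k A B C := by
  apply List.ext_getElem?
  intro q
  rcases Nat.eq_zero_or_pos q with rfl | h1
  · rw [h0]
    rfl
  rcases lt_or_ge q (1 + m * n) with h2 | h2
  · exact hA.getElem?_eq hasBlock_left h1 h2
  rcases lt_or_ge q (1 + m * n + m * r) with h3 | h3
  · exact hB.getElem?_eq hasBlock_middle h2 h3
  rcases lt_or_ge q (1 + m * n + m * r + r * n) with h4 | h4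
  · exact hC.getElem?_eq hasBlock_right h3 h4
  · rw [List.getElem?_eq_none (by omega),
      List.getElem?_eq_none (by rw [length_certificateTokens]; omega)]

end Certificate

/-- Scanning makes `x ++ w` a sequence of integers, and the blocks turn this sequence into `k`, `A`,
`B`, `C`. The boundary between `x` and `w` is required to be the start of an integer, and `1 + m *
n` separators lie before it, so it falls exactly between `A` and `B`. -/
theorem isCertifiedWord_iff (x w : List TextSymbol) :
    IsCertifiedWord (pairWord (x, w)) ↔ IsFactorizationCertificate x w := by
  rw [IsCertifiedWord, mergedText_pairWord, inlCount_pairWord, scan_eq_zero_iff]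
  constructor
  · rintro ⟨⟨E, hE⟩, hx, m, hm, n, hn, ⟨hm1, hn1, hr1, hneg, hlast, hs, hlen⟩, ⟨hA, hB, hC⟩, hF⟩
    rw [hE] at hx hm hn hneg hlast hs hlen hr1 hA hB hC hF
    rw [sepCount_length] at hlen
    obtain ⟨a, ha⟩ : ∃ a, E[0]? = some a := ⟨_, List.getElem?_eq_getElem (by omega)⟩
    rw [isNegToken_iff ha] at hneg
    rw [isLastToken_iff ha] at hlast
    obtain ⟨k, hk⟩ := Int.eq_ofNat_of_zero_le (not_lt.1 hneg)
    have ha' : E[0]? = some ((k : ℤ), true) := by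
      rw [ha, ← hk, ← hlast]
    -- Cutting `k` off at the text length is invisible, because `m` and `n` are below that length.
    have hr : min (headValue (tokensText E)) (min m n) = min k (min m n) := by
      rw [headValue_eq ha', Int.natAbs_natCast]
      omega
    rw [hr] at hr1 hlen hB hC hF
    rw [← hs] at hx
    obtain ⟨A, hA'⟩ := hasBlock_of_isBlock (by omega) hA
    obtain ⟨B, hB'⟩ := hasBlock_of_isBlock (by omega) hB
    obtain ⟨C, hC'⟩ := hasBlock_of_isBlock (by omega) hC
    have hbf := (isBoundedFactorization_iff ha hA' hB' hC').2 hF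
    have hEq := eq_certificateTokens hlen.symm ha' hA' hB' hC'
    refine ⟨m, n, k, A, B, C, hm1, hn1, by omega, ?_, ?_, hbf⟩
    all_goals
      rw [tokenStart_tokensText (by omega)] at hx
      have h1 : x ++ w = tokensText (E.take (1 + m * n)) ++ tokensText (E.drop (1 + m * n)) := by
        rw [hE, ← tokensText_append, List.take_append_drop]
      -- Both decompositions of the same word have first parts of equal length.
      obtain ⟨h2, h3⟩ := List.append_inj h1 hx.symm
    · rw [h2, instanceText_eq hn1]
      congr 1
      conv_lhs => rw [hEq]
      rw [certificateTokens, ← List.cons_append, List.take_left']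
      rw [List.length_cons, length_matrixTokens, Nat.add_comm]
    · rw [h3, matrixText_eq (by omega), matrixText_eq hn1, ← tokensText_append]
      congr 1
      conv_lhs => rw [hEq]
      rw [certificateTokens, ← List.cons_append, List.drop_left']
      rw [List.length_cons, length_matrixTokens, Nat.add_comm]
  · rintro ⟨m, n, k, A, B, C, hm, hn, hk, rfl, rfl, hbf⟩
    have hz : instanceText A k ++ (matrixText B ++ matrixText C) =
        tokensText (certificateTokens k A B C) := by
      rw [instanceText_eq hn, matrixText_eq (by omega), matrixText_eq hn, ← tokensText_append,
        ← tokensText_append]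
      rfl
    have hx : instanceText A k = tokensText ((certificateTokens k A B C).take (1 + m * n)) := by
      rw [instanceText_eq hn, certificateTokens, ← List.cons_append, List.take_left']
      rw [List.length_cons, length_matrixTokens, Nat.add_comm]
    have h0 : (certificateTokens k A B C)[0]? = some ((k : ℤ), true) := rfl
    have hlen := length_certificateTokens (k := k) (A := A) (B := B) (C := C)
    have hx1 : (instanceText A k).length =
        tokenStart (tokensText (certificateTokens k A B C)) (1 + m * n) := by
      rw [hx, tokenStart_tokensText (by omega)]
    have hsep : sepCount (tokensText (certificateTokens k A B C)) (instanceText A k).length =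
        1 + m * n := by
      rw [sepCount, ← hz, List.take_left, instanceText_eq hn, countP_isSep_tokensText,
        List.length_cons, length_matrixTokens, Nat.add_comm]
    have hle : (certificateTokens k A B C).length ≤
        (tokensText (certificateTokens k A B C)).length := by
      rw [← countP_isSep_tokensText]
      exact List.countP_le_length
    -- The witnesses `m` and `n` lie below the text length: they are at most `m * n`, which is less
    -- than the number of integers and hence of symbols.
    have hmn : m ≤ m * n := Nat.le_mul_of_pos_right _ hn
    have hnm : n ≤ m * n := Nat.le_mul_of_pos_left _ hm
    have hr' : min (headValue (tokensText (certificateTokens k A B C))) (min m n) =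
        min k (min m n) := by
      rw [headValue_eq h0, Int.natAbs_natCast]
      omega
    rw [hz, hsep]
    refine ⟨⟨_, rfl⟩, hx1.symm, m, by omega, n, by omega, ?_⟩
    rw [hr']
    refine ⟨⟨hm, hn, by omega, ?_, ?_, rfl, ?_⟩, ⟨hasBlock_left.isBlock, hasBlock_middle.isBlock,
      hasBlock_right.isBlock⟩,
      (isBoundedFactorization_iff h0 hasBlock_left hasBlock_middle hasBlock_right).1 hbf⟩
    · rw [isNegToken_iff h0]
      simp
    · rw [isLastToken_iff h0]
    · rw [sepCount_length, hlen]

/-! ### Certificates of polynomial length -/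

theorem length_tokensText_le {E : List (ℤ × Bool)} {c : ℕ} (hc : 0 < c)
    (h : ∀ a ∈ E, a.1.natAbs < 10 ^ c) : (tokensText E).length ≤ E.length * (c + 2) := by
  induction E with
  | nil => simp
  | cons a E ih =>
    have h1 := ih fun b hb => h b (List.mem_cons_of_mem _ hb)
    have h2 := length_natText_le (h a List.mem_cons_self) hc
    rw [tokensText_cons, List.length_append, List.length_cons, Nat.succ_mul]
    simp only [tokenText, intText, List.length_append, List.length_cons, List.length_nil]
    omega

theorem length_le_length_tokensText (E : List (ℤ × Bool)) : E.length ≤ (tokensText E).length := by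
  rw [← countP_isSep_tokensText]
  exact List.countP_le_length

theorem length_matrixText_le {m n c : ℕ} (hn : 0 < n) (hc : 0 < c) (A : Matrix (Fin m) (Fin n) ℤ)
    (h : ∀ i j, (A i j).natAbs < 10 ^ c) : (matrixText A).length ≤ m * n * (c + 2) := by
  rw [matrixText_eq hn, ← length_matrixTokens A]
  refine length_tokensText_le hc fun a ha => ?_
  rw [matrixTokens, List.mem_ofFn] at ha
  obtain ⟨q, rfl⟩ := ha
  exact h _ _

theorem natAbs_lt_of_instanceText {m n : ℕ} (A : Matrix (Fin m) (Fin n) ℤ) (k : ℕ) (i : Fin m)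
    (j : Fin n) : (A i j).natAbs < 10 ^ (instanceText A k).length := by
  rw [instanceText_eq j.pos]
  have h := hasBlock_append [((k : ℤ), true)] [] A i j
  rw [List.append_nil] at h
  exact natAbs_lt_pow_length h

theorem mul_le_length_instanceText {m n : ℕ} (hn : 0 < n) (A : Matrix (Fin m) (Fin n) ℤ) (k : ℕ) :
    m * n ≤ (instanceText A k).length := by
  rw [instanceText_eq hn]
  refine le_trans ?_ (length_le_length_tokensText _)
  rw [List.length_cons, length_matrixTokens]
  omega

theorem IsBoundedFactorization.length_le {m n k r : ℕ} {A : Matrix (Fin m) (Fin n) ℤ}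
    {B : Matrix (Fin m) (Fin r) ℤ} {C : Matrix (Fin r) (Fin n) ℤ} (h : IsBoundedFactorization A B C)
    (hn : 0 < n) (hr : 0 < r) (hrm : r ≤ m) (hrn : r ≤ n) :
    (matrixText B ++ matrixText C).length ≤
      2 * (instanceText A k).length * ((instanceText A k).length + 3) := by
  obtain ⟨-, _, _, ⟨⟨⟨i, j⟩, rfl⟩, -⟩, ⟨⟨⟨i', j'⟩, rfl⟩, -⟩, hB, hC⟩ := h
  have h1 := natAbs_lt_of_instanceText A k i j
  have h2 := natAbs_lt_of_instanceText A k i' j'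
  have h3 := mul_le_length_instanceText hn A k
  set N := (instanceText A k).length
  -- Both entries of `A` are below `10 ^ N`, and `2 * 10 ^ N ≤ 10 ^ (N + 1)`: one more digit
  -- suffices.
  have h4 : ∀ x : ℤ, |x| ≤ |A i j| + |A i' j'| → x.natAbs < 10 ^ (N + 1) := fun x hx => by
    rw [pow_succ]
    simp only [Int.abs_eq_natAbs] at hx h1 h2
    omega
  have h5 := length_matrixText_le hr N.succ_pos B fun s t => h4 _ (hB s t)
  have h6 := length_matrixText_le hn N.succ_pos C fun s t => h4 _ (hC s t)
  rw [List.length_append]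
  calc _ ≤ m * r * (N + 1 + 2) + r * n * (N + 1 + 2) := add_le_add h5 h6
    _ ≤ N * (N + 1 + 2) + N * (N + 1 + 2) := by
      gcongr
      · exact (Nat.mul_le_mul_left m hrn).trans h3
      · exact (Nat.mul_le_mul_right n hrm).trans h3
    _ = _ := by ring

/-- Inner size `min k (min m n)` loses nothing by `factorRank_le_min`, and keeps the certificate
short even when `k` is exponential in the length of the input. -/
theorem mem_TMF_iff (x : List TextSymbol) :
    x ∈ TMF ↔ ∃ w : List TextSymbol, w.length ≤ 2 * x.length * (x.length + 3) ∧
      IsFactorizationCertificate x w := by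
  constructor
  · rintro ⟨m, n, k, A, hm, hn, hk, rfl, h⟩
    obtain ⟨B, C, hbf⟩ := (exists_boundedFactorization_iff hm hn A).2
      (le_min h (factorRank_le_min A.toReal))
    exact ⟨_, hbf.length_le hn (by omega) (by omega) (by omega), m, n, k, A, B, C, hm, hn, hk, rfl,
      rfl, hbf⟩
  · rintro ⟨w, -, m, n, k, A, B, C, hm, hn, hk, rfl, -, hbf⟩
    exact ⟨m, n, k, A, hm, hn, hk, rfl,
      ((exists_boundedFactorization_iff hm hn A).1 ⟨B, C, hbf⟩).trans (min_le_left _ _)⟩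

/-- The fixed prefix `u` is written by the machine itself before it reads its input; this is what
allows `k` to be fixed later. -/
theorem polyTimeDecidableRel_isFactorizationCertificate (u : List TextSymbol) :
    PolyTimeDecidableRel fun x w => IsFactorizationCertificate (u ++ x) w := by
  classical
  refine ⟨fun b => decide (IsFactorizationCertificate (u ++ b.1) b.2),
    fun x w => decide_eq_true_iff, ?_⟩
  refine definablePred_isCertifiedWord.nonempty_computableInPolyTime pairWord (u.map Sum.inl) _
    fun b => ?_
  rw [decide_eq_true_iff, ← isCertifiedWord_iff]
  simp [pairWord]

theorem isCertificateRel_TMF : IsCertificateRel TMF IsFactorizationCertificate := by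
  refine ⟨polyTimeDecidableRel_isFactorizationCertificate [],
    2 * Polynomial.X * (Polynomial.X + 3), fun x => ?_⟩
  rw [mem_TMF_iff]
  simp

/-! ### Instances with a fixed number -/

/-- A number is the sum of its decimal digits times powers of ten, and these digits are read from
the text. -/
theorem intText_injective_natCast {k l : ℕ} (h : intText k = intText l) : k = l := by
  have h1 : tokensText [((k : ℤ), true)] = tokensText [((l : ℤ), true)] := by
    simp [tokenText, h]
  have hk : [((k : ℤ), true)][0]? = some ((k : ℤ), true) := rfl
  have hl : [((l : ℤ), true)][0]? = some ((l : ℤ), true) := rfl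
  have h2 := natAbs_lt_pow_length hk
  have h3 := natAbs_lt_pow_length hl
  rw [← h1] at h3
  simp only [Int.natAbs_natCast] at h2 h3
  rw [← Nat.mod_eq_of_lt h2, ← Nat.mod_eq_of_lt h3, ← sum_digits, ← sum_digits]
  refine Finset.sum_congr rfl fun i _ => ?_
  have h4 := tokenDigit_eq hk i
  rw [h1, tokenDigit_eq hl i] at h4
  simp only [Int.natAbs_natCast] at h4
  rw [h4]

theorem newline_notMem_intText (z : ℤ) : TextSymbol.newline ∉ intText z := by
  intro h
  have h1 := countP_isSep_intText z
  rw [List.countP_eq_zero] at h1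
  exact h1 _ h rfl

/-- The numeral contains no end-of-line symbol, so the first such symbol delimits it. -/
theorem instanceText_eq_iff {m n k l : ℕ} (A : Matrix (Fin m) (Fin n) ℤ) (x : List TextSymbol) :
    intText k ++ [TextSymbol.newline] ++ x = instanceText A l ↔ k = l ∧ x = matrixText A := by
  constructor
  · intro h
    simp only [instanceText, List.append_assoc, List.singleton_append] at h
    have h1 := congrArg (List.takeWhile fun c => c ≠ TextSymbol.newline) h
    have h2 : ∀ (z : ℤ) (y : List TextSymbol), (intText z ++ TextSymbol.newline :: y).takeWhile
        (fun c => c ≠ TextSymbol.newline) = intText z := fun z y => by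
      rw [List.takeWhile_append_of_pos]
      · simp
      · exact fun c hc => decide_eq_true (ne_of_mem_of_not_mem hc (newline_notMem_intText z))
    rw [h2, h2] at h1
    rw [h1] at h
    exact ⟨intText_injective_natCast h1, by simpa using h⟩
  · rintro ⟨rfl, rfl⟩
    rfl

/-- Prepending the line with `k` reduces `k`-TMF to TMF; unique readability of the first line
prevents a different `k` from being read back. -/
theorem mem_kTMF_iff {k : ℕ} (hk : 0 < k) (x : List TextSymbol) :
    x ∈ kTMF k ↔ intText k ++ [TextSymbol.newline] ++ x ∈ TMF := by
  constructor
  · rintro ⟨m, n, A, hm, hn, rfl, h⟩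
    exact ⟨m, n, k, A, hm, hn, hk, rfl, (factorRank_le_iff hm hn _).2 h⟩
  · rintro ⟨m, n, l, A, hm, hn, hl, hx, h⟩
    obtain ⟨rfl, rfl⟩ := (instanceText_eq_iff A x).1 hx
    exact ⟨m, n, A, hm, hn, rfl, (factorRank_le_iff hm hn _).1 h⟩

theorem inNP_kTMF {k : ℕ} (hk : 0 < k) : InNP (kTMF k) := by
  refine ⟨TextSymbol, inferInstance, fun x w =>
    IsFactorizationCertificate (intText k ++ [TextSymbol.newline] ++ x) w,
    polyTimeDecidableRel_isFactorizationCertificate _,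
    2 * (Polynomial.X + Polynomial.C (intText k ++ [TextSymbol.newline]).length) *
      (Polynomial.X + Polynomial.C (intText k ++ [TextSymbol.newline]).length + 3), fun x => ?_⟩
  rw [mem_kTMF_iff hk, mem_TMF_iff, List.length_append (bs := x), Nat.add_comm _ x.length]
  simp only [Polynomial.eval_mul, Polynomial.eval_add, Polynomial.eval_X, Polynomial.eval_C,
    Polynomial.eval_ofNat]

theorem mainTheorem7 :
    -- TMF is in NP, with bounded integer factorizations as the certificates
    (InNP TMF ∧ IsCertificateRel TMF IsFactorizationCertificate) ∧
    -- a bounded integer factorization exists whenever the factor rank is at most `k`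
    (∀ (m n k : ℕ) (A : Matrix (Fin m) (Fin n) ℤ), 0 < m → 0 < n → 0 < k →
      factorRank A.toReal ≤ k →
      ∃ (B : Matrix (Fin m) (Fin k) ℤ) (C : Matrix (Fin k) (Fin n) ℤ),
        IsBoundedFactorization A B C) ∧
    -- for every fixed positive `k`, the problem `k`-TMF is in NP
    (∀ k : ℕ, 0 < k → InNP (kTMF k)) := by
  refine ⟨⟨⟨TextSymbol, inferInstance, _, isCertificateRel_TMF⟩, isCertificateRel_TMF⟩, ?_, ?_⟩
  · intro m n k A hm hn _ h
    exact (exists_boundedFactorization_iff hm hn A).2 h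
  · exact fun k hk => inNP_kTMF hk
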